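/- \textbf{Theorem (FPAIF, simultaneous generalization).} \emph{Setting.} Let $\mathcal P$ be a probability distribution over individuals $x\in\mathcal X$ and $\mathcal Q$ one over problems $f\in\mathcal F$, $f:\mathcal X\to\{0,1\}$. Let $\mathcal H$ be a class of functions $\mathcal X\to\{0,1\}$ that contains the two constant functions and has finite VC dimension $d_{\mathcal H}$. A mapping $\psi\in\Delta(\mathcal H)^{\mathcal F}$ assigns to each $f$ a distribution $\psi_f$ over $\mathcal H$. Put $\rho_x=\Pr_{f\sim\mathcal Q}[f(x)=0]$, $\rho_{\inf}=\inf_{x\in\mathcal X}\rho_x$ (assumed positive), $$\mathrm{E}_{\mathrm{FP}}(x,\psi;\mathcal Q)=\tfrac1{\rho_x}\,\mathbb E_{f\sim\mathcal Q}\Pr_{h\sim\psi_f}[h(x)=1,\,f(x)=0],\qquad \mathrm{err}(\psi;\mathcal P,\mathcal Q)=\mathbb E_{x\sim\mathcal P}\,\mathbb E_{f\sim\mathcal Q}\Pr_{h\sim\psi_f}[h(x)\ne f(x)].$$ The mapping $\psi$ is $(\alpha,\beta)$-FPAIF with respect to $(\mathcal P,\mathcal Q)$ if $\Pr_{x\sim\mathcal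 P}\big(|\mathrm{E}_{\mathrm{FP}}(x,\psi;\mathcal Q)-\gamma|>\alpha\big)\le\beta$ for some $\gamma\ge0$. $\mathrm{OPT}(\alpha;\mathcal P,\mathcal Q)$ is the infimum of $\mathrm{err}(\psi;\mathcal P,\mathcal Q)$ over all pairs $\psi\in\Delta(\mathcal H)^{\mathcal F}$, $\gamma\in[0,1]$ with $|\mathrm{E}_{\mathrm{FP}}(x,\psi;\mathcal Q)-\gamma|\le\alpha$ for all $x\in\mathcal X$. \emph{Algorithm.} Given are $X=(x_1,\dots,x_n)\sim\mathcal P^n$, independent $F=(f_1,\dots,f_m)\sim\mathcal Q^m$, and estimates $\tilde\rho_1,\dots,\tilde\rho_n$ that may depend on $X$ and on additional randomness but, jointly with $X$, are independent of $F$. The oracle $CSC$ returns, for data $(x_i,c_i^1,c_i^0)_{i\le n}$, a minimizer over $h\in\mathcal H$ of $\sum_i\{c_i^1h(x_i)+c_i^0(1-h(x_i))\}$ (measurably in the data). Set $$B=\tfrac{1+2\nu}{\alpha},\quad T=\Big\lceil\tfrac{16B^2(1+2\alpha)^2\log(2n+1)}{\nu^2}\Big\rceil,\quad \eta=\tfrac{\nu}{4(1+2\alpha)^2B},$$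 assume $m_0=m/T$ is an integer and that almost surely $|\tilde\rho_i-\rho_{x_i}|\le\sqrt{\log n/(2m_0)}$ for all $i$. Partition $F$ uniformly at random (independently of everything else) into batches $F_1,\dots,F_T$ of size $m_0$, and let $\theta_1=0\in\mathbb R^{2n}$. In round $t=1,\dots,T$: $\lambda_{i,t}^{\pm}=B\,e^{\theta_{i,t}^{\pm}}/(1+\sum_{i',\bullet}e^{\theta_{i',t}^{\bullet}})$; $w_{i,t}=\lambda_{i,t}^+-\lambda_{i,t}^-$; $\gamma_t=\mathbf 1[\sum_iw_{i,t}>0]$; for every $f$, let $h_{f,t}$ be the output of $CSC$ with costs $c_i^1=(w_{i,t}/\tilde\rho_i+1/n)(1-f(x_i))$ and $c_i^0=f(x_i)/n$; with $\hat e_{i,t}=\#\{f\in F_t:h_{f,t}(x_i)=1,f(x_i)=0\}/\#\{f\in F_t:f(x_i)=0\}$ (and $0/0=0$), update $\theta_{i,t+1}^{+}=\theta_{i,t}^{+}+\eta(\hat e_{i,t}-\gamma_t-2\alpha)$, $\theta_{i,t+1}^{-}=\theta_{i,t}^{-}+\eta(\gamma_t-\hat e_{i,t}-2\alpha)$. The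 outputs are $\hat\gamma=\frac1T\sum_t\gamma_t$ and the mapping $\hat\psi$, where $\hat\psi_f$ is the uniform distribution over $h_{f,1},\dots,h_{f,T}$. \emph{Claim.} There are absolute constants $C,K>0$ and $k\in\mathbb N$ such that the following holds for all $0<\alpha\le1$, $\beta>0$, $0<\nu\le1$, $0<\delta<1$. If $$n\ \ge\ C\,\frac{m\,d_{\mathcal H}+\log\frac1{\nu^2\delta}}{\alpha^2\beta^2}\Big(1+\log\frac{nm}{\alpha\nu\delta}\Big)^k,\qquad m\ \ge\ C\,\frac{\log n\,\log(n/\delta)}{\rho_{\inf}^2\,\nu^4\alpha^4}\Big(1+\log\frac n{\alpha\nu\delta}\Big)^k$$ (that is, $n\ge\widetilde O\big((m\,d_{\mathcal H}+\log(1/\nu^2\delta))/(\alpha^2\beta^2)\big)$ and $m\ge\widetilde O\big(\log n\log(n/\delta)/(\rho_{\inf}^2\nu^4\alpha^4)\big)$), then with probability at least $1-12\delta$ over the sample (and the random partition and the estimates) $\hat\psi$ satisfies $(6\alpha,2\beta)$-FPAIF with respect to $(\mathcal P,\mathcal Q)$, with $\hat\gamma$ as the common rate, $$\Pr_{x\sim\mathcal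 P}\big(|\mathrm{E}_{\mathrm{FP}}(x,\hat\psi;\mathcal Q)-\hat\gamma|>6\alpha\big)\le2\beta,\qquad\text{and}\qquad \mathrm{err}(\hat\psi;\mathcal P,\mathcal Q)\le\mathrm{OPT}(\alpha;\mathcal P,\mathcal Q)+K\nu+K\alpha\beta .$$ -/

import Mathlib

open MeasureTheory ProbabilityTheory
open scoped ENNReal

noncomputable section

namespace FPAIF

/-! Labels are Booleans: `true` is the label 1 and `false` is the label 0.
Individuals are the points of `𝒳`; a problem is an element `f` of a class `𝓕` of functions
`𝒳 → Bool` (via `FunLike`); a hypothesis class is a set `ℋ : Set (𝒳 → Bool)`. -/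

/-- The label as a real number. -/
def bit (b : Bool) : ℝ := if b then 1 else 0

/-! ### VC dimension -/

/-- `ℋ` shatters the finite set `s`: every labeling of `s` is realized by a member of `ℋ`. -/
def Shatters {𝒳 : Type*} (ℋ : Set (𝒳 → Bool)) (s : Finset 𝒳) : Prop :=
  ∀ g : 𝒳 → Bool, ∃ h ∈ ℋ, ∀ x ∈ s, h x = g x

/-- The VC dimension: the supremum of the cardinalities of the shattered finite sets. -/
def vcDim {𝒳 : Type*} (ℋ : Set (𝒳 → Bool)) : ℕ∞ :=
  ⨆ (s : Finset 𝒳) (_ : Shatters ℋ s), (s.card : ℕ∞)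

/-! ### Cost sensitive classification -/

/-- The cost of the classifier `h` on the data set `D = (x_i, c_i^1, c_i^0)_i`. -/
def cscCost {𝒳 : Type*} {n : ℕ} (D : Fin n → 𝒳 × ℝ × ℝ) (h : 𝒳 → Bool) : ℝ :=
  ∑ i, ((D i).2.1 * bit (h (D i).1) + (D i).2.2 * (1 - bit (h (D i).1)))

/-- `csc` is a cost sensitive classification oracle for `ℋ` on data sets of size `n`: it returns a
member of `ℋ` of minimal cost, and its prediction at a point depends measurably on the data set
and on the point. -/
structure IsCSCOracle {𝒳 : Type*} [MeasurableSpace 𝒳] (ℋ : Set (𝒳 → Bool)) {n : ℕ}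
    (csc : (Fin n → 𝒳 × ℝ × ℝ) → ℋ) : Prop where
  optimal : ∀ D, ∀ h ∈ ℋ, cscCost D (csc D).1 ≤ cscCost D h
  measurable : Measurable fun z : (Fin n → 𝒳 × ℝ × ℝ) × 𝒳 => (csc z.1).1 z.2

/-! ### Mappings from problems to randomized classifiers, their rates, and the benchmark -/

/-- `ψ` is a mapping from problems to randomized classifiers: every `ψ f` is a probability
distribution over `ℋ` (whose σ-algebra is generated by the evaluations `h ↦ h x`), and the
probability that `h ∼ ψ f` labels `x` with 1 is a measurable function of `(f, x)`. -/
structure IsMapping {𝒳 𝓕 : Type*} [MeasurableSpace 𝒳] [MeasurableSpace 𝓕]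
    {ℋ : Set (𝒳 → Bool)} (ψ : 𝓕 → Measure ℋ) : Prop where
  prob : ∀ f, IsProbabilityMeasure (ψ f)
  measurable : Measurable fun z : 𝓕 × 𝒳 => ψ z.1 {h : ℋ | h.1 z.2 = true}

section Rates

variable {𝒳 𝓕 : Type*} [MeasurableSpace 𝒳] [MeasurableSpace 𝓕] [FunLike 𝓕 𝒳 Bool]

/-- `ρ_x`, the probability that a random problem labels `x` with 0. -/
def rho (Q : Measure 𝓕) (x : 𝒳) : ℝ := Q.real {f : 𝓕 | f x = false}

/-- The infimum of `ρ_x` over all individuals. -/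
def rhoInf (𝒳 : Type*) {𝓕 : Type*} [MeasurableSpace 𝓕] [FunLike 𝓕 𝒳 Bool]
    (Q : Measure 𝓕) : ℝ := ⨅ x : 𝒳, rho Q x

/-- The individual error rate of `ψ` on `x`. -/
def indErr (Q : Measure 𝓕) {ℋ : Set (𝒳 → Bool)} (ψ : 𝓕 → Measure ℋ) (x : 𝒳) : ℝ :=
  ∫ f, (ψ f).real {h : ℋ | h.1 x ≠ f x} ∂Q

/-- The overall error rate `err(ψ; P, Q)`. -/
def err (P : Measure 𝒳) (Q : Measure 𝓕) {ℋ : Set (𝒳 → Bool)} (ψ : 𝓕 → Measure ℋ) : ℝ :=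
  ∫ x, indErr Q ψ x ∂P

/-- The individual false positive rate of `ψ` on `x`. -/
def fpRate (Q : Measure 𝓕) {ℋ : Set (𝒳 → Bool)} (ψ : 𝓕 → Measure ℋ) (x : 𝒳) : ℝ :=
  1 / rho Q x * ∫ f, (ψ f).real {h : ℋ | h.1 x = true ∧ f x = false} ∂Q

/-- The false positive rates of all but a `β` fraction of the individuals are within `α` of
`γ ≥ 0`. -/
def IsFPAIFAt (P : Measure 𝒳) (Q : Measure 𝓕) {ℋ : Set (𝒳 → Bool)} (ψ : 𝓕 → Measure ℋ)
    (α β γ : ℝ) : Prop :=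
  0 ≤ γ ∧ P.real {x | α < |fpRate Q ψ x - γ|} ≤ β

/-- `(α, β)`-approximate False Positive Average Individual Fairness with respect to `(P, Q)`. -/
def IsFPAIF (P : Measure 𝒳) (Q : Measure 𝓕) {ℋ : Set (𝒳 → Bool)} (ψ : 𝓕 → Measure ℋ)
    (α β : ℝ) : Prop :=
  ∃ γ : ℝ, IsFPAIFAt P Q ψ α β γ

/-- `OPT(α; P, Q)`: the optimal value of the fair learning problem, i.e. the infimum of the error
over all mappings `ψ` whose individual false positive rates on all individuals are within `α` of
some common `γ ∈ [0, 1]`. -/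
def OPT (ℋ : Set (𝒳 → Bool)) (P : Measure 𝒳) (Q : Measure 𝓕) (α : ℝ) : ℝ :=
  sInf {e : ℝ | ∃ (ψ : 𝓕 → Measure ℋ) (γ : ℝ), IsMapping ψ ∧ 0 ≤ γ ∧ γ ≤ 1 ∧
    (∀ x, |fpRate Q ψ x - γ| ≤ α) ∧ e = err P Q ψ}

end Rates

/-! ### The algorithm FPAIF-Learn -/

/-- The bound `B` on the dual variables. -/
def dualBound (α ν : ℝ) : ℝ := (1 + 2 * ν) / α

/-- The number `T` of rounds (rounded up to an integer). -/
def numRounds (n : ℕ) (α ν : ℝ) : ℕ :=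
  ⌈16 * dualBound α ν ^ 2 * (1 + 2 * α) ^ 2 * Real.log (2 * n + 1) / ν ^ 2⌉₊

/-- The learning rate `η`. -/
def learningRate (α ν : ℝ) : ℝ := ν / (4 * (1 + 2 * α) ^ 2 * dualBound α ν)

section Algorithm

variable {𝒳 𝓕 : Type*} [FunLike 𝓕 𝒳 Bool] {ℋ : Set (𝒳 → Bool)} {n : ℕ}

/-- The data set passed to the oracle for the problem `f`, given the individuals `X`, the
estimates `r` and the weights `w`: the costs are
`c_i^1 = (w_i / r_i + 1 / n) (1 - f(x_i))` and `c_i^0 = (1 / n) f(x_i)`. -/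
def cscData (X : Fin n → 𝒳) (r w : Fin n → ℝ) (f : 𝓕) : Fin n → 𝒳 × ℝ × ℝ :=
  fun i => (X i, (w i / r i + 1 / n) * (1 - bit (f (X i))), 1 / n * bit (f (X i)))

/-- The classifier that the (approximate) best response to the weights `w` uses for `f`. -/
def response (csc : (Fin n → 𝒳 × ℝ × ℝ) → ℋ) (X : Fin n → 𝒳) (r w : Fin n → ℝ) (f : 𝓕) : ℋ :=
  csc (cscData X r w f)

/-- The value of `γ` in the best response to the weights `w`. -/
def gammaResponse (w : Fin n → ℝ) : ℝ := if 0 < ∑ i, w i then 1 else 0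

/-- The false positive rate at `x` on a batch `S` of problems when the classifier used for the
problem `f` is `h f`. -/
def batchFPRate {m₀ : ℕ} (S : Fin m₀ → 𝓕) (h : 𝓕 → ℋ) (x : 𝒳) : ℝ :=
  (∑ s, if (h (S s)).1 x = true ∧ S s x = false then (1 : ℝ) else 0) /
    ∑ s, if S s x = false then (1 : ℝ) else 0

/-- The dual variables attached to `θ`; the sign `+` is `true`, the sign `-` is `false`. -/
def dual (B : ℝ) (θ : Fin n × Bool → ℝ) : Fin n × Bool → ℝ :=
  fun k => B * (Real.exp (θ k) / (1 + ∑ l, Real.exp (θ l)))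

/-- The weights `w_i = λ_i^+ - λ_i^-` over the individuals. -/
def weights (B : ℝ) (θ : Fin n × Bool → ℝ) : Fin n → ℝ :=
  fun i => dual B θ (i, true) - dual B θ (i, false)

/-- The vector of fairness violations of a pair `(h, γ)` on a batch `S`. -/
def violation {m₀ : ℕ} (α : ℝ) (X : Fin n → 𝒳) (S : Fin m₀ → 𝓕) (h : 𝓕 → ℋ) (γ : ℝ) :
    Fin n × Bool → ℝ
  | (i, true) => batchFPRate S h (X i) - γ - 2 * α
  | (i, false) => γ - batchFPRate S h (X i) - 2 * α

/-- The state `θ` of the Auditor; `theta … t` is its value at the start of round `t` (rounds are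
numbered from 0), and the update in round `t` uses only the batch `S t`. -/
def theta {T m₀ : ℕ} (csc : (Fin n → 𝒳 × ℝ × ℝ) → ℋ) (α ν : ℝ) (X : Fin n → 𝒳)
    (r : Fin n → ℝ) (S : Fin T → Fin m₀ → 𝓕) : ℕ → Fin n × Bool → ℝ
  | 0 => 0
  | t + 1 =>
    let θ := theta csc α ν X r S t
    let w := weights (dualBound α ν) θ
    if ht : t < T then
      θ + learningRate α ν • violation α X (S ⟨t, ht⟩) (response csc X r w) (gammaResponse w)
    else θ

/-- The weights `w_t` that the Auditor plays in round `t`. -/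
def roundWeights {T m₀ : ℕ} (csc : (Fin n → 𝒳 × ℝ × ℝ) → ℋ) (α ν : ℝ) (X : Fin n → 𝒳)
    (r : Fin n → ℝ) (S : Fin T → Fin m₀ → 𝓕) (t : Fin T) : Fin n → ℝ :=
  weights (dualBound α ν) (theta csc α ν X r S t)

/-- The output `γ̂` of the algorithm: the average of the plays `γ_t`. -/
def gammaHat {T m₀ : ℕ} (csc : (Fin n → 𝒳 × ℝ × ℝ) → ℋ) (α ν : ℝ) (X : Fin n → 𝒳)
    (r : Fin n → ℝ) (S : Fin T → Fin m₀ → 𝓕) : ℝ :=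
  1 / T * ∑ t : Fin T, gammaResponse (roundWeights csc α ν X r S t)

/-- The output `ψ̂` of the algorithm: `ψ̂ f` is the uniform distribution over the `T` classifiers
that the oracle returns for `f` with the weights `w_1, …, w_T`. -/
def psiHat [MeasurableSpace 𝒳] {T m₀ : ℕ} (csc : (Fin n → 𝒳 × ℝ × ℝ) → ℋ) (α ν : ℝ)
    (X : Fin n → 𝒳) (r : Fin n → ℝ) (S : Fin T → Fin m₀ → 𝓕) : 𝓕 → Measure ℋ :=
  fun f => (T : ℝ≥0∞)⁻¹ •
    ∑ t : Fin T, Measure.dirac (response csc X r (roundWeights csc α ν X r S t) f)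

end Algorithm

/-! ### The random partition and the sample space -/

/-- An ordered partition of the `m` problems into `T` batches of size `m₀`: the batch `t` consists
of the problems with the indices `e (t, s)`. -/
abbrev Split (T m₀ m : ℕ) : Type := Fin T × Fin m₀ ≃ Fin m

instance (T m₀ m : ℕ) : MeasurableSpace (Split T m₀ m) := ⊤

/-- The batches `F_1, …, F_T` of the problems `F` given by the partition `e`. -/
def batches {𝓕 : Type*} {T m₀ m : ℕ} (F : Fin m → 𝓕) (e : Split T m₀ m) :
    Fin T → Fin m₀ → 𝓕 :=
  fun t s => F (e (t, s))

/-- The joint law of the side randomness of the estimates, the `n` i.i.d. individuals, the `m`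
i.i.d. problems and the uniformly random partition; the four are independent. -/
def sampleLaw {Ω 𝒳 𝓕 : Type*} [MeasurableSpace Ω] [MeasurableSpace 𝒳] [MeasurableSpace 𝓕]
    (μ : Measure Ω) (P : Measure 𝒳) (Q : Measure 𝓕) (n m T m₀ : ℕ) :
    Measure (Ω × (Fin n → 𝒳) × (Fin m → 𝓕) × Split T m₀ m) :=
  μ.prod ((Measure.pi fun _ : Fin n => P).prod
    ((Measure.pi fun _ : Fin m => Q).prod (uniformOn Set.univ)))

end FPAIF

end

set_option linter.unusedSectionVars false

namespace FPAIF

/-! ### Concentration and product measures -/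

/-! The algorithm is a zero-sum game between an Auditor, who runs exponentiated gradient over the
dual domain, and a Learner, who answers with a best response. The Lagrangian separates over
problems, so one oracle call per problem is an exact best response to the weights once the true
rates at the sampled points are replaced by their estimates (`lagrangian_response_le`). Low regret
then gives a deterministic guarantee on the sample (`sample_guarantee`). Regret against the vertex 0
bounds the error. Regret against `B` times a unit vector bounds a single violation, since `B * α = 1
+ 2 * ν` exceeds any possible gain in error.

Two kinds of randomness remain. For the problems, the classifiers of round `t` depend only on
earlier batches, so for fixed `x` the batch of round `t` is fresh and Hoeffding applies
(`measure_round_not_accurate_le`). A union bound covers the sampled individuals. For the population,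
Fubini and Markov show that the individuals with an inaccurate estimate have mass at most `1 / n`
with high probability.

For the individuals, the true rates are awkward because they involve the classifiers of all
problems. Generalization is therefore proved for the batch estimates. With the batches fixed, these
depend on the sample only through `T * m₀ = m` hypotheses and the `T + 1` possible values of `γ̂`.
By Sauer's lemma at most `(T + 1) * (2 * n + 1) ^ (m * d)` patterns occur on `2 * n` points
(`exists_finset_values`), and symmetrization for sample-dependent functions (`uniform_convergence`)
concludes. This is why `n` must dominate `m * d`.

`good_event_conclusion` chains the comparisons: true rates to batch estimates on the population,
population to sample, then the game guarantee against a nearly optimal fair mapping fixed in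
advance. Five failure events of probability at most `δ` each are discarded. -/

/-- The endpoint `a` is left free so that the lower tail follows by applying the bound to `-φ`, with
`a = -1`. -/
theorem hoeffding_upper {Y : Type*} [MeasurableSpace Y] (ν : Measure Y) [IsProbabilityMeasure ν]
    {N : ℕ} (hN : 0 < N) {φ : Y → ℝ} (hφ : Measurable φ) {a : ℝ}
    (h01 : ∀ y, φ y ∈ Set.Icc a (a + 1)) {ε : ℝ} (hε : 0 ≤ ε) :
    (Measure.pi fun _ : Fin N => ν).real {S | ε ≤ 1 / N * ∑ s, φ (S s) - ∫ y, φ y ∂ν} ≤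
      Real.exp (-2 * N * ε ^ 2) := by
  have hN' : (0 : ℝ) < N := by exact_mod_cast hN
  have hind : iIndepFun (fun (s : Fin N) (S : Fin N → Y) => φ (S s) - ∫ y, φ y ∂ν)
      (Measure.pi fun _ : Fin N => ν) :=
    iIndepFun_pi (μ := fun _ : Fin N => ν) (X := fun _ y => φ y - ∫ y, φ y ∂ν)
      (fun i => (hφ.sub_const _).aemeasurable)
  have hsub : ∀ s ∈ (Finset.univ : Finset (Fin N)),
      HasSubgaussianMGF (fun S : Fin N → Y => φ (S s) - ∫ y, φ y ∂ν)
      ((‖(a + 1) - a‖₊ / 2) ^ 2) (Measure.pi fun _ : Fin N => ν) := by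
    intro s _
    have h := hasSubgaussianMGF_of_mem_Icc (μ := ν) hφ.aemeasurable (ae_of_all _ h01)
    have hmp : MeasurePreserving (fun S : Fin N → Y => S s) (Measure.pi fun _ : Fin N => ν) ν :=
      measurePreserving_eval (fun _ : Fin N => ν) s
    rw [← hmp.map_eq] at h
    have h2 := HasSubgaussianMGF.of_map hmp.measurable.aemeasurable h
    rw [hmp.map_eq] at h2
    exact h2
  have := HasSubgaussianMGF.measure_sum_ge_le_of_iIndepFun hind hsub (ε := N * ε) (by positivity)
  calc _ ≤ _ := measureReal_mono ?_
    _ ≤ _ := this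
    _ = _ := ?_
  · intro S hS
    simp only [Set.mem_ofPred_eq, Finset.sum_sub_distrib, Finset.sum_const, Finset.card_univ,
      Fintype.card_fin, nsmul_eq_mul] at hS ⊢
    have := mul_le_mul_of_nonneg_left hS hN'.le
    rw [mul_sub, ← mul_assoc, mul_one_div_cancel hN'.ne', one_mul] at this
    exact this
  · congr 1
    simp
    field_simp

/-- Two-sided Hoeffding inequality for the mean of `N` independent copies of `φ ∈ [0, 1]`. -/
theorem hoeffding_mean {Y : Type*} [MeasurableSpace Y] (ν : Measure Y) [IsProbabilityMeasure ν]
    {N : ℕ} (hN : 0 < N) {φ : Y → ℝ} (hφ : Measurable φ)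
    (h01 : ∀ y, φ y ∈ Set.Icc (0 : ℝ) 1) {ε : ℝ} (hε : 0 ≤ ε) :
    (Measure.pi fun _ : Fin N => ν) {S | ε < |1 / N * ∑ s, φ (S s) - ∫ y, φ y ∂ν|} ≤
      ENNReal.ofReal (2 * Real.exp (-2 * N * ε ^ 2)) := by
  have h1 := hoeffding_upper ν hN hφ (a := 0) (by simpa using h01) hε
  have h2 := hoeffding_upper ν hN hφ.neg (a := -1) (by
    intro y; have := h01 y; simp only [Set.mem_Icc] at this ⊢; constructor <;> simp <;> linarith) hε
  rw [← ofReal_measureReal]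
  apply ENNReal.ofReal_le_ofReal
  calc _ ≤ _ := measureReal_mono (s₂ := {S | ε ≤ 1 / N * ∑ s, φ (S s) - ∫ y, φ y ∂ν} ∪
        {S | ε ≤ 1 / N * ∑ s, (-φ) (S s) - ∫ y, (-φ) y ∂ν}) ?_
    _ ≤ _ := measureReal_union_le _ _
    _ ≤ _ := by linarith
  intro S hS
  simp only [Set.mem_ofPred_eq, Pi.neg_apply, Finset.sum_neg_distrib, integral_neg,
    Set.mem_union] at hS ⊢
  rcases lt_abs.1 hS with h | h
  · left; exact h.le
  · right; linarith

/-- A bound on the sections in one coordinate bounds the measure of a set in a product. -/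
theorem pi_measure_le_of_update {ι Y : Type*} [Fintype ι] [DecidableEq ι] [MeasurableSpace Y]
    (ν : Measure Y) [IsProbabilityMeasure ν] {D : Set (ι → Y)} (hD : MeasurableSet D) (t : ι)
    {c : ℝ≥0∞} (h : ∀ S : ι → Y, ν {y | Function.update S t y ∈ D} ≤ c) :
    (Measure.pi fun _ : ι => ν) D ≤ c := by
  have key := lintegral_le_of_lmarginal_le (μ := fun _ : ι => ν) {t}
    (f := D.indicator 1) (g := fun _ => c) (measurable_one.indicator hD) measurable_const (by
      rw [lmarginal_singleton, lmarginal_singleton]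
      intro S
      simp only [lintegral_const, measure_univ, mul_one]
      exact (lintegral_indicator_one (μ := ν) ((measurable_update S (a := t)) hD)).trans_le (h S))
  rw [lintegral_indicator_one hD] at key
  simpa using key

/-- Fubini's bound, sections over the first factor. -/
theorem prod_measure_le_of_left {A B : Type*} [MeasurableSpace A] [MeasurableSpace B]
    (μ : Measure A) [IsProbabilityMeasure μ] (ν : Measure B) [IsProbabilityMeasure ν]
    {D : Set (A × B)} (hD : MeasurableSet D) {c : ℝ≥0∞} (h : ∀ a, ν {b | (a, b) ∈ D} ≤ c) :
    (μ.prod ν) D ≤ c := by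
  rw [Measure.prod_apply hD]
  calc _ ≤ ∫⁻ _, c ∂μ := lintegral_mono h
    _ = c := by simp

/-- Fubini's bound, sections over the second factor. -/
theorem prod_measure_le_of_right {A B : Type*} [MeasurableSpace A] [MeasurableSpace B]
    (μ : Measure A) [IsProbabilityMeasure μ] (ν : Measure B) [IsProbabilityMeasure ν]
    {D : Set (A × B)} (hD : MeasurableSet D) {c : ℝ≥0∞} (h : ∀ b, μ {a | (a, b) ∈ D} ≤ c) :
    (μ.prod ν) D ≤ c := by
  rw [Measure.prod_apply_symm hD]
  calc _ ≤ ∫⁻ _, c ∂ν := lintegral_mono h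
    _ = c := by simp

/-- Cutting `m` independent problems into batches gives independent batches. -/
theorem measurePreserving_batches {𝓕 : Type*} [MeasurableSpace 𝓕] (Q : Measure 𝓕)
    [IsProbabilityMeasure Q] {T m₀ m : ℕ} (e : Split T m₀ m) :
    MeasurePreserving (fun F : Fin m → 𝓕 => batches F e) (Measure.pi fun _ => Q)
      (Measure.pi fun _ : Fin T => Measure.pi fun _ : Fin m₀ => Q) := by
  have h1 := measurePreserving_piCongrLeft (fun _ : Fin T × Fin m₀ => Q) e.symm
  have h2 : MeasurePreserving (MeasurableEquiv.curry (Fin T) (Fin m₀) 𝓕)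
      (Measure.pi fun _ : Fin T × Fin m₀ => Q)
      (Measure.pi fun _ : Fin T => Measure.pi fun _ : Fin m₀ => Q) := by
    refine ⟨MeasurableEquiv.measurable _, ?_⟩
    have := Measure.infinitePi_map_curry (fun (_ : Fin T) (_ : Fin m₀) => Q)
    simpa only [Measure.infinitePi_eq_pi] using this
  have h3 := h2.comp h1
  convert h3 using 1
  funext F t s
  simp [batches, MeasurableEquiv.piCongrLeft, Equiv.piCongrLeft, MeasurableEquiv.curry]

/-- Every fixed partition already produces batches with the product law, so averaging over an
independent random partition changes nothing. -/
theorem measurePreserving_batches_random {𝓕 : Type*} [MeasurableSpace 𝓕] (Q : Measure 𝓕)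
    [IsProbabilityMeasure Q] {T m₀ m : ℕ} [Nonempty (Split T m₀ m)] :
    MeasurePreserving (fun z : (Fin m → 𝓕) × Split T m₀ m => batches z.1 z.2)
      ((Measure.pi fun _ => Q).prod (uniformOn Set.univ))
      (Measure.pi fun _ : Fin T => Measure.pi fun _ : Fin m₀ => Q) := by
  have hm : Measurable (fun z : (Fin m → 𝓕) × Split T m₀ m => batches z.1 z.2) :=
    measurable_from_prod_countable_left fun e => (measurePreserving_batches Q e).measurable
  have : IsProbabilityMeasure (uniformOn (Set.univ : Set (Split T m₀ m))) :=
    isProbabilityMeasure_uniformOn Set.finite_univ Set.univ_nonempty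
  refine ⟨hm, ?_⟩
  ext D hD
  rw [Measure.map_apply hm hD, Measure.prod_apply_symm (hm hD)]
  have : ∀ e : Split T m₀ m, (Measure.pi fun _ : Fin m => Q)
      ((fun F => (F, e)) ⁻¹' ((fun z : (Fin m → 𝓕) × Split T m₀ m => batches z.1 z.2) ⁻¹' D)) =
      (Measure.pi fun _ : Fin T => Measure.pi fun _ : Fin m₀ => Q) D := fun e =>
    (measurePreserving_batches Q e).measure_preimage hD.nullMeasurableSet
  simp_rw [this]
  simp

/-! ### The growth function of a class of finite VC dimension -/

theorem sum_choose_le_add_one_pow (N d : ℕ) :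
    ∑ k ∈ Finset.Iic d, N.choose k ≤ (N + 1) ^ d := by
  rw [add_pow, ← Nat.range_succ_eq_Iic]
  refine Finset.sum_le_sum fun k hk => ?_
  have hk' : k ≤ d := Nat.lt_succ_iff.1 (Finset.mem_range.1 hk)
  calc N.choose k ≤ N ^ k := Nat.choose_le_pow N k
    _ ≤ N ^ k * 1 ^ (d - k) * d.choose k := by
      rw [one_pow, mul_one]; exact Nat.le_mul_of_pos_right _ (Nat.choose_pos hk')

theorem card_le_of_shatters {𝒳 : Type*} {ℋ : Set (𝒳 → Bool)} {d : ℕ} (hd : vcDim ℋ = d)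
    {s : Finset 𝒳} (hs : Shatters ℋ s) : s.card ≤ d := by
  have : (s.card : ℕ∞) ≤ vcDim ℋ := le_iSup₂_of_le s hs le_rfl
  rw [hd] at this
  exact_mod_cast this

/-- Sauer's lemma: the members of a class of VC dimension `d` induce at most `(N + 1) ^ d` labelings
of `N` points. -/
theorem exists_finset_labelings {𝒳 ι : Type*} [Fintype ι] [DecidableEq ι] {ℋ : Set (𝒳 → Bool)}
    {d : ℕ} (hd : vcDim ℋ = d) (u : ι → 𝒳) :
    ∃ s : Finset (ι → Bool), s.card ≤ (Fintype.card ι + 1) ^ d ∧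
      ∀ h ∈ ℋ, (fun i => h (u i)) ∈ s := by
  classical
  let s : Finset (ι → Bool) := Finset.univ.filter fun p => ∃ h ∈ ℋ, (fun i => h (u i)) = p
  -- Labelings are encoded by their sets of ones, so that the Sauer–Shelah bound for set families
  -- applies.
  let supp : (ι → Bool) → Finset ι := fun p => Finset.univ.filter fun i => p i = true
  have hsupp : Function.Injective supp := by
    intro p q hpq
    funext i
    have := Finset.ext_iff.1 hpq i
    simp only [supp, Finset.mem_filter, Finset.mem_univ, true_and] at this
    exact Bool.eq_iff_iff.2 this
  refine ⟨s, ?_, fun h hh => by simp only [s, Finset.mem_filter, Finset.mem_univ, true_and]; exact ⟨h, hh, rfl⟩⟩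
  rw [← Finset.card_image_of_injective s hsupp]
  refine (Finset.card_le_card_shatterer _).trans (Finset.card_shatterer_le_sum_vcDim.trans
    (le_trans (Finset.sum_le_sum_of_subset (Finset.Iic_subset_Iic.2 ?_))
      (sum_choose_le_add_one_pow _ d)))
  refine Finset.sup_le fun t ht => ?_
  rw [Finset.mem_shatterer] at ht
  have hex : ∀ v ⊆ t, ∃ h ∈ ℋ, ∀ i ∈ t, (h (u i) = true ↔ i ∈ v) := by
    intro v hv
    obtain ⟨w, hw, htw⟩ := ht hv
    obtain ⟨p, hp, rfl⟩ := Finset.mem_image.1 hw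
    obtain ⟨h, hh, rfl⟩ := (Finset.mem_filter.1 hp).2
    refine ⟨h, hh, fun i hi => ?_⟩
    rw [← htw]
    simp [supp, hi]
  -- The points `u i` may repeat. A shattered index set contains no repetition, since the trace
  -- `{i}` separates `i` from every other index; hence its image in `𝒳` has the same size and is
  -- shattered by `ℋ`.
  have hinj : Set.InjOn u t := by
    intro i hi j hj hij
    obtain ⟨h, -, hv⟩ := hex {i} (Finset.singleton_subset_iff.2 hi)
    have h1 := (hv i hi).2 (Finset.mem_singleton_self i)
    rw [hij] at h1
    exact (Finset.mem_singleton.1 ((hv j hj).1 h1)).symm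
  rw [← Finset.card_image_of_injOn hinj]
  refine card_le_of_shatters hd fun g => ?_
  obtain ⟨h, hh, hv⟩ := hex (t.filter fun i => g (u i) = true) (Finset.filter_subset _ _)
  refine ⟨h, hh, fun x hx => ?_⟩
  obtain ⟨i, hi, rfl⟩ := Finset.mem_image.1 hx
  have := hv i hi
  simp only [Finset.mem_filter, hi, true_and] at this
  exact Bool.eq_iff_iff.2 this

/-! ### Symmetrization -/

/-- The sign by which exchanging the two members of a pair changes their difference. -/
noncomputable def swapSign (b : Bool) : ℝ := if b then -1 else 1

/-- Hoeffding's inequality for Rademacher sums in counting form: Chernoff's method with parameter `s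
/ n`, where each coordinate contributes `2 * cosh (s / n * a i) ≤ 2 * exp ((s / n) ^ 2 / 2)`. -/
theorem card_signs_le {n : ℕ} (hn : 0 < n) {a : Fin n → ℝ} (ha : ∀ i, |a i| ≤ 1) {s : ℝ}
    (hs : 0 ≤ s) :
    (((Finset.univ : Finset (Fin n → Bool)).filter
      fun σ => s ≤ ∑ i, swapSign (σ i) * a i).card : ℝ) ≤
      2 ^ n * Real.exp (-s ^ 2 / (2 * n)) := by
  have hn' : (0 : ℝ) < n := by exact_mod_cast hn
  have hs2 : ∑ σ : Fin n → Bool, Real.exp (s / n * ∑ i, swapSign (σ i) * a i) ≤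
      2 ^ n * Real.exp (s ^ 2 / (2 * n)) := by
    have h1 : ∀ σ : Fin n → Bool, Real.exp (s / n * ∑ i, swapSign (σ i) * a i) =
        ∏ i, Real.exp (s / n * (swapSign (σ i) * a i)) := fun σ => by
      rw [Finset.mul_sum, Real.exp_sum]
    simp_rw [h1]
    have h2 := Finset.prod_univ_sum (fun _ : Fin n => (Finset.univ : Finset Bool))
      (fun i b => Real.exp (s / n * (swapSign b * a i)))
    rw [Fintype.piFinset_univ] at h2
    rw [← h2]
    calc _ ≤ ∏ _i : Fin n, 2 * Real.exp ((s / n) ^ 2 / 2) := by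
          refine Finset.prod_le_prod (fun i _ => by positivity) fun i _ => ?_
          have h3 := Real.cosh_le_exp_half_sq (s / n * a i)
          rw [Real.cosh_eq] at h3
          have h4 : (s / n * a i) ^ 2 ≤ (s / n) ^ 2 := by
            rw [mul_pow]
            have : a i ^ 2 ≤ 1 := (sq_le_one_iff_abs_le_one _).2 (ha i)
            nlinarith [sq_nonneg (s / n)]
          have h5 : Real.exp ((s / n * a i) ^ 2 / 2) ≤ Real.exp ((s / n) ^ 2 / 2) :=
            Real.exp_le_exp.2 (by linarith)
          simp only [Fintype.sum_bool, swapSign, if_true, Bool.false_eq_true, if_false, neg_mul,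
            one_mul, mul_neg]
          linarith
      _ = _ := by
          rw [Finset.prod_const, Finset.card_univ, Fintype.card_fin, mul_pow, ← Real.exp_nat_mul]
          congr 2
          field_simp
  have hm : (((Finset.univ : Finset (Fin n → Bool)).filter
      fun σ => s ≤ ∑ i, swapSign (σ i) * a i).card : ℝ) * Real.exp (s ^ 2 / n) ≤
      2 ^ n * Real.exp (s ^ 2 / (2 * n)) := by
    refine le_trans ?_ hs2
    rw [← nsmul_eq_mul, ← Finset.sum_const]
    refine (Finset.sum_le_sum fun σ hσ => ?_).trans
      (Finset.sum_le_sum_of_subset_of_nonneg (Finset.filter_subset _ _) fun _ _ _ => by positivity)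
    apply Real.exp_le_exp.2
    have := (Finset.mem_filter.1 hσ).2
    calc s ^ 2 / n = s / n * s := by ring
      _ ≤ _ := mul_le_mul_of_nonneg_left this (by positivity)
  refine le_of_mul_le_mul_right (hm.trans_eq ?_) (Real.exp_pos (s ^ 2 / n))
  rw [mul_assoc, ← Real.exp_add]
  congr 2
  field_simp
  ring

/-- Exchange the members of the pairs selected by `σ`. -/
def swapPairs {𝒳 : Type*} {n : ℕ} (σ : Fin n → Bool) (u : Fin n → 𝒳 × 𝒳) : Fin n → 𝒳 × 𝒳 :=
  fun i => if σ i then (u i).swap else u i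

theorem measurePreserving_swapPairs {𝒳 : Type*} [MeasurableSpace 𝒳] (P : Measure 𝒳)
    [IsProbabilityMeasure P] {n : ℕ} (σ : Fin n → Bool) :
    MeasurePreserving (swapPairs (𝒳 := 𝒳) σ) (Measure.pi fun _ => P.prod P)
      (Measure.pi fun _ => P.prod P) := by
  refine measurePreserving_pi (fun _ : Fin n => P.prod P) (fun _ : Fin n => P.prod P)
    (f := fun i p => if σ i then p.swap else p) fun i => ?_
  cases h : σ i
  · simp only [Bool.false_eq_true, if_false]
    exact MeasurePreserving.id (P.prod P)
  · simpa [h] using Measure.measurePreserving_swap (μ := P) (ν := P)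

/-- The deviation between the means of `g X` on the ghost sample and on the sample, exceeding `c`,
where `X` consists of the first members of the pairs. -/
def ghostDeviation {𝒳 : Type*} {n : ℕ} (g : (Fin n → 𝒳) → 𝒳 → ℝ) (c : ℝ) : Set (Fin n → 𝒳 × 𝒳) :=
  {u | c < 1 / n * ∑ i, g (fun j => (u j).1) (u i).2 - 1 / n * ∑ i, g (fun j => (u j).1) (u i).1}

theorem measurableSet_ghostDeviation {𝒳 : Type*} [MeasurableSpace 𝒳] {n : ℕ}
    {g : (Fin n → 𝒳) → 𝒳 → ℝ} (hg : Measurable fun z : (Fin n → 𝒳) × 𝒳 => g z.1 z.2) (c : ℝ) :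
    MeasurableSet (ghostDeviation g c) := by
  have h1 : Measurable fun u : Fin n → 𝒳 × 𝒳 => fun j => (u j).1 := by fun_prop
  refine measurableSet_lt measurable_const (Measurable.sub ?_ ?_) <;>
  · refine Measurable.const_mul (Finset.measurable_sum _ fun i _ => ?_) _
    exact hg.comp (h1.prodMk (by fun_prop))

/-- All `2 ^ n` swaps preserve the law of the pairs, so it suffices to bound, for fixed pairs, how
many swaps land in the event. A swap also changes the sample and hence the function `g X`, but the
values on the `2 * n` points stay in one finite set of size at most `N`; a union bound over that set
reduces to `card_signs_le`. -/
theorem measure_ghostDeviation_le {𝒳 : Type*} [MeasurableSpace 𝒳] (P : Measure 𝒳)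
    [IsProbabilityMeasure P] {n : ℕ} (hn : 0 < n) {g : (Fin n → 𝒳) → 𝒳 → ℝ}
    (hg : Measurable fun z : (Fin n → 𝒳) × 𝒳 => g z.1 z.2)
    (h01 : ∀ X x, g X x ∈ Set.Icc (0 : ℝ) 1) {N : ℝ}
    (hfin : ∀ u : Fin n → 𝒳 × 𝒳, ∃ s : Finset (Fin n → ℝ × ℝ), (s.card : ℝ) ≤ N ∧
      ∀ X, (fun i => (g X (u i).1, g X (u i).2)) ∈ s)
    {ε : ℝ} (hε : 0 ≤ ε) :
    (Measure.pi fun _ : Fin n => P.prod P) (ghostDeviation g (ε / 2)) ≤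
      ENNReal.ofReal (N * Real.exp (-n * ε ^ 2 / 8)) := by
  classical
  have hn' : (0 : ℝ) < n := by exact_mod_cast hn
  set M := Measure.pi fun _ : Fin n => P.prod P
  set D := ghostDeviation g (ε / 2) with hDdef
  have hD : MeasurableSet D := measurableSet_ghostDeviation hg _
  have hcount : ∀ u : Fin n → 𝒳 × 𝒳,
      (((Finset.univ : Finset (Fin n → Bool)).filter fun σ => swapPairs σ u ∈ D).card : ℝ) ≤
        2 ^ n * (N * Real.exp (-n * ε ^ 2 / 8)) := by
    intro u
    obtain ⟨s, hsN, hs⟩ := hfin u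
    -- The covering set may contain patterns that no sample realizes; the filter removes those to
    -- which the sign bound would not apply.
    let s' := s.filter fun v => ∀ i, |(v i).2 - (v i).1| ≤ 1
    have hsub : ((Finset.univ : Finset (Fin n → Bool)).filter fun σ => swapPairs σ u ∈ D) ⊆
        s'.biUnion fun v => (Finset.univ : Finset (Fin n → Bool)).filter
          fun σ => n * ε / 2 ≤ ∑ i, swapSign (σ i) * ((v i).2 - (v i).1) := by
      intro σ hσ
      simp only [Finset.mem_filter, Finset.mem_univ, true_and] at hσ
      simp only [Finset.mem_biUnion, Finset.mem_filter, Finset.mem_univ, true_and, s']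
      set X : Fin n → 𝒳 := fun j => (swapPairs σ u j).1 with hX
      refine ⟨_, ⟨hs X, fun i => ?_⟩, ?_⟩
      · have h1 := h01 X (u i).1
        have h2 := h01 X (u i).2
        simp only [Set.mem_Icc] at h1 h2
        rw [abs_le]; constructor <;> linarith
      · have h3 : ε / 2 < 1 / n * ∑ i, g X (swapPairs σ u i).2 -
            1 / n * ∑ i, g X (swapPairs σ u i).1 := hσ
        rw [← mul_sub, ← Finset.sum_sub_distrib] at h3
        have h4 : ∑ i, (g X (swapPairs σ u i).2 - g X (swapPairs σ u i).1) =
            ∑ i, swapSign (σ i) * (g X (u i).2 - g X (u i).1) := by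
          refine Finset.sum_congr rfl fun i _ => ?_
          cases h : σ i <;> simp [swapPairs, swapSign, h]
        rw [h4] at h3
        have h5 := mul_lt_mul_of_pos_left h3 hn'
        rw [← mul_assoc, mul_one_div_cancel hn'.ne', one_mul] at h5
        linarith
    calc _ ≤ ((s'.biUnion fun v => (Finset.univ : Finset (Fin n → Bool)).filter
          fun σ => n * ε / 2 ≤ ∑ i, swapSign (σ i) * ((v i).2 - (v i).1)).card : ℝ) := by
          exact_mod_cast Finset.card_le_card hsub
      _ ≤ ∑ v ∈ s', (((Finset.univ : Finset (Fin n → Bool)).filter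
          fun σ => n * ε / 2 ≤ ∑ i, swapSign (σ i) * ((v i).2 - (v i).1)).card : ℝ) := by
          exact_mod_cast Finset.card_biUnion_le
      _ ≤ ∑ v ∈ s', 2 ^ n * Real.exp (-(n * ε / 2) ^ 2 / (2 * n)) :=
          Finset.sum_le_sum fun v hv =>
            card_signs_le hn (Finset.mem_filter.1 hv).2 (by positivity)
      _ = s'.card * (2 ^ n * Real.exp (-n * ε ^ 2 / 8)) := by
          rw [Finset.sum_const, nsmul_eq_mul]
          congr 3
          field_simp
          ring
      _ ≤ N * (2 ^ n * Real.exp (-n * ε ^ 2 / 8)) := by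
          gcongr
          exact le_trans (by exact_mod_cast Finset.card_filter_le _ _) hsN
      _ = _ := by ring
  -- Integrating the pointwise count over the pairs and exchanging sum and integral.
  have hsum : ∑ σ : Fin n → Bool, M (swapPairs σ ⁻¹' D) ≤
      ENNReal.ofReal (2 ^ n * (N * Real.exp (-n * ε ^ 2 / 8))) := by
    have hmeas : ∀ σ : Fin n → Bool, MeasurableSet (swapPairs σ ⁻¹' D) := fun σ =>
      (measurePreserving_swapPairs P σ).measurable hD
    simp_rw [← lintegral_indicator_one (hmeas _)]
    rw [← lintegral_finsetSum _ fun σ _ => measurable_one.indicator (hmeas σ)]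
    calc _ ≤ ∫⁻ _, ENNReal.ofReal (2 ^ n * (N * Real.exp (-n * ε ^ 2 / 8))) ∂M :=
          lintegral_mono fun u => ?_
      _ = _ := by simp
    refine le_trans (le_of_eq ?_) (ENNReal.ofReal_le_ofReal (hcount u))
    rw [ENNReal.ofReal_natCast, Finset.card_filter]
    push_cast
    refine Finset.sum_congr rfl fun σ _ => ?_
    simp [Set.indicator_apply]
  have hconst : ∑ σ : Fin n → Bool, M (swapPairs σ ⁻¹' D) = 2 ^ n * M D := by
    rw [Finset.sum_congr rfl fun σ _ =>
      (measurePreserving_swapPairs P σ).measure_preimage hD.nullMeasurableSet]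
    simp [M]
  rw [hconst, ENNReal.ofReal_mul (by positivity), ENNReal.ofReal_pow (by norm_num)] at hsum
  norm_num at hsum
  refine (ENNReal.mul_le_mul_iff_right (by positivity) (by simp)).1 (hsum.trans_eq ?_)
  norm_num

/-- One-sided uniform convergence for a sample-dependent function `g X`, provided that the
functions `g X` take at most `N` different sets of values on any `2 n` points. -/
theorem uniform_convergence {𝒳 : Type*} [MeasurableSpace 𝒳] (P : Measure 𝒳)
    [IsProbabilityMeasure P] {n : ℕ} (hn : 0 < n) {g : (Fin n → 𝒳) → 𝒳 → ℝ}
    (hg : Measurable fun z : (Fin n → 𝒳) × 𝒳 => g z.1 z.2)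
    (h01 : ∀ X x, g X x ∈ Set.Icc (0 : ℝ) 1) {N : ℝ}
    (hfin : ∀ u : Fin n → 𝒳 × 𝒳, ∃ s : Finset (Fin n → ℝ × ℝ), (s.card : ℝ) ≤ N ∧
      ∀ X, (fun i => (g X (u i).1, g X (u i).2)) ∈ s)
    {ε : ℝ} (hε : 0 ≤ ε) (hnε : 2 * Real.exp (-2 * n * (ε / 2) ^ 2) ≤ 1 / 2) :
    (Measure.pi fun _ : Fin n => P) {X | 1 / n * ∑ i, g X (X i) + ε < ∫ x, g X x ∂P} ≤
      ENNReal.ofReal (2 * (N * Real.exp (-n * ε ^ 2 / 8))) := by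
  set E := {X : Fin n → 𝒳 | 1 / n * ∑ i, g X (X i) + ε < ∫ x, g X x ∂P} with hE
  have hEm : MeasurableSet E := by
    refine measurableSet_lt ?_ ?_
    · refine (Measurable.const_mul (Finset.measurable_sum _ fun i _ => ?_) _).add_const _
      exact hg.comp (measurable_id.prodMk (measurable_pi_apply i))
    · exact (hg.stronglyMeasurable.integral_prod_right (ν := P)).measurable
  have hD := measurableSet_ghostDeviation hg (ε / 2)
  have hmp := (measurePreserving_arrowProdEquivProdArrow 𝒳 𝒳 (Fin n) (fun _ => P) (fun _ => P)).symm
  have hghost := measure_ghostDeviation_le P hn hg h01 hfin hε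
  rw [← hmp.measure_preimage hD.nullMeasurableSet, Measure.prod_apply (hmp.measurable hD)] at hghost
  -- For a bad sample `X` the function `g X` is fixed, so an independent ghost sample has mean
  -- within `ε / 2` of the expectation with probability at least 1/2, and then its mean exceeds that
  -- of `X` by more than `ε / 2`.
  have hhalf : ∀ X ∈ E, (1 / 2 : ℝ≥0∞) ≤ (Measure.pi fun _ : Fin n => P)
      (Prod.mk X ⁻¹' (⇑(MeasurableEquiv.arrowProdEquivProdArrow 𝒳 𝒳 (Fin n)).symm ⁻¹'
        ghostDeviation g (ε / 2))) := by
    intro X hX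
    set A := Prod.mk X ⁻¹' (⇑(MeasurableEquiv.arrowProdEquivProdArrow 𝒳 𝒳 (Fin n)).symm ⁻¹'
        ghostDeviation g (ε / 2))
    set A' := {X' : Fin n → 𝒳 | ε / 2 < |1 / n * ∑ i, g X (X' i) - ∫ x, g X x ∂P|}
    have hgX : Measurable (g X) := hg.comp measurable_prodMk_left
    have h1 : (Measure.pi fun _ : Fin n => P) A' ≤ 1 / 2 := by
      refine (hoeffding_mean P hn hgX (h01 X) (ε := ε / 2) (by positivity)).trans ?_
      refine (ENNReal.ofReal_le_ofReal hnε).trans (le_of_eq ?_)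
      rw [ENNReal.ofReal_div_of_pos (by norm_num)]
      simp
    have h2 : Set.univ ⊆ A ∪ A' := by
      intro X' _
      by_cases h : X' ∈ A'
      · exact Or.inr h
      · left
        simp only [A', Set.mem_ofPred_eq, not_lt] at h
        have h3 : 1 / n * ∑ i, g X (X i) + ε < ∫ x, g X x ∂P := hX
        have h4 := (abs_le.1 h).1
        change ε / 2 < 1 / n * ∑ i, g X (X' i) - 1 / n * ∑ i, g X (X i)
        linarith
    have h5 : (1 / 2 : ℝ≥0∞) + 1 / 2 ≤ (Measure.pi fun _ : Fin n => P) A + 1 / 2 := by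
      rw [ENNReal.add_halves]
      have h6 : (Measure.pi fun _ : Fin n => P) Set.univ = 1 := measure_univ
      exact h6.symm.le.trans <| (measure_mono h2).trans ((measure_union_le _ _).trans (add_le_add_right h1 _))
    exact (ENNReal.add_le_add_iff_right (by simp)).1 h5
  have hE2 : (Measure.pi fun _ : Fin n => P) E * (1 / 2) ≤
      ENNReal.ofReal (N * Real.exp (-n * ε ^ 2 / 8)) := by
    refine le_trans ?_ hghost
    rw [mul_comm, ← lintegral_indicator_const hEm]
    refine lintegral_mono fun X => ?_
    by_cases hX : X ∈ E
    · simpa [Set.indicator_of_mem hX] using hhalf X hX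
    · simp [Set.indicator_of_notMem hX]
  calc _ = 2 * ((Measure.pi fun _ : Fin n => P) E * (1 / 2)) := by
        rw [mul_comm, mul_assoc, one_div, ENNReal.inv_mul_cancel (by simp) (by simp), mul_one]
    _ ≤ 2 * ENNReal.ofReal (N * Real.exp (-n * ε ^ 2 / 8)) := by gcongr
    _ = _ := by rw [ENNReal.ofReal_mul (p := 2) (by norm_num), ENNReal.ofReal_ofNat]

/-! ### Exponentiated gradient -/

section Dual

variable {n : ℕ}

theorem dual_nonneg {B : ℝ} (hB : 0 ≤ B) (θ : Fin n × Bool → ℝ) (k : Fin n × Bool) :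
    0 ≤ dual B θ k := by
  unfold dual; positivity

theorem sum_dual_le {B : ℝ} (hB : 0 ≤ B) (θ : Fin n × Bool → ℝ) : ∑ k, dual B θ k ≤ B := by
  unfold dual
  rw [← Finset.mul_sum, ← Finset.sum_div]
  refine mul_le_of_le_one_right hB ((div_le_one (by positivity)).2 (by linarith))

theorem abs_weights_le {B : ℝ} (hB : 0 ≤ B) (θ : Fin n × Bool → ℝ) (i : Fin n) :
    |weights B θ i| ≤ dual B θ (i, true) + dual B θ (i, false) := by
  have h1 := dual_nonneg hB θ (i, true)
  have h2 := dual_nonneg hB θ (i, false)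
  unfold weights
  rw [abs_le]; constructor <;> linarith

theorem sum_abs_weights_le {B : ℝ} (hB : 0 ≤ B) (θ : Fin n × Bool → ℝ) :
    ∑ i, |weights B θ i| ≤ ∑ k, dual B θ k := by
  rw [Fintype.sum_prod_type]
  refine Finset.sum_le_sum fun i _ => ?_
  rw [Fintype.sum_bool]
  exact abs_weights_le hB θ i

/-- The potential of the exponentiated gradient algorithm. -/
noncomputable def logPotential (θ : Fin n × Bool → ℝ) : ℝ := Real.log (1 + ∑ k, Real.exp (θ k))

/-- `dual B θ / B` is the gradient of the potential, and `exp y ≤ 1 + y + y ^ 2` for `|y| ≤ 1`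
controls the second order. The summand 1 in the potential is a further expert with gain 0 that holds
the unspent dual mass. -/
theorem logPotential_add_le {θ v : Fin n × Bool → ℝ} {η M B : ℝ} (hη : 0 ≤ η) (hB : 0 < B)
    (hv : ∀ k, |v k| ≤ M) (hηM : η * M ≤ 1) :
    logPotential (θ + η • v) ≤ logPotential θ + η / B * ∑ k, dual B θ k * v k + (η * M) ^ 2 := by
  set W := 1 + ∑ k, Real.exp (θ k) with hW
  have hW0 : 0 < W := by positivity
  have hexp : ∀ k, Real.exp ((θ + η • v) k) ≤
      Real.exp (θ k) * (1 + η * v k + (η * M) ^ 2) := by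
    intro k
    have hvM : |η * v k| ≤ η * M := by
      rw [abs_mul, abs_of_nonneg hη]; exact mul_le_mul_of_nonneg_left (hv k) hη
    have h1 := Real.abs_exp_sub_one_sub_id_le (hvM.trans hηM)
    have h2 : (η * v k) ^ 2 ≤ (η * M) ^ 2 := sq_le_sq' (abs_le.1 hvM).1 (abs_le.1 hvM).2
    simp only [Pi.add_apply, Pi.smul_apply, smul_eq_mul, Real.exp_add]
    refine mul_le_mul_of_nonneg_left ?_ (Real.exp_pos _).le
    have := (abs_le.1 h1).2
    linarith
  have hdual : ∑ k, dual B θ k * v k = B / W * ∑ k, Real.exp (θ k) * v k := by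
    rw [Finset.mul_sum]
    refine Finset.sum_congr rfl fun k _ => ?_
    simp only [dual, ← hW]; ring
  have hstep : 1 + ∑ k, Real.exp ((θ + η • v) k) ≤
      W * Real.exp (η / B * ∑ k, dual B θ k * v k + (η * M) ^ 2) := by
    calc _ ≤ 1 + ∑ k, Real.exp (θ k) * (1 + η * v k + (η * M) ^ 2) := by
          gcongr with k; exact hexp k
      _ = 1 + ((W - 1) * (1 + (η * M) ^ 2) + η * ∑ k, Real.exp (θ k) * v k) := by
          simp only [hW, add_sub_cancel_left, Finset.sum_mul, Finset.mul_sum,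
            ← Finset.sum_add_distrib]
          congr 1
          refine Finset.sum_congr rfl fun k _ => ?_
          ring
      _ ≤ W * (η / B * ∑ k, dual B θ k * v k + (η * M) ^ 2 + 1) := by
          rw [hdual]
          have : W * (η / B * (B / W * ∑ k, Real.exp (θ k) * v k) + (η * M) ^ 2 + 1) =
              η * ∑ k, Real.exp (θ k) * v k + W * (η * M) ^ 2 + W := by
            field_simp
          rw [this]
          nlinarith [sq_nonneg (η * M)]
      _ ≤ _ := mul_le_mul_of_nonneg_left (Real.add_one_le_exp _) hW0.le
  unfold logPotential
  calc _ ≤ Real.log (W * Real.exp (η / B * ∑ k, dual B θ k * v k + (η * M) ^ 2)) :=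
        Real.log_le_log (by positivity) hstep
    _ = _ := by rw [Real.log_mul hW0.ne' (Real.exp_pos _).ne', Real.log_exp]; ring

/-- The regret bound of the exponentiated gradient algorithm, against the vertices of the dual
domain. -/
theorem exponentiatedGradient_regret {T : ℕ} {θ : ℕ → Fin n × Bool → ℝ}
    {v : Fin T → Fin n × Bool → ℝ} {η M B : ℝ} (hη : 0 < η) (hB : 0 < B)
    (hθ₀ : θ 0 = 0) (hθ : ∀ t : Fin T, θ (t + 1) = θ t + η • v t)
    (hv : ∀ t k, |v t k| ≤ M) (hηM : η * M ≤ 1) :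
    (0 ≤ ∑ t : Fin T, ∑ l, dual B (θ t) l * v t l +
      (B * Real.log (2 * n + 1) / η + η * M ^ 2 * B * T)) ∧
    ∀ k, B * ∑ t, v t k ≤ ∑ t : Fin T, ∑ l, dual B (θ t) l * v t l +
      (B * Real.log (2 * n + 1) / η + η * M ^ 2 * B * T) := by
  set R := ∑ t : Fin T, ∑ l, dual B (θ t) l * v t l
  have hpot : logPotential (θ T) ≤ Real.log (2 * n + 1) + η / B * R + T * (η * M) ^ 2 := by
    have h0 : logPotential (θ 0) = Real.log (2 * n + 1) := by
      rw [hθ₀]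
      simp only [logPotential, Pi.zero_apply, Real.exp_zero, Finset.sum_const, Finset.card_univ,
        Fintype.card_prod, Fintype.card_fin, Fintype.card_bool, nsmul_eq_mul, mul_one]
      congr 1; push_cast; ring
    have htel : logPotential (θ T) - logPotential (θ 0) =
        ∑ t : Fin T, (logPotential (θ (t + 1)) - logPotential (θ t)) := by
      rw [Fin.sum_univ_eq_sum_range (fun t => logPotential (θ (t + 1)) - logPotential (θ t)) T,
        Finset.sum_range_sub (fun t => logPotential (θ t))]
    have hle : ∑ t : Fin T, (logPotential (θ (t + 1)) - logPotential (θ t)) ≤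
        ∑ t : Fin T, (η / B * (∑ l, dual B (θ t) l * v t l) + (η * M) ^ 2) := by
      refine Finset.sum_le_sum fun t _ => ?_
      rw [hθ t]
      have := logPotential_add_le (θ := θ t) hη.le hB (hv t) hηM
      linarith
    rw [Finset.sum_add_distrib, ← Finset.mul_sum, Finset.sum_const, Finset.card_univ,
      Fintype.card_fin, nsmul_eq_mul] at hle
    linarith
  have hscale : B / η * (Real.log (2 * n + 1) + η / B * R + T * (η * M) ^ 2) =
      R + (B * Real.log (2 * n + 1) / η + η * M ^ 2 * B * T) := by
    field_simp
    ring
  -- The vertex 0 corresponds to nonnegativity of the final potential, the vertex `B` times the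
  -- `k`-th unit vector to the fact that the potential dominates `θ T k`.
  constructor
  · rw [← hscale]
    refine mul_nonneg (by positivity) (le_trans (Real.log_nonneg ?_) hpot)
    have : 0 ≤ ∑ k, Real.exp (θ T k) := by positivity
    linarith
  · intro k
    have hk : θ T k = η * ∑ t, v t k := by
      have htel : θ T k - θ 0 k = ∑ t : Fin T, (θ (t + 1) k - θ t k) := by
        rw [Fin.sum_univ_eq_sum_range (fun t => θ (t + 1) k - θ t k) T,
          Finset.sum_range_sub (fun t => θ t k)]
      rw [hθ₀, Pi.zero_apply, sub_zero] at htel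
      rw [htel, Finset.mul_sum]
      refine Finset.sum_congr rfl fun t _ => ?_
      rw [hθ t]; simp
    have hle : θ T k ≤ logPotential (θ T) := by
      rw [logPotential, Real.le_log_iff_exp_le (by positivity)]
      have : Real.exp (θ T k) ≤ ∑ l, Real.exp (θ T l) :=
        Finset.single_le_sum (f := fun l => Real.exp (θ T l)) (fun _ _ => (Real.exp_pos _).le)
          (Finset.mem_univ k)
      linarith
    rw [← hscale]
    calc _ = B / η * θ T k := by rw [hk]; field_simp
      _ ≤ _ := mul_le_mul_of_nonneg_left (hle.trans hpot) (by positivity)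

end Dual

/-! ### Rates of mappings -/

/-- The mapping that uses the classifier `h f` for the problem `f`. -/
noncomputable def pureMap {𝒳 𝓕 : Type*} [MeasurableSpace 𝒳] {ℋ : Set (𝒳 → Bool)} (h : 𝓕 → ℋ) :
    𝓕 → Measure ℋ := fun f => Measure.dirac (h f)

section Rates

variable {𝒳 𝓕 : Type*} [MeasurableSpace 𝒳] {ℋ : Set (𝒳 → Bool)}

theorem measurable_eval_hypothesis (x : 𝒳) : Measurable fun h : ℋ => h.1 x :=
  (measurable_pi_apply x).comp measurable_subtype_coe

theorem measurableSet_eval_eq (x : 𝒳) (b : Bool) : MeasurableSet {h : ℋ | h.1 x = b} :=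
  measurable_eval_hypothesis x (MeasurableSet.singleton b)

variable [FunLike 𝓕 𝒳 Bool]

/-- Together with `real_error` this expresses both rates through the single number `M.real {h | h.1
x = true}`, in which they are affine. -/
theorem real_falsePositive (M : Measure ℋ) (f : 𝓕) (x : 𝒳) :
    M.real {h : ℋ | h.1 x = true ∧ f x = false} =
      (1 - bit (f x)) * M.real {h : ℋ | h.1 x = true} := by
  cases hf : f x <;> simp [bit]

theorem real_error (M : Measure ℋ) [IsProbabilityMeasure M] (f : 𝓕) (x : 𝒳) :
    M.real {h : ℋ | h.1 x ≠ f x} =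
      (1 - bit (f x)) * M.real {h : ℋ | h.1 x = true} +
        bit (f x) * (1 - M.real {h : ℋ | h.1 x = true}) := by
  cases hf : f x
  · simp [bit]
  · rw [← probReal_compl_eq_one_sub (measurableSet_eval_eq x true)]
    simp [bit, Set.compl_def]

theorem bit_mem_Icc (b : Bool) : bit b ∈ Set.Icc (0 : ℝ) 1 := by
  cases b <;> simp [bit]

theorem measurable_bit : Measurable bit := measurable_of_countable _

variable [MeasurableSpace 𝓕]

/-! ### Measurability, integrability and range of the rates. -/

section Measurability

variable {ψ : 𝓕 → Measure ℋ}

theorem IsMapping.measurable_real (hψ : IsMapping ψ) :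
    Measurable fun z : 𝓕 × 𝒳 => (ψ z.1).real {h : ℋ | h.1 z.2 = true} :=
  hψ.measurable.ennreal_toReal

theorem IsMapping.measurable_falsePositive (hψ : IsMapping ψ)
    (hev : Measurable fun z : 𝓕 × 𝒳 => z.1 z.2) :
    Measurable fun z : 𝓕 × 𝒳 => (ψ z.1).real {h : ℋ | h.1 z.2 = true ∧ z.1 z.2 = false} := by
  simp_rw [real_falsePositive]
  exact (measurable_const.sub (measurable_bit.comp hev)).mul hψ.measurable_real

theorem IsMapping.measurable_error (hψ : IsMapping ψ)
    (hev : Measurable fun z : 𝓕 × 𝒳 => z.1 z.2) :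
    Measurable fun z : 𝓕 × 𝒳 => (ψ z.1).real {h : ℋ | h.1 z.2 ≠ z.1 z.2} := by
  have := hψ.prob
  simp_rw [real_error]
  exact ((measurable_const.sub (measurable_bit.comp hev)).mul hψ.measurable_real).add
    ((measurable_bit.comp hev).mul (measurable_const.sub hψ.measurable_real))

theorem IsMapping.integrable_falsePositive (hψ : IsMapping ψ)
    (hev : Measurable fun z : 𝓕 × 𝒳 => z.1 z.2) (Q : Measure 𝓕) [IsProbabilityMeasure Q] (x : 𝒳) :
    Integrable (fun f => (ψ f).real {h : ℋ | h.1 x = true ∧ f x = false}) Q := by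
  have := hψ.prob
  exact Integrable.of_mem_Icc 0 1 ((hψ.measurable_falsePositive hev).comp
    measurable_prodMk_right).aemeasurable
    (ae_of_all _ fun f => ⟨measureReal_nonneg, measureReal_le_one⟩)

theorem IsMapping.integrable_error (hψ : IsMapping ψ)
    (hev : Measurable fun z : 𝓕 × 𝒳 => z.1 z.2) (Q : Measure 𝓕) [IsProbabilityMeasure Q] (x : 𝒳) :
    Integrable (fun f => (ψ f).real {h : ℋ | h.1 x ≠ f x}) Q := by
  have := hψ.prob
  exact Integrable.of_mem_Icc 0 1 ((hψ.measurable_error hev).comp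
    measurable_prodMk_right).aemeasurable
    (ae_of_all _ fun f => ⟨measureReal_nonneg, measureReal_le_one⟩)

theorem IsMapping.measurable_indErr (hψ : IsMapping ψ)
    (hev : Measurable fun z : 𝓕 × 𝒳 => z.1 z.2) (Q : Measure 𝓕) [IsProbabilityMeasure Q] :
    Measurable (indErr Q ψ) :=
  ((hψ.measurable_error hev).stronglyMeasurable.integral_prod_left (μ := Q)).measurable

theorem measurableSet_label (hev : Measurable fun z : 𝓕 × 𝒳 => z.1 z.2) (x : 𝒳) (b : Bool) :
    MeasurableSet {f : 𝓕 | f x = b} :=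
  (hev.comp measurable_prodMk_right) (MeasurableSet.singleton b)

theorem indErr_mem_Icc (Q : Measure 𝓕) [IsProbabilityMeasure Q] (hψ : ∀ f, IsProbabilityMeasure (ψ f))
    (x : 𝒳) : indErr Q ψ x ∈ Set.Icc (0 : ℝ) 1 := by
  refine ⟨integral_nonneg fun f => measureReal_nonneg, ?_⟩
  have := integral_mono_of_nonneg (μ := Q) (f := fun f => (ψ f).real {h : ℋ | h.1 x ≠ f x})
    (g := fun _ => 1)
    (ae_of_all _ fun f => measureReal_nonneg) (integrable_const _)
    (ae_of_all _ fun f => measureReal_le_one)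
  rw [integral_const, probReal_univ, one_smul] at this
  exact this

theorem err_mem_Icc (P : Measure 𝒳) [IsProbabilityMeasure P] (Q : Measure 𝓕)
    [IsProbabilityMeasure Q] (hψ : ∀ f, IsProbabilityMeasure (ψ f)) :
    err P Q ψ ∈ Set.Icc (0 : ℝ) 1 := by
  refine ⟨integral_nonneg fun x => (indErr_mem_Icc Q hψ x).1, ?_⟩
  have := integral_mono_of_nonneg (μ := P) (f := indErr Q ψ) (g := fun _ => 1)
    (ae_of_all _ fun x => (indErr_mem_Icc Q hψ x).1) (integrable_const _)
    (ae_of_all _ fun x => (indErr_mem_Icc Q hψ x).2)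
  rw [integral_const, probReal_univ, one_smul] at this
  exact this

theorem rho_mul_fpRate {Q : Measure 𝓕} {x : 𝒳} (hρ : 0 < rho Q x) :
    rho Q x * fpRate Q ψ x = ∫ f, (ψ f).real {h : ℋ | h.1 x = true ∧ f x = false} ∂Q := by
  unfold fpRate; field_simp

theorem rho_le_one (Q : Measure 𝓕) [IsProbabilityMeasure Q] (x : 𝒳) : rho Q x ≤ 1 :=
  measureReal_le_one

theorem rhoInf_le_rho (Q : Measure 𝓕) (x : 𝒳) : rhoInf 𝒳 Q ≤ rho Q x :=
  ciInf_le ⟨0, by rintro _ ⟨y, rfl⟩; exact measureReal_nonneg⟩ x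

theorem integral_one_sub_bit (hev : Measurable fun z : 𝓕 × 𝒳 => z.1 z.2) (Q : Measure 𝓕)
    (x : 𝒳) : ∫ f : 𝓕, (1 - bit (f x)) ∂Q = rho Q x := by
  have : (fun f : 𝓕 => 1 - bit (f x)) = {f : 𝓕 | f x = false}.indicator 1 := by
    funext f; cases h : f x <;> simp [bit, h]
  rw [this, integral_indicator_one (measurableSet_label hev x false)]
  rfl

theorem fpRate_mem_Icc (hev : Measurable fun z : 𝓕 × 𝒳 => z.1 z.2) (Q : Measure 𝓕)
    [IsProbabilityMeasure Q] (hψ : ∀ f, IsProbabilityMeasure (ψ f)) (x : 𝒳) :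
    fpRate Q ψ x ∈ Set.Icc (0 : ℝ) 1 := by
  have h0 : 0 ≤ ∫ f, (ψ f).real {h : ℋ | h.1 x = true ∧ f x = false} ∂Q :=
    integral_nonneg fun f => measureReal_nonneg
  have hρ : 0 ≤ rho Q x := measureReal_nonneg
  refine ⟨by unfold fpRate; positivity, ?_⟩
  have h1 : ∫ f, (ψ f).real {h : ℋ | h.1 x = true ∧ f x = false} ∂Q ≤ rho Q x := by
    rw [← integral_one_sub_bit hev]
    have hle : ∀ f : 𝓕, 1 - bit (f x) ∈ Set.Icc (0 : ℝ) 1 := fun f => by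
      cases f x <;> simp [bit]
    refine integral_mono_of_nonneg (ae_of_all _ fun f => measureReal_nonneg)
      (Integrable.of_mem_Icc 0 1 ?_ (ae_of_all _ hle)) (ae_of_all _ fun f => ?_)
    · exact (measurable_const.sub (measurable_bit.comp
        (hev.comp measurable_prodMk_right))).aemeasurable
    · simp only [real_falsePositive]
      exact mul_le_of_le_one_right (hle f).1 measureReal_le_one
  unfold fpRate
  rw [one_div_mul_eq_div]
  exact div_le_one_of_le₀ h1 hρ

end Measurability

/-! ### The oracle's response -/

section Response

variable {n : ℕ} {csc : (Fin n → 𝒳 × ℝ × ℝ) → ℋ}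

theorem pureMap_real (h : 𝓕 → ℋ) (f : 𝓕) (x : 𝒳) :
    (pureMap h f).real {g : ℋ | g.1 x = true} = bit ((h f).1 x) := by
  rw [pureMap, Measure.real, Measure.dirac_apply' _ (measurableSet_eval_eq _ _)]
  cases h' : (h f).1 x <;> simp [bit, h']

theorem isMapping_pureMap {h : 𝓕 → ℋ} (hh : Measurable fun z : 𝓕 × 𝒳 => (h z.1).1 z.2) :
    IsMapping (pureMap h) := by
  refine ⟨fun f => by unfold pureMap; infer_instance, ?_⟩
  have : (fun z : 𝓕 × 𝒳 => pureMap h z.1 {h : ℋ | h.1 z.2 = true}) =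
      {z : 𝓕 × 𝒳 | (h z.1).1 z.2 = true}.indicator 1 := by
    funext z
    rw [pureMap, Measure.dirac_apply' _ (measurableSet_eval_eq _ _)]
    rfl
  rw [this]
  exact measurable_one.indicator (hh (MeasurableSet.singleton true))

theorem measurable_response (hcsc : IsCSCOracle ℋ csc)
    (hev : Measurable fun z : 𝓕 × 𝒳 => z.1 z.2) {Z : Type*} [MeasurableSpace Z]
    {X : Z → Fin n → 𝒳} {r w : Z → Fin n → ℝ} {f : Z → 𝓕} {x : Z → 𝒳} (hX : Measurable X)
    (hr : Measurable r) (hw : Measurable w) (hf : Measurable f) (hx : Measurable x) :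
    Measurable fun z => (response csc (X z) (r z) (w z) (f z)).1 (x z) := by
  refine hcsc.measurable.comp (Measurable.prodMk (measurable_pi_lambda _ fun i => ?_) hx)
  have hXi := (measurable_pi_apply i).comp hX
  have hri := (measurable_pi_apply i).comp hr
  have hwi := (measurable_pi_apply i).comp hw
  have hb : Measurable fun z => bit (f z (X z i)) := measurable_bit.comp (hev.comp (hf.prodMk hXi))
  exact hXi.prodMk ((((hwi.div hri).add_const _).mul (measurable_const.sub hb)).prodMk
    (hb.const_mul _))

/-- The cost of a randomized classifier for the problem `f`. -/
noncomputable def mixedCost (X : Fin n → 𝒳) (r w : Fin n → ℝ) (M : Measure ℋ) (f : 𝓕) : ℝ :=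
  ∑ i, (w i / r i * M.real {h : ℋ | h.1 (X i) = true ∧ f (X i) = false} +
    1 / n * M.real {h : ℋ | h.1 (X i) ≠ f (X i)})

/-- The oracle's costs are designed for this identity: `w i / r i + 1 / n` charges a false positive
once for unfairness and once as an error, while `1 / n` charges a false negative. -/
theorem integral_cscCost (X : Fin n → 𝒳) (r w : Fin n → ℝ) (M : Measure ℋ)
    [IsProbabilityMeasure M] (f : 𝓕) :
    Integrable (fun h : ℋ => cscCost (cscData X r w f) h.1) M ∧
      ∫ h : ℋ, cscCost (cscData X r w f) h.1 ∂M = mixedCost X r w M f := by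
  have hb : ∀ i, Integrable (fun h : ℋ => bit (h.1 (X i))) M := fun i =>
    Integrable.of_mem_Icc 0 1 (measurable_bit.comp (measurable_eval_hypothesis _)).aemeasurable
      (ae_of_all _ fun h => bit_mem_Icc _)
  have hbi : ∀ i, ∫ h : ℋ, bit (h.1 (X i)) ∂M = M.real {h : ℋ | h.1 (X i) = true} := fun i => by
    rw [← integral_indicator_one (measurableSet_eval_eq _ _)]
    refine integral_congr_ae (ae_of_all _ fun h => ?_)
    cases h' : h.1 (X i) <;> simp [bit, h']
  have hc : ∀ i, Integrable (fun h : ℋ => 1 - bit (h.1 (X i))) M := fun i =>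
    (integrable_const _).sub (hb i)
  have hci : ∀ i, ∫ h : ℋ, (1 - bit (h.1 (X i))) ∂M = 1 - M.real {h : ℋ | h.1 (X i) = true} :=
    fun i => by rw [integral_sub (integrable_const _) (hb i), hbi]; simp
  have hterm : ∀ i, Integrable (fun h : ℋ => (cscData X r w f i).2.1 * bit (h.1 (X i)) +
      (cscData X r w f i).2.2 * (1 - bit (h.1 (X i)))) M := fun i =>
    ((hb i).const_mul _).add ((hc i).const_mul _)
  refine ⟨integrable_finsetSum _ fun i _ => hterm i, ?_⟩
  unfold cscCost mixedCost
  refine (integral_finsetSum _ fun i _ => hterm i).trans ?_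
  refine Finset.sum_congr rfl fun i _ => ?_
  refine (integral_add ((hb i).const_mul _) ((hc i).const_mul _)).trans ?_
  rw [integral_const_mul, integral_const_mul, hbi, hci, real_falsePositive, real_error]
  simp only [cscData]
  ring

/-- Randomizing cannot beat the oracle: its optimality holds against every `h` and is averaged over
`h ∼ M`. -/
theorem mixedCost_response_le (hcsc : IsCSCOracle ℋ csc) (X : Fin n → 𝒳) (r w : Fin n → ℝ)
    (M : Measure ℋ) [IsProbabilityMeasure M] (f : 𝓕) :
    mixedCost X r w (pureMap (response csc X r w) f) f ≤ mixedCost X r w M f := by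
  have : IsProbabilityMeasure (pureMap (response csc X r w) f) := by
    unfold pureMap; infer_instance
  have h1 : mixedCost X r w (pureMap (response csc X r w) f) f =
      cscCost (cscData X r w f) (response csc X r w f).1 := by
    unfold mixedCost cscCost
    refine Finset.sum_congr rfl fun i _ => ?_
    rw [real_falsePositive, real_error]
    rw [pureMap_real]
    simp only [cscData]
    ring
  obtain ⟨hint, heq⟩ := integral_cscCost X r w M f
  rw [h1, ← heq]
  have := integral_mono (μ := M) (integrable_const _) hint fun h =>
    hcsc.optimal (cscData X r w f) h.1 h.2
  simpa [response] using this

/-- The Lagrangian is the integral over `f` of `mixedCost`, so minimizing separately for every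
problem minimizes over all mappings. The factor `rho / r` appears because the oracle is priced with
the estimates. -/
theorem lagrangian_response_le (hcsc : IsCSCOracle ℋ csc)
    (hev : Measurable fun z : 𝓕 × 𝒳 => z.1 z.2) (Q : Measure 𝓕) [IsProbabilityMeasure Q]
    (X : Fin n → 𝒳) (r w : Fin n → ℝ) (hρ : ∀ x, 0 < rho Q x) {ψ : 𝓕 → Measure ℋ}
    (hψ : IsMapping ψ) :
    ∑ i, (w i / r i * (rho Q (X i) * fpRate Q (pureMap (response csc X r w)) (X i)) +
      1 / n * indErr Q (pureMap (response csc X r w)) (X i)) ≤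
    ∑ i, (w i / r i * (rho Q (X i) * fpRate Q ψ (X i)) + 1 / n * indErr Q ψ (X i)) := by
  have key : ∀ {φ : 𝓕 → Measure ℋ}, IsMapping φ →
      Integrable (fun f => mixedCost X r w (φ f) f) Q ∧
      ∫ f, mixedCost X r w (φ f) f ∂Q =
        ∑ i, (w i / r i * (rho Q (X i) * fpRate Q φ (X i)) + 1 / n * indErr Q φ (X i)) := by
    intro φ hφ
    have h1 := fun i => (hφ.integrable_falsePositive hev Q (X i)).const_mul (w i / r i)
    have h2 := fun i => (hφ.integrable_error hev Q (X i)).const_mul (1 / n : ℝ)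
    refine ⟨integrable_finsetSum _ fun i _ => (h1 i).add (h2 i), ?_⟩
    unfold mixedCost
    refine (integral_finsetSum _ fun i _ => (h1 i).add (h2 i)).trans ?_
    refine Finset.sum_congr rfl fun i _ => ?_
    refine (integral_add (h1 i) (h2 i)).trans ?_
    rw [integral_const_mul, integral_const_mul,
      rho_mul_fpRate (hρ _)]
    rfl
  have hresp : IsMapping (pureMap (response csc X r w) : 𝓕 → Measure ℋ) :=
    isMapping_pureMap (measurable_response hcsc hev measurable_const measurable_const
      measurable_const measurable_fst measurable_snd)
  rw [← (key hresp).2, ← (key hψ).2]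
  exact integral_mono (key hresp).1 (key hψ).1 fun f =>
    have := hψ.prob f
    mixedCost_response_le hcsc X r w (ψ f) f

end Response

end Rates

/-! ### The guarantee of the algorithm on its sample -/

section Sample

variable {𝒳 𝓕 : Type*} [MeasurableSpace 𝒳] [MeasurableSpace 𝓕] [FunLike 𝓕 𝒳 Bool]
  {ℋ : Set (𝒳 → Bool)} {n : ℕ} {csc : (Fin n → 𝒳 × ℝ × ℝ) → ℋ}

theorem batchFPRate_mem_Icc {m₀ : ℕ} (S : Fin m₀ → 𝓕) (h : 𝓕 → ℋ) (x : 𝒳) :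
    batchFPRate S h x ∈ Set.Icc (0 : ℝ) 1 := by
  have h0 : 0 ≤ ∑ s, (if (h (S s)).1 x = true ∧ S s x = false then (1 : ℝ) else 0) :=
    Finset.sum_nonneg fun s _ => by positivity
  have h1 : ∑ s, (if (h (S s)).1 x = true ∧ S s x = false then (1 : ℝ) else 0) ≤
      ∑ s, if S s x = false then (1 : ℝ) else 0 := by
    refine Finset.sum_le_sum fun s _ => ?_
    split_ifs with h1 h2 <;> simp_all
  unfold batchFPRate
  exact ⟨div_nonneg h0 (h0.trans h1), div_le_one_of_le₀ h1 (h0.trans h1)⟩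

theorem gammaResponse_mem_Icc (w : Fin n → ℝ) : gammaResponse w ∈ Set.Icc (0 : ℝ) 1 := by
  unfold gammaResponse; split_ifs <;> simp

/-- The Lagrangian is linear in `γ`, so an endpoint of `[0, 1]` selected by the sign of the total
weight is optimal. -/
theorem neg_gammaResponse_mul_le (w : Fin n → ℝ) {γ : ℝ} (hγ : γ ∈ Set.Icc (0 : ℝ) 1) :
    -(gammaResponse w * ∑ i, w i) ≤ -(γ * ∑ i, w i) := by
  unfold gammaResponse
  split_ifs with h
  · nlinarith [hγ.2]
  · push Not at h; nlinarith [hγ.1]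

theorem abs_violation_le {m₀ : ℕ} {α : ℝ} (hα : 0 ≤ α) (X : Fin n → 𝒳) (S : Fin m₀ → 𝓕)
    (h : 𝓕 → ℋ) {γ : ℝ} (hγ : γ ∈ Set.Icc (0 : ℝ) 1) (k : Fin n × Bool) :
    |violation α X S h γ k| ≤ 1 + 2 * α := by
  obtain ⟨i, b⟩ := k
  have h1 := batchFPRate_mem_Icc S h (X i)
  obtain ⟨h2, h3⟩ := h1
  obtain ⟨h4, h5⟩ := hγ
  cases b <;> simp only [violation] <;> rw [abs_le] <;> constructor <;> linarith

theorem mean_le_one {c : Fin n → ℝ} (hc : ∀ i, c i ≤ 1) : 1 / (n : ℝ) * ∑ i, c i ≤ 1 := by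
  rcases Nat.eq_zero_or_pos n with rfl | hn
  · simp
  · have : ∑ i, c i ≤ ∑ _i : Fin n, (1 : ℝ) := Finset.sum_le_sum fun i _ => hc i
    rw [Finset.sum_const, Finset.card_univ, Fintype.card_fin, nsmul_eq_mul, mul_one] at this
    rw [one_div_mul_eq_div]
    exact div_le_one_of_le₀ this (Nat.cast_nonneg n)

/-- The Lagrangian gain of the Auditor in one round, compared with a feasible mapping. -/
theorem round_gain_le (hcsc : IsCSCOracle ℋ csc) (hev : Measurable fun z : 𝓕 × 𝒳 => z.1 z.2)
    (Q : Measure 𝓕) [IsProbabilityMeasure Q] (hρ : ∀ x, 0 < rho Q x) (X : Fin n → 𝒳)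
    (r : Fin n → ℝ) {B α κ κ' : ℝ} (hB : 0 ≤ B) (hκ : 0 ≤ κ) (hκ' : 0 ≤ κ') (hα : 0 ≤ α)
    (θ : Fin n × Bool → ℝ) {m₀ : ℕ} (S : Fin m₀ → 𝓕)
    (hS : ∀ i, |batchFPRate S (response csc X r (weights B θ)) (X i) -
      fpRate Q (pureMap (response csc X r (weights B θ))) (X i)| ≤ κ)
    (hr : ∀ i, |rho Q (X i) / r i - 1| ≤ κ') {ψ : 𝓕 → Measure ℋ} (hψ : IsMapping ψ) {γ : ℝ}
    (hγ : γ ∈ Set.Icc (0 : ℝ) 1) (hfair : ∀ i, |fpRate Q ψ (X i) - γ| ≤ α) :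
    ∑ k, dual B θ k * violation α X S (response csc X r (weights B θ))
      (gammaResponse (weights B θ)) k ≤
    1 / n * ∑ i, indErr Q ψ (X i) -
      1 / n * ∑ i, indErr Q (pureMap (response csc X r (weights B θ))) (X i) +
      B * (κ + 2 * κ') := by
  set w := weights B θ with hw
  set h : 𝓕 → ℋ := response csc X r w with hh
  set φ : 𝓕 → Measure ℋ := pureMap h with hφdef
  set L := ∑ k, dual B θ k
  have hφ : IsMapping φ := isMapping_pureMap (h := h) (measurable_response hcsc hev
      (Z := 𝓕 × 𝒳) measurable_const measurable_const measurable_const measurable_fst measurable_snd)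
  have hLB : L ≤ B := sum_dual_le hB θ
  have hwL : ∑ i, |w i| ≤ L := sum_abs_weights_le hB θ
  have hwB := hwL.trans hLB
  have hsum : ∑ k, dual B θ k * violation α X S h (gammaResponse w) k =
      ∑ i, w i * batchFPRate S h (X i) - gammaResponse w * ∑ i, w i - 2 * α * L := by
    simp only [L, Fintype.sum_prod_type, Fintype.sum_bool, violation, Finset.mul_sum,
      ← Finset.sum_sub_distrib]
    refine Finset.sum_congr rfl fun i _ => ?_
    simp only [hw, weights]
    ring
  -- Since the weights have ℓ¹ norm at most `B`, replacing one vector of rates by another at uniform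
  -- distance `c` costs at most `B * c`.
  have hperturb : ∀ {a b : Fin n → ℝ} {c : ℝ}, (∀ i, |a i - b i| ≤ c) → 0 ≤ c →
      ∑ i, w i * a i ≤ ∑ i, w i * b i + B * c := by
    intro a b c hab hc
    have : ∑ i, w i * a i - ∑ i, w i * b i ≤ ∑ i, |w i| * c := by
      rw [← Finset.sum_sub_distrib]
      refine Finset.sum_le_sum fun i _ => ?_
      rw [← mul_sub]
      exact (le_abs_self _).trans ((abs_mul _ _).trans_le
        (mul_le_mul_of_nonneg_left (hab i) (abs_nonneg _)))
    rw [← Finset.sum_mul] at this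
    linarith [mul_le_mul_of_nonneg_right hwB hc]
  have hclose : ∀ {χ : 𝓕 → Measure ℋ}, IsMapping χ → ∀ i,
      |fpRate Q χ (X i) - rho Q (X i) / r i * fpRate Q χ (X i)| ≤ κ' := by
    intro χ hχ i
    have h1 := fpRate_mem_Icc hev Q hχ.prob (X i)
    have h2 : fpRate Q χ (X i) - rho Q (X i) / r i * fpRate Q χ (X i) =
        -((rho Q (X i) / r i - 1) * fpRate Q χ (X i)) := by ring
    rw [h2, abs_neg, abs_mul, abs_of_nonneg h1.1]
    exact (mul_le_of_le_one_right (abs_nonneg _) h1.2).trans (hr i)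
  have hbest := lagrangian_response_le hcsc hev Q X r w hρ hψ
  simp only [Finset.sum_add_distrib, ← Finset.mul_sum] at hbest
  have hre : ∀ χ : 𝓕 → Measure ℋ, ∑ i, w i / r i * (rho Q (X i) * fpRate Q χ (X i)) =
      ∑ i, w i * (rho Q (X i) / r i * fpRate Q χ (X i)) := fun χ =>
    Finset.sum_congr rfl fun i _ => by ring
  rw [hre, hre] at hbest
  -- Three replacements give `κ + 2 * κ'`: batch rate by true rate for the played mapping, true by
  -- rescaled rate for that mapping, and rescaled by true rate for the comparator.
  have s1 := hperturb hS hκ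
  have s2 := hperturb (hclose hφ) hκ'
  have s3 := hperturb (fun i => (abs_sub_comm _ _).trans_le (hclose hψ i)) hκ'
  have s4 := neg_gammaResponse_mul_le w hγ
  have s5 : ∑ i, w i * fpRate Q ψ (X i) - γ * ∑ i, w i ≤ α * L := by
    rw [mul_comm γ, Finset.sum_mul, ← Finset.sum_sub_distrib]
    calc _ ≤ ∑ i, |w i| * α := by
          refine Finset.sum_le_sum fun i _ => ?_
          rw [← mul_sub]
          exact (le_abs_self _).trans ((abs_mul _ _).trans_le
            (mul_le_mul_of_nonneg_left (hfair i) (abs_nonneg _)))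
      _ = (∑ i, |w i|) * α := by rw [Finset.sum_mul]
      _ ≤ _ := by rw [mul_comm]; exact mul_le_mul_of_nonneg_left hwL hα
  -- The Auditor grants a slack of `2 * α`, but the comparator needs only `α`; the remaining `-α *
  -- L` is dropped.
  have hL0 : 0 ≤ α * L := mul_nonneg hα (Finset.sum_nonneg fun k _ => dual_nonneg hB θ k)
  rw [hsum]
  linarith

/-- The mapping that the Learner plays in round `t`. -/
noncomputable def roundResponse {T m₀ : ℕ} (csc : (Fin n → 𝒳 × ℝ × ℝ) → ℋ) (α ν : ℝ) (X : Fin n → 𝒳)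
    (r : Fin n → ℝ) (S : Fin T → Fin m₀ → 𝓕) (t : Fin T) : 𝓕 → ℋ :=
  response csc X r (roundWeights csc α ν X r S t)

theorem theta_succ {T m₀ : ℕ} (α ν : ℝ) (X : Fin n → 𝒳) (r : Fin n → ℝ)
    (S : Fin T → Fin m₀ → 𝓕) (t : Fin T) :
    theta csc α ν X r S (t + 1) = theta csc α ν X r S t + learningRate α ν •
      violation α X (S t) (roundResponse csc α ν X r S t)
        (gammaResponse (roundWeights csc α ν X r S t)) := by
  rw [theta]
  simp only [t.2, dif_pos, Fin.eta]
  rfl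

theorem dualBound_pos {α ν : ℝ} (hα : 0 < α) (hν : 0 < ν) : 0 < dualBound α ν := by
  unfold dualBound; positivity

theorem le_numRounds (n : ℕ) (α ν : ℝ) :
    16 * dualBound α ν ^ 2 * (1 + 2 * α) ^ 2 * Real.log (2 * n + 1) / ν ^ 2 ≤ numRounds n α ν :=
  Nat.le_ceil _

/-- The regret of the Auditor is at most `ν / 2` per round. -/
theorem regret_const_le (n : ℕ) {α ν : ℝ} (hα : 0 < α) (hν : 0 < ν) :
    dualBound α ν * Real.log (2 * n + 1) / learningRate α ν +
      learningRate α ν * (1 + 2 * α) ^ 2 * dualBound α ν * numRounds n α ν ≤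
      ν / 2 * numRounds n α ν := by
  have hB := dualBound_pos hα hν
  have h1 := le_numRounds n α ν
  -- `η` and `T` balance the two terms: the first is `ν / 4` times the number of rounds before
  -- rounding up, the second exactly `ν / 4` times `T`.
  have h2 : dualBound α ν * Real.log (2 * n + 1) / learningRate α ν =
      ν / 4 * (16 * dualBound α ν ^ 2 * (1 + 2 * α) ^ 2 * Real.log (2 * n + 1) / ν ^ 2) := by
    unfold learningRate
    field_simp
    ring
  have h3 : learningRate α ν * (1 + 2 * α) ^ 2 * dualBound α ν = ν / 4 := by
    unfold learningRate
    field_simp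
  rw [h2, h3]
  nlinarith

/-- The step-size condition of the regret bound; it holds because `α ≤ 1` forces `B ≥ 1`. -/
theorem learningRate_mul_le_one {α ν : ℝ} (hα : 0 < α) (hα1 : α ≤ 1) (hν : 0 < ν) (hν1 : ν ≤ 1) :
    learningRate α ν * (1 + 2 * α) ≤ 1 := by
  have hB : 1 ≤ dualBound α ν := by
    unfold dualBound; rw [le_div_iff₀ hα]; linarith
  have h1 : learningRate α ν * (1 + 2 * α) = ν / (4 * (1 + 2 * α) * dualBound α ν) := by
    unfold learningRate
    have := dualBound_pos hα hν
    field_simp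
  rw [h1, div_le_one (by positivity)]
  nlinarith

/-- Summing `round_gain_le` bounds the Auditor's total gain by the error advantage of the comparator
plus `T * ν`, and the regret adds `T * ν / 2`. Comparison with the vertex 0 yields the error bound.
The fairness bound concerns the batch estimates, since these are what the Auditor sees. -/
theorem sample_guarantee (hcsc : IsCSCOracle ℋ csc)
    (hev : Measurable fun z : 𝓕 × 𝒳 => z.1 z.2) (Q : Measure 𝓕) [IsProbabilityMeasure Q]
    (hρ : ∀ x, 0 < rho Q x) {α ν κ κ' : ℝ} (hα : 0 < α) (hα1 : α ≤ 1) (hν : 0 < ν) (hν1 : ν ≤ 1)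
    (hκ : 0 ≤ κ) (hκ' : 0 ≤ κ') (hκν : dualBound α ν * (κ + 2 * κ') ≤ ν)
    {T : ℕ} (hTn : T = numRounds n α ν) (hT : 0 < T) (X : Fin n → 𝒳) (r : Fin n → ℝ) {m₀ : ℕ}
    (S : Fin T → Fin m₀ → 𝓕)
    (hS : ∀ t i, |batchFPRate (S t) (roundResponse csc α ν X r S t) (X i) -
      fpRate Q (pureMap (roundResponse csc α ν X r S t)) (X i)| ≤ κ)
    (hr : ∀ i, |rho Q (X i) / r i - 1| ≤ κ') {ψ : 𝓕 → Measure ℋ} (hψ : IsMapping ψ) {γ : ℝ}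
    (hγ : γ ∈ Set.Icc (0 : ℝ) 1) (hfair : ∀ i, |fpRate Q ψ (X i) - γ| ≤ α) :
    1 / n * ∑ i, (1 / T *
        ∑ t, indErr Q (pureMap (roundResponse csc α ν X r S t)) (X i)) ≤
      1 / n * ∑ i, indErr Q ψ (X i) + 3 / 2 * ν ∧
    ∀ i, |1 / T * ∑ t, batchFPRate (S t) (roundResponse csc α ν X r S t) (X i) -
      gammaHat csc α ν X r S| ≤ 3 * α := by
  set B := dualBound α ν with hBdef
  have hB : 0 < B := dualBound_pos hα hν
  have hT' : (0 : ℝ) < T := by exact_mod_cast hT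
  set v : Fin T → Fin n × Bool → ℝ := fun t =>
    violation α X (S t) (roundResponse csc α ν X r S t)
        (gammaResponse (roundWeights csc α ν X r S t)) with hv
  set e : Fin T → ℝ := fun t =>
    1 / n * ∑ i, indErr Q (pureMap (roundResponse csc α ν X r S t)) (X i) with he
  set e' : ℝ := 1 / n * ∑ i, indErr Q ψ (X i) with he'
  have hη : 0 < learningRate α ν := by unfold learningRate; positivity
  obtain ⟨hreg0, hregk⟩ := exponentiatedGradient_regret hη hB (θ := theta csc α ν X r S) rfl
    (theta_succ α ν X r S) (fun t k => abs_violation_le hα.le X (S t) _ (gammaResponse_mem_Icc _) k)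
    (learningRate_mul_le_one hα hα1 hν hν1)
  have hconst := regret_const_le n hα hν
  rw [← hTn] at hconst
  have hgain : ∑ t : Fin T, ∑ k, dual B (theta csc α ν X r S t) k * v t k ≤
      T * e' - ∑ t, e t + T * ν := by
    calc _ ≤ ∑ t : Fin T, (e' - e t + ν) := by
          refine Finset.sum_le_sum fun t _ => ?_
          have := round_gain_le hcsc hev Q hρ X r hB.le hκ hκ' hα.le (theta csc α ν X r S t) (S t)
            (hS t) hr hψ hγ hfair
          exact this.trans (add_le_add_right hκν _)
      _ = _ := by
          rw [Finset.sum_add_distrib, Finset.sum_sub_distrib]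
          simp
  have he0 : ∀ t, 0 ≤ e t := fun t =>
    mul_nonneg (by positivity) (Finset.sum_nonneg fun i _ =>
      (indErr_mem_Icc Q (fun f => by unfold pureMap; infer_instance) _).1)
  have he1 : e' ≤ 1 := mean_le_one fun i => (indErr_mem_Icc Q hψ.prob _).2
  have hgamma : gammaHat csc α ν X r S =
      1 / T * ∑ t, gammaResponse (roundWeights csc α ν X r S t) := rfl
  -- Against a vertex, `B` times the average violation is at most `1 + 2 * ν = B * α`. Exceeding the
  -- slack `2 * α` by at most `α` gives `3 * α`.
  have hk : ∀ k, ∑ t, v t k ≤ T * α := by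
    intro k
    have h1 : B * ∑ t, v t k ≤ T * (1 + 2 * ν) := by
      have h2 : 0 ≤ ∑ t, e t := Finset.sum_nonneg fun t _ => he0 t
      have h3 := hregk k
      nlinarith
    have h2 : (1 + 2 * ν) = B * α := by
      rw [hBdef]; unfold dualBound; field_simp
    rw [h2] at h1
    refine le_of_mul_le_mul_left ?_ hB
    linarith
  constructor
  · have h1 : 1 / (n : ℝ) * ∑ i, (1 / T *
        ∑ t, indErr Q (pureMap (roundResponse csc α ν X r S t)) (X i)) = 1 / T * ∑ t, e t := by
      simp only [he, Finset.mul_sum]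
      rw [Finset.sum_comm]
      refine Finset.sum_congr rfl fun t _ => Finset.sum_congr rfl fun i _ => ?_
      ring
    rw [h1, one_div_mul_eq_div, div_le_iff₀ hT']
    linarith
  · intro i
    have ht := hk (i, true)
    have hf := hk (i, false)
    simp only [hv, violation, Finset.sum_sub_distrib, Finset.sum_const, Finset.card_univ,
      Fintype.card_fin, nsmul_eq_mul] at ht hf
    rw [hgamma, ← mul_sub, abs_le]
    constructor
    · rw [one_div_mul_eq_div, le_div_iff₀ hT']; linarith
    · rw [one_div_mul_eq_div, div_le_iff₀ hT']; linarith

end Sample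

/-! ### The rates of the output of the algorithm, and measurability of the algorithm -/

section Algorithm

variable {𝒳 𝓕 : Type*} [MeasurableSpace 𝒳] [MeasurableSpace 𝓕] [FunLike 𝓕 𝒳 Bool]
  {ℋ : Set (𝒳 → Bool)} {n T m₀ : ℕ} {csc : (Fin n → 𝒳 × ℝ × ℝ) → ℋ}

theorem isProbabilityMeasure_pureMap (h : 𝓕 → ℋ) (f : 𝓕) : IsProbabilityMeasure (pureMap h f) := by
  unfold pureMap; infer_instance

theorem psiHat_real (α ν : ℝ) (X : Fin n → 𝒳) (r : Fin n → ℝ) (S : Fin T → Fin m₀ → 𝓕) (f : 𝓕)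
    (A : Set ℋ) :
    (psiHat csc α ν X r S f).real A =
      1 / T * ∑ t, (pureMap (roundResponse csc α ν X r S t) f).real A := by
  have := fun t => isProbabilityMeasure_pureMap (roundResponse csc α ν X r S t) f
  have h1 : psiHat csc α ν X r S f =
      (T : ℝ≥0∞)⁻¹ • ∑ t, pureMap (roundResponse csc α ν X r S t) f := rfl
  rw [h1, measureReal_ennreal_smul_apply, Measure.real, Measure.finsetSum_apply,
    ENNReal.toReal_sum fun t _ => measure_ne_top _ _]
  simp [Measure.real]

theorem isMapping_roundResponse (hcsc : IsCSCOracle ℋ csc)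
    (hev : Measurable fun z : 𝓕 × 𝒳 => z.1 z.2) (α ν : ℝ) (X : Fin n → 𝒳) (r : Fin n → ℝ)
    (S : Fin T → Fin m₀ → 𝓕) (t : Fin T) : IsMapping (pureMap (roundResponse csc α ν X r S t)) :=
  isMapping_pureMap (h := roundResponse csc α ν X r S t) (measurable_response hcsc hev
    (Z := 𝓕 × 𝒳) measurable_const measurable_const measurable_const measurable_fst measurable_snd)

theorem isMapping_psiHat (hT : 0 < T) (hcsc : IsCSCOracle ℋ csc)
    (hev : Measurable fun z : 𝓕 × 𝒳 => z.1 z.2) (α ν : ℝ) (X : Fin n → 𝒳) (r : Fin n → ℝ)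
    (S : Fin T → Fin m₀ → 𝓕) : IsMapping (psiHat csc α ν X r S) := by
  have happ : ∀ f A, psiHat csc α ν X r S f A =
      (T : ℝ≥0∞)⁻¹ * ∑ t, pureMap (roundResponse csc α ν X r S t) f A := fun f A => by
    have h1 : psiHat csc α ν X r S f =
      (T : ℝ≥0∞)⁻¹ • ∑ t, pureMap (roundResponse csc α ν X r S t) f := rfl
    rw [h1, Measure.smul_apply, Measure.finsetSum_apply, smul_eq_mul]
  constructor
  · intro f
    constructor
    have := fun t => isProbabilityMeasure_pureMap (roundResponse csc α ν X r S t) f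
    rw [happ]
    simp only [measure_univ, Finset.sum_const, Finset.card_univ, Fintype.card_fin, nsmul_eq_mul,
      mul_one]
    exact ENNReal.inv_mul_cancel (by exact_mod_cast hT.ne') (by simp)
  · simp only [happ]
    exact (Finset.measurable_sum _ fun t _ =>
      (isMapping_roundResponse hcsc hev α ν X r S t).measurable).const_mul _

theorem indErr_psiHat (hcsc : IsCSCOracle ℋ csc)
    (hev : Measurable fun z : 𝓕 × 𝒳 => z.1 z.2) (Q : Measure 𝓕) [IsProbabilityMeasure Q]
    (α ν : ℝ) (X : Fin n → 𝒳) (r : Fin n → ℝ) (S : Fin T → Fin m₀ → 𝓕) (x : 𝒳) :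
    indErr Q (psiHat csc α ν X r S) x =
      1 / T * ∑ t, indErr Q (pureMap (roundResponse csc α ν X r S t)) x := by
  unfold indErr
  simp only [psiHat_real]
  rw [integral_const_mul, integral_finsetSum _ fun t _ =>
    (isMapping_roundResponse hcsc hev α ν X r S t).integrable_error hev Q x]

theorem fpRate_psiHat (hcsc : IsCSCOracle ℋ csc)
    (hev : Measurable fun z : 𝓕 × 𝒳 => z.1 z.2) (Q : Measure 𝓕) [IsProbabilityMeasure Q]
    (α ν : ℝ) (X : Fin n → 𝒳) (r : Fin n → ℝ) (S : Fin T → Fin m₀ → 𝓕) (x : 𝒳) :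
    fpRate Q (psiHat csc α ν X r S) x =
      1 / T * ∑ t, fpRate Q (pureMap (roundResponse csc α ν X r S t)) x := by
  unfold fpRate
  simp only [psiHat_real]
  rw [integral_const_mul, integral_finsetSum _ fun t _ =>
    (isMapping_roundResponse hcsc hev α ν X r S t).integrable_falsePositive hev Q x,
    ← Finset.mul_sum]
  ring

/-- The indicator of a false positive. -/
def fpInd (h : 𝓕 → ℋ) (x : 𝒳) (f : 𝓕) : ℝ := if (h f).1 x = true ∧ f x = false then 1 else 0

/-- The indicator of the label 0. -/
def zeroInd (x : 𝒳) (f : 𝓕) : ℝ := if f x = false then 1 else 0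

/-- The indicator of an error. -/
def errInd (h : 𝓕 → ℋ) (x : 𝒳) (f : 𝓕) : ℝ := if (h f).1 x ≠ f x then 1 else 0

theorem fpInd_mem_Icc (h : 𝓕 → ℋ) (x : 𝒳) (f : 𝓕) : fpInd h x f ∈ Set.Icc (0 : ℝ) 1 := by
  unfold fpInd; split_ifs <;> simp

theorem zeroInd_mem_Icc (x : 𝒳) (f : 𝓕) : zeroInd x f ∈ Set.Icc (0 : ℝ) 1 := by
  unfold zeroInd; split_ifs <;> simp

theorem errInd_mem_Icc (h : 𝓕 → ℋ) (x : 𝒳) (f : 𝓕) : errInd h x f ∈ Set.Icc (0 : ℝ) 1 := by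
  unfold errInd; split_ifs <;> simp

theorem integral_fpInd {Q : Measure 𝓕} {x : 𝒳} (hρ : 0 < rho Q x) (h : 𝓕 → ℋ) :
    ∫ f, fpInd h x f ∂Q = rho Q x * fpRate Q (pureMap h) x := by
  rw [rho_mul_fpRate hρ]
  refine integral_congr_ae (ae_of_all _ fun f => ?_)
  simp only [real_falsePositive, pureMap_real]
  cases h1 : (h f).1 x <;> cases h2 : f x <;> simp [fpInd, bit, h1, h2]

theorem integral_zeroInd (hev : Measurable fun z : 𝓕 × 𝒳 => z.1 z.2) (Q : Measure 𝓕) (x : 𝒳) :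
    ∫ f : 𝓕, zeroInd x f ∂Q = rho Q x := by
  rw [← integral_one_sub_bit hev]
  refine integral_congr_ae (ae_of_all _ fun f => ?_)
  cases h2 : f x <;> simp [zeroInd, bit, h2]

theorem integral_errInd (Q : Measure 𝓕) (x : 𝒳) (h : 𝓕 → ℋ) :
    ∫ f, errInd h x f ∂Q = indErr Q (pureMap h) x := by
  refine integral_congr_ae (ae_of_all _ fun f => ?_)
  have := isProbabilityMeasure_pureMap h f
  simp only [real_error, pureMap_real]
  cases h1 : (h f).1 x <;> cases h2 : f x <;> simp [errInd, bit, h1, h2]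

section Measurability

variable {Z : Type*} [MeasurableSpace Z]

theorem measurable_fpInd (hev : Measurable fun z : 𝓕 × 𝒳 => z.1 z.2) {h : Z → 𝓕 → ℋ} {f : Z → 𝓕}
    {x : Z → 𝒳} (hh : Measurable fun z => (h z (f z)).1 (x z)) (hf : Measurable f)
    (hx : Measurable x) : Measurable fun z => fpInd (h z) (x z) (f z) := by
  have h1 : Measurable fun z => (f z) (x z) := hev.comp (hf.prodMk hx)
  exact Measurable.ite ((hh (MeasurableSet.singleton true)).inter (h1 (MeasurableSet.singleton false)))
    measurable_const measurable_const

theorem measurable_zeroInd (hev : Measurable fun z : 𝓕 × 𝒳 => z.1 z.2) {f : Z → 𝓕}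
    {x : Z → 𝒳} (hf : Measurable f)
    (hx : Measurable x) : Measurable fun z => zeroInd (x z) (f z) :=
  have h1 : Measurable fun z => (f z) (x z) := hev.comp (hf.prodMk hx)
  Measurable.ite (h1 (MeasurableSet.singleton false)) measurable_const measurable_const

theorem measurable_errInd (hev : Measurable fun z : 𝓕 × 𝒳 => z.1 z.2) {h : Z → 𝓕 → ℋ} {f : Z → 𝓕}
    {x : Z → 𝒳} (hh : Measurable fun z => (h z (f z)).1 (x z)) (hf : Measurable f)
    (hx : Measurable x) : Measurable fun z => errInd (h z) (x z) (f z) := by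
  have h1 : Measurable fun z => (f z) (x z) := hev.comp (hf.prodMk hx)
  exact Measurable.ite (measurableSet_eq_fun hh h1).compl measurable_const measurable_const

theorem measurable_batchFPRate (hev : Measurable fun z : 𝓕 × 𝒳 => z.1 z.2) {h : Z → 𝓕 → ℋ}
    {S : Z → Fin m₀ → 𝓕} {x : Z → 𝒳} (hh : ∀ s, Measurable fun z => (h z (S z s)).1 (x z))
    (hS : Measurable S) (hx : Measurable x) :
    Measurable fun z => batchFPRate (S z) (h z) (x z) := by
  have hSs := fun s => (measurable_pi_apply s).comp hS
  exact (Finset.measurable_sum _ fun s _ => measurable_fpInd hev (hh s) (hSs s) hx).div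
    (Finset.measurable_sum _ fun s _ => measurable_zeroInd hev (hSs s) hx)

theorem measurable_weights {B : ℝ} : Measurable (weights (n := n) B) := by
  have hd : ∀ k : Fin n × Bool, Measurable fun θ : Fin n × Bool → ℝ => dual B θ k := fun k => by
    unfold dual; fun_prop
  exact measurable_pi_lambda _ fun i => (hd _).sub (hd _)

theorem measurable_gammaResponse : Measurable (gammaResponse (n := n)) :=
  Measurable.ite (measurableSet_lt measurable_const
    (Finset.measurable_sum _ fun i _ => measurable_pi_apply i)) measurable_const measurable_const

theorem measurable_theta (hcsc : IsCSCOracle ℋ csc) (hev : Measurable fun z : 𝓕 × 𝒳 => z.1 z.2)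
    (α ν : ℝ) {X : Z → Fin n → 𝒳} {r : Z → Fin n → ℝ} {S : Z → Fin T → Fin m₀ → 𝓕}
    (hX : Measurable X) (hr : Measurable r) (hS : Measurable S) (t : ℕ) :
    Measurable fun z => theta csc α ν (X z) (r z) (S z) t := by
  induction t with
  | zero => exact measurable_const
  | succ t ih =>
    by_cases ht : t < T
    · simp only [theta, ht, dif_pos]
      have hw : Measurable fun z => weights (dualBound α ν) (theta csc α ν (X z) (r z) (S z) t) :=
        measurable_weights.comp ih
      have hγ := measurable_gammaResponse.comp hw
      have hSt := (measurable_pi_apply (⟨t, ht⟩ : Fin T)).comp hS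
      have hb : ∀ i, Measurable fun z => batchFPRate (S z ⟨t, ht⟩) (response csc (X z) (r z)
          (weights (dualBound α ν) (theta csc α ν (X z) (r z) (S z) t))) (X z i) := fun i =>
        measurable_batchFPRate hev (fun s => measurable_response hcsc hev hX hr hw
          ((measurable_pi_apply s).comp hSt) ((measurable_pi_apply i).comp hX)) hSt
          ((measurable_pi_apply i).comp hX)
      refine measurable_pi_lambda _ fun k => ((measurable_pi_apply k).comp ih).add
        (Measurable.const_mul ?_ (learningRate α ν))
      obtain ⟨i, b⟩ := k
      cases b
      · exact (hγ.sub (hb i)).sub_const _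
      · exact ((hb i).sub hγ).sub_const _
    · simpa only [theta, ht, dif_neg, not_false_eq_true] using ih

theorem measurable_roundWeights (hcsc : IsCSCOracle ℋ csc)
    (hev : Measurable fun z : 𝓕 × 𝒳 => z.1 z.2)
    (α ν : ℝ) {X : Z → Fin n → 𝒳} {r : Z → Fin n → ℝ} {S : Z → Fin T → Fin m₀ → 𝓕}
    (hX : Measurable X) (hr : Measurable r) (hS : Measurable S) (t : Fin T) :
    Measurable fun z => roundWeights csc α ν (X z) (r z) (S z) t :=
  measurable_weights.comp (measurable_theta hcsc hev α ν hX hr hS t)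

theorem measurable_roundResponse (hcsc : IsCSCOracle ℋ csc)
    (hev : Measurable fun z : 𝓕 × 𝒳 => z.1 z.2)
    (α ν : ℝ) {X : Z → Fin n → 𝒳} {r : Z → Fin n → ℝ} {S : Z → Fin T → Fin m₀ → 𝓕} {f : Z → 𝓕}
    {x : Z → 𝒳} (hX : Measurable X) (hr : Measurable r) (hS : Measurable S) (t : Fin T)
    (hf : Measurable f) (hx : Measurable x) :
    Measurable fun z => (roundResponse csc α ν (X z) (r z) (S z) t (f z)).1 (x z) :=
  measurable_response hcsc hev hX hr (measurable_roundWeights hcsc hev α ν hX hr hS t) hf hx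

theorem measurable_gammaHat (hcsc : IsCSCOracle ℋ csc)
    (hev : Measurable fun z : 𝓕 × 𝒳 => z.1 z.2)
    (α ν : ℝ) {X : Z → Fin n → 𝒳} {r : Z → Fin n → ℝ} {S : Z → Fin T → Fin m₀ → 𝓕}
    (hX : Measurable X) (hr : Measurable r) (hS : Measurable S) :
    Measurable fun z => gammaHat csc α ν (X z) (r z) (S z) :=
  (Finset.measurable_sum _ fun t _ => measurable_gammaResponse.comp
    (measurable_roundWeights hcsc hev α ν hX hr hS t)).const_mul _

end Measurability

/-! ### Accuracy of the estimates on a fresh batch -/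

/-- The averages over the batch `S` are within `ε` of their expectations. -/
structure BatchAccurate (Q : Measure 𝓕) (ε : ℝ) (S : Fin m₀ → 𝓕) (h : 𝓕 → ℋ) (x : 𝒳) : Prop where
  fp : |1 / m₀ * ∑ s, fpInd h x (S s) - ∫ f, fpInd h x f ∂Q| ≤ ε
  zero : |1 / m₀ * ∑ s, zeroInd x (S s) - ∫ f : 𝓕, zeroInd x f ∂Q| ≤ ε
  error : |1 / m₀ * ∑ s, errInd h x (S s) - ∫ f, errInd h x f ∂Q| ≤ ε

theorem batchAccurate_iff (Q : Measure 𝓕) (ε : ℝ) (S : Fin m₀ → 𝓕) (h : 𝓕 → ℋ) (x : 𝒳) :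
    BatchAccurate Q ε S h x ↔ |1 / m₀ * ∑ s, fpInd h x (S s) - ∫ f, fpInd h x f ∂Q| ≤ ε ∧
      |1 / m₀ * ∑ s, zeroInd x (S s) - ∫ f : 𝓕, zeroInd x f ∂Q| ≤ ε ∧
      |1 / m₀ * ∑ s, errInd h x (S s) - ∫ f, errInd h x f ∂Q| ≤ ε :=
  ⟨fun ⟨a, b, c⟩ => ⟨a, b, c⟩, fun ⟨a, b, c⟩ => ⟨a, b, c⟩⟩

/-- With `q * b = a`, the identity `(q - E) * ρ = (a - ρ * E) - q * (b - ρ)` and `0 ≤ q ≤ 1` bound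
the error of the ratio without a lower bound on the empirical denominator. If that denominator
vanishes then so does `a`, and the convention `0 / 0 = 0` does no harm. -/
theorem BatchAccurate.batchFPRate_close (hm₀ : 0 < m₀) (hev : Measurable fun z : 𝓕 × 𝒳 => z.1 z.2)
    {Q : Measure 𝓕} [IsProbabilityMeasure Q] {ε ρ₀ : ℝ} {S : Fin m₀ → 𝓕} {h : 𝓕 → ℋ} {x : 𝒳}
    (hacc : BatchAccurate Q ε S h x) (hρ₀ : 0 < ρ₀) (hρ : ρ₀ ≤ rho Q x) :
    |batchFPRate S h x - fpRate Q (pureMap h) x| ≤ 2 * ε / ρ₀ := by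
  have hm : (0 : ℝ) < m₀ := by exact_mod_cast hm₀
  have hρx := hρ₀.trans_le hρ
  obtain ⟨h1, h2, -⟩ := hacc
  rw [integral_fpInd hρx] at h1
  rw [integral_zeroInd hev] at h2
  obtain ⟨hE0, hE1⟩ := fpRate_mem_Icc hev Q (isProbabilityMeasure_pureMap h) x
  obtain ⟨hb0, hb1⟩ := batchFPRate_mem_Icc S h x
  set a := 1 / (m₀ : ℝ) * ∑ s, fpInd h x (S s) with ha
  set b := 1 / (m₀ : ℝ) * ∑ s, zeroInd x (S s) with hb
  set ρ := rho Q x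
  set E := fpRate Q (pureMap h) x
  set q := batchFPRate S h x with hq
  have hqab : q * b = a := by
    have hle : ∑ s, fpInd h x (S s) ≤ ∑ s, zeroInd x (S s) := Finset.sum_le_sum fun s _ => by
      unfold fpInd zeroInd
      split_ifs with h1 h2 <;> simp_all
    have h0 : 0 ≤ ∑ s, fpInd h x (S s) := Finset.sum_nonneg fun s _ => (fpInd_mem_Icc h x _).1
    have hq' : q = (∑ s, fpInd h x (S s)) / ∑ s, zeroInd x (S s) := rfl
    by_cases hz : ∑ s, zeroInd x (S s) = 0
    · have : ∑ s, fpInd h x (S s) = 0 := le_antisymm (hle.trans_eq hz) h0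
      rw [ha, hb, hz, this]; simp
    · rw [hq', ha, hb]; field_simp
  have hε : 0 ≤ ε := (abs_nonneg _).trans h1
  have hkey : |q - E| * ρ ≤ 2 * ε := by
    have : (q - E) * ρ = (a - ρ * E) - q * (b - ρ) := by rw [← hqab]; ring
    rw [← abs_of_pos hρx, ← abs_mul, this]
    calc _ ≤ |a - ρ * E| + |q * (b - ρ)| := abs_sub _ _
      _ ≤ ε + ε := by
          refine add_le_add h1 ?_
          rw [abs_mul, abs_of_nonneg hb0]
          exact (mul_le_of_le_one_left (abs_nonneg _) hb1).trans h2
      _ = _ := by ring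
  rw [le_div_iff₀ hρ₀]
  exact (mul_le_mul_of_nonneg_left hρ (abs_nonneg _)).trans hkey

/-- Three two-sided Hoeffding bounds, whence the factor 6. The classifiers `h` are fixed before the
batch is drawn. -/
theorem measure_not_batchAccurate_le (hm₀ : 0 < m₀) (hev : Measurable fun z : 𝓕 × 𝒳 => z.1 z.2)
    (Q : Measure 𝓕) [IsProbabilityMeasure Q] {ε : ℝ} (hε : 0 ≤ ε) {h : 𝓕 → ℋ} (x : 𝒳)
    (hh : Measurable fun f => (h f).1 x) :
    (Measure.pi fun _ : Fin m₀ => Q) {S | ¬ BatchAccurate Q ε S h x} ≤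
      ENNReal.ofReal (6 * Real.exp (-2 * m₀ * ε ^ 2)) := by
  have h1 := hoeffding_mean Q hm₀ (measurable_fpInd (Z := 𝓕) (h := fun _ => h) (x := fun _ => x)
    hev hh measurable_id measurable_const) (fpInd_mem_Icc h x) hε
  have h2 := hoeffding_mean Q hm₀ (measurable_zeroInd (Z := 𝓕) (x := fun _ => x)
    hev measurable_id measurable_const) (zeroInd_mem_Icc x) hε
  have h3 := hoeffding_mean Q hm₀ (measurable_errInd (Z := 𝓕) (h := fun _ => h) (x := fun _ => x)
    hev hh measurable_id measurable_const) (errInd_mem_Icc h x) hε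
  have hsub : {S : Fin m₀ → 𝓕 | ¬ BatchAccurate Q ε S h x} ⊆
      {S | ε < |1 / m₀ * ∑ s, fpInd h x (S s) - ∫ f, fpInd h x f ∂Q|} ∪
      ({S | ε < |1 / m₀ * ∑ s, zeroInd x (S s) - ∫ f : 𝓕, zeroInd x f ∂Q|} ∪
      {S | ε < |1 / m₀ * ∑ s, errInd h x (S s) - ∫ f, errInd h x f ∂Q|}) := by
    intro S hS
    simp only [Set.mem_ofPred_eq, batchAccurate_iff, not_and_or, not_le] at hS
    exact hS
  calc _ ≤ _ := measure_mono hsub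
    _ ≤ _ := measure_union_le _ _
    _ ≤ _ := add_le_add h1 ((measure_union_le _ _).trans (add_le_add h2 h3))
    _ = _ := by
      rw [← ENNReal.ofReal_add (by positivity) (by positivity),
        ← ENNReal.ofReal_add (by positivity) (by positivity)]
      congr 1; ring

theorem measurableSet_mean_close {Z Y : Type*} [MeasurableSpace Z] [MeasurableSpace Y]
    (Q : Measure Y) [IsProbabilityMeasure Q] (ε : ℝ) {φ : Z → Y → ℝ} {S : Z → Fin m₀ → Y}
    (hφ : Measurable fun z : Z × Y => φ z.1 z.2) (hS : Measurable S) :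
    MeasurableSet {z | |1 / m₀ * ∑ s, φ z (S z s) - ∫ y, φ z y ∂Q| ≤ ε} := by
  have h1 : Measurable fun z => ∑ s, φ z (S z s) := Finset.measurable_sum _ fun s _ =>
    hφ.comp (measurable_id.prodMk ((measurable_pi_apply s).comp hS))
  have h2 : Measurable fun z => ∫ y, φ z y ∂Q :=
    (hφ.stronglyMeasurable.integral_prod_right' (ν := Q)).measurable
  exact measurableSet_le ((h1.const_mul _).sub h2).abs measurable_const

theorem measurableSet_batchAccurate {Z : Type*} [MeasurableSpace Z]
    (hev : Measurable fun z : 𝓕 × 𝒳 => z.1 z.2) (Q : Measure 𝓕) [IsProbabilityMeasure Q] (ε : ℝ)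
    {h : Z → 𝓕 → ℋ} {S : Z → Fin m₀ → 𝓕} {x : Z → 𝒳}
    (hh : Measurable fun z : Z × 𝓕 => (h z.1 z.2).1 (x z.1)) (hS : Measurable S)
    (hx : Measurable x) : MeasurableSet {z | BatchAccurate Q ε (S z) (h z) (x z)} := by
  simp only [batchAccurate_iff]
  have hx' : Measurable fun z : Z × 𝓕 => x z.1 := hx.comp measurable_fst
  exact (measurableSet_mean_close Q ε (φ := fun z => fpInd (h z) (x z))
      (measurable_fpInd (h := fun z : Z × 𝓕 => h z.1) hev hh measurable_snd hx') hS).inter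
    ((measurableSet_mean_close Q ε (φ := fun z => zeroInd (x z))
      (measurable_zeroInd hev measurable_snd hx') hS).inter
    (measurableSet_mean_close Q ε (φ := fun z => errInd (h z) (x z))
      (measurable_errInd (h := fun z : Z × 𝓕 => h z.1) hev hh measurable_snd hx') hS))

/-- The state at the start of round `k` reads only the batches before `k`. This is what makes the
batch of round `t` fresh. -/
theorem theta_update (α ν : ℝ) (X : Fin n → 𝒳) (r : Fin n → ℝ) (S : Fin T → Fin m₀ → 𝓕)
    (t : Fin T) (y : Fin m₀ → 𝓕) {k : ℕ} (hk : k ≤ t) :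
    theta csc α ν X r (Function.update S t y) k = theta csc α ν X r S k := by
  induction k with
  | zero => rfl
  | succ k ih =>
    have hkT : k < T := lt_of_lt_of_le hk t.2.le
    have hne : (⟨k, hkT⟩ : Fin T) ≠ t := fun h => by
      have : k = t := congrArg Fin.val h
      omega
    simp only [theta, hkT, dif_pos, ih (by omega), Function.update_of_ne hne]

theorem roundResponse_update (α ν : ℝ) (X : Fin n → 𝒳) (r : Fin n → ℝ) (S : Fin T → Fin m₀ → 𝓕)
    (t : Fin T) (y : Fin m₀ → 𝓕) :
    roundResponse csc α ν X r (Function.update S t y) t = roundResponse csc α ν X r S t := by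
  unfold roundResponse roundWeights
  rw [theta_update α ν X r S t y le_rfl]

/-- The batch of a round is fresh for the mapping played in that round. -/
theorem measure_round_not_accurate_le (hm₀ : 0 < m₀) (hcsc : IsCSCOracle ℋ csc)
    (hev : Measurable fun z : 𝓕 × 𝒳 => z.1 z.2) (Q : Measure 𝓕) [IsProbabilityMeasure Q] {ε : ℝ}
    (hε : 0 ≤ ε) (α ν : ℝ) (X : Fin n → 𝒳) (r : Fin n → ℝ) (t : Fin T) (x : 𝒳) :
    (Measure.pi fun _ : Fin T => Measure.pi fun _ : Fin m₀ => Q)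
      {S | ¬ BatchAccurate Q ε (S t) (roundResponse csc α ν X r S t) x} ≤
      ENNReal.ofReal (6 * Real.exp (-2 * m₀ * ε ^ 2)) := by
  refine pi_measure_le_of_update _ ?_ t fun S => ?_
  · refine (measurableSet_batchAccurate hev Q ε
      (h := fun S : Fin T → Fin m₀ → 𝓕 => roundResponse csc α ν X r S t)
      (x := fun _ => x) ?_ (measurable_pi_apply t) measurable_const).compl
    exact measurable_roundResponse hcsc hev α ν (Z := (Fin T → Fin m₀ → 𝓕) × 𝓕) measurable_const
      measurable_const measurable_fst t measurable_snd measurable_const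
  -- With all other batches frozen, the response of round `t` no longer varies with the resampled
  -- batch.
  · simp only [Set.mem_ofPred_eq, Function.update_self, roundResponse_update]
    refine measure_not_batchAccurate_le hm₀ hev Q hε x ?_
    exact measurable_response hcsc hev (Z := 𝓕) measurable_const measurable_const measurable_const
      measurable_id measurable_const

end Algorithm

/-! ### Generalization to the distribution over individuals -/

section Generalization

variable {𝒳 𝓕 : Type*} [MeasurableSpace 𝒳] [MeasurableSpace 𝓕] [FunLike 𝓕 𝒳 Bool]
  {ℋ : Set (𝒳 → Bool)} {n T m₀ : ℕ} {csc : (Fin n → 𝒳 × ℝ × ℝ) → ℋ}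

/-- The false positive rate at `x`, estimated in every round on the batch of that round. -/
noncomputable def batchMeanFP (csc : (Fin n → 𝒳 × ℝ × ℝ) → ℋ) (α ν : ℝ) (X : Fin n → 𝒳) (r : Fin n → ℝ)
    (S : Fin T → Fin m₀ → 𝓕) (x : 𝒳) : ℝ :=
  1 / T * ∑ t, batchFPRate (S t) (roundResponse csc α ν X r S t) x

/-- The error rate at `x`, estimated in every round on the batch of that round. -/
noncomputable def batchMeanErr (csc : (Fin n → 𝒳 × ℝ × ℝ) → ℋ) (α ν : ℝ) (X : Fin n → 𝒳) (r : Fin n → ℝ)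
    (S : Fin T → Fin m₀ → 𝓕) (x : 𝒳) : ℝ :=
  1 / T * ∑ t, (1 / m₀ * ∑ s, errInd (roundResponse csc α ν X r S t) x (S t s))

/-- The indicator that the estimated false positive rate at `x` is not within `3 α` of `γ̂`. -/
noncomputable def unfairInd (csc : (Fin n → 𝒳 × ℝ × ℝ) → ℋ) (α ν : ℝ) (X : Fin n → 𝒳) (r : Fin n → ℝ)
    (S : Fin T → Fin m₀ → 𝓕) (x : 𝒳) : ℝ :=
  if 3 * α < |batchMeanFP csc α ν X r S x - gammaHat csc α ν X r S| then 1 else 0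

theorem mean_mem_Icc {c : Fin n → ℝ} (hc : ∀ i, c i ∈ Set.Icc (0 : ℝ) 1) :
    1 / (n : ℝ) * ∑ i, c i ∈ Set.Icc (0 : ℝ) 1 :=
  ⟨mul_nonneg (by positivity) (Finset.sum_nonneg fun i _ => (hc i).1),
    mean_le_one fun i => (hc i).2⟩

theorem batchMeanErr_mem_Icc (α ν : ℝ) (X : Fin n → 𝒳) (r : Fin n → ℝ) (S : Fin T → Fin m₀ → 𝓕)
    (x : 𝒳) : batchMeanErr csc α ν X r S x ∈ Set.Icc (0 : ℝ) 1 :=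
  mean_mem_Icc fun _ => mean_mem_Icc fun _ => errInd_mem_Icc _ _ _

theorem unfairInd_mem_Icc (α ν : ℝ) (X : Fin n → 𝒳) (r : Fin n → ℝ) (S : Fin T → Fin m₀ → 𝓕)
    (x : 𝒳) : unfairInd csc α ν X r S x ∈ Set.Icc (0 : ℝ) 1 := by
  unfold unfairInd; split_ifs <;> simp

theorem gammaHat_mem_Icc (α ν : ℝ) (X : Fin n → 𝒳) (r : Fin n → ℝ) (S : Fin T → Fin m₀ → 𝓕) :
    gammaHat csc α ν X r S ∈ Set.Icc (0 : ℝ) 1 :=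
  mean_mem_Icc fun _ => gammaResponse_mem_Icc _

section Measurability

variable {Z : Type*} [MeasurableSpace Z] {X : Z → Fin n → 𝒳} {r : Z → Fin n → ℝ}
  {S : Z → Fin T → Fin m₀ → 𝓕} {x : Z → 𝒳}

theorem measurable_batchMeanErr (hcsc : IsCSCOracle ℋ csc)
    (hev : Measurable fun z : 𝓕 × 𝒳 => z.1 z.2) (α ν : ℝ)
    (hX : Measurable X) (hr : Measurable r) (hS : Measurable S) (hx : Measurable x) :
    Measurable fun z => batchMeanErr csc α ν (X z) (r z) (S z) (x z) := by
  have hSts := fun t s => (measurable_pi_apply (X := fun _ : Fin m₀ => 𝓕) s).comp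
    ((measurable_pi_apply (X := fun _ : Fin T => Fin m₀ → 𝓕) t).comp hS)
  exact (Finset.measurable_sum _ fun t _ => (Finset.measurable_sum _ fun s _ =>
    measurable_errInd hev (measurable_roundResponse hcsc hev α ν hX hr hS t (hSts t s) hx)
      (hSts t s) hx).const_mul _).const_mul _

theorem measurable_batchMeanFP (hcsc : IsCSCOracle ℋ csc)
    (hev : Measurable fun z : 𝓕 × 𝒳 => z.1 z.2) (α ν : ℝ)
    (hX : Measurable X) (hr : Measurable r) (hS : Measurable S) (hx : Measurable x) :
    Measurable fun z => batchMeanFP csc α ν (X z) (r z) (S z) (x z) := by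
  have hSt := fun t => (measurable_pi_apply (X := fun _ : Fin T => Fin m₀ → 𝓕) t).comp hS
  exact (Finset.measurable_sum _ fun t _ => measurable_batchFPRate hev (fun s =>
    measurable_roundResponse hcsc hev α ν hX hr hS t ((measurable_pi_apply s).comp (hSt t)) hx)
      (hSt t) hx).const_mul _

theorem measurable_unfairInd (hcsc : IsCSCOracle ℋ csc)
    (hev : Measurable fun z : 𝓕 × 𝒳 => z.1 z.2) (α ν : ℝ)
    (hX : Measurable X) (hr : Measurable r) (hS : Measurable S) (hx : Measurable x) :
    Measurable fun z => unfairInd csc α ν (X z) (r z) (S z) (x z) :=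
  Measurable.ite (measurableSet_lt measurable_const
    ((measurable_batchMeanFP hcsc hev α ν hX hr hS hx).sub
      (measurable_gammaHat hcsc hev α ν hX hr hS)).abs) measurable_const measurable_const

theorem measurableSet_roundAccurate (hcsc : IsCSCOracle ℋ csc)
    (hev : Measurable fun z : 𝓕 × 𝒳 => z.1 z.2) (Q : Measure 𝓕) [IsProbabilityMeasure Q] (ε α ν : ℝ)
    (hX : Measurable X) (hr : Measurable r) (hS : Measurable S) (hx : Measurable x) (t : Fin T) :
    MeasurableSet
      {z | BatchAccurate Q ε (S z t) (roundResponse csc α ν (X z) (r z) (S z) t) (x z)} :=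
  measurableSet_batchAccurate hev Q ε
    (measurable_roundResponse hcsc hev α ν (Z := Z × 𝓕) (hX.comp measurable_fst)
      (hr.comp measurable_fst) (hS.comp measurable_fst) t measurable_snd (hx.comp measurable_fst))
    ((measurable_pi_apply t).comp hS) hx

end Measurability

/-- Functions of `x` that depend on `a : A` only through `T * m₀` predictions at `x` and a number
`j a ≤ T` take few different sets of values on `2 n` points. -/
theorem exists_finset_values {d : ℕ} (hd : vcDim ℋ = d) {A : Type*} (H : A → Fin T → Fin m₀ → ℋ)
    (j : A → Fin (T + 1)) (Φ : 𝒳 → Fin (T + 1) → (Fin T → Fin m₀ → Bool) → ℝ)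
    (u : Fin n → 𝒳 × 𝒳) :
    ∃ s : Finset (Fin n → ℝ × ℝ), (s.card : ℝ) ≤ (T + 1) * (2 * n + 1) ^ (T * m₀ * d) ∧
      ∀ a, (fun i => (Φ (u i).1 (j a) fun t s => (H a t s).1 (u i).1,
        Φ (u i).2 (j a) fun t s => (H a t s).1 (u i).2)) ∈ s := by
  classical
  -- One set `s₀` of labelings of the `2 * n` points serves all `T * m₀` hypotheses, so a joint
  -- pattern is a family of elements of `s₀` together with the value of `j`.
  obtain ⟨s₀, hcard, hs₀⟩ := exists_finset_labelings hd
    (fun k : Fin n × Bool => if k.2 then (u k.1).2 else (u k.1).1)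
  let F : Fin (T + 1) × (Fin T × Fin m₀ → Fin n × Bool → Bool) → Fin n → ℝ × ℝ := fun p i =>
    (Φ (u i).1 p.1 fun t s => p.2 (t, s) (i, false), Φ (u i).2 p.1 fun t s => p.2 (t, s) (i, true))
  refine ⟨((Finset.univ : Finset (Fin (T + 1))) ×ˢ Fintype.piFinset fun _ => s₀).image F, ?_, ?_⟩
  · have h1 : (((Finset.univ : Finset (Fin (T + 1))) ×ˢ
        Fintype.piFinset fun _ : Fin T × Fin m₀ => s₀).image F).card ≤
        (T + 1) * (2 * n + 1) ^ (T * m₀ * d) := by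
      refine Finset.card_image_le.trans ?_
      rw [Finset.card_product, Fintype.card_piFinset, Finset.card_univ, Fintype.card_fin,
        Finset.prod_const, Finset.card_univ, Fintype.card_prod, Fintype.card_fin, Fintype.card_fin,
        mul_comm (T * m₀) d, pow_mul _ d (T * m₀)]
      refine Nat.mul_le_mul_left _ (Nat.pow_le_pow_left (hcard.trans_eq ?_) _)
      simp [mul_comm]
    exact_mod_cast h1
  · intro a
    refine Finset.mem_image.2 ⟨(j a, fun p k => (H a p.1 p.2).1
      (if k.2 then (u k.1).2 else (u k.1).1)), ?_, ?_⟩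
    · simp only [Finset.mem_product, Finset.mem_univ, true_and, Fintype.mem_piFinset]
      exact fun p => hs₀ _ (H a p.1 p.2).2
    · funext i
      simp [F]

/-- The number of rounds in which the Learner plays `γ = 1`. -/
noncomputable def numOnes (csc : (Fin n → 𝒳 × ℝ × ℝ) → ℋ) (α ν : ℝ) (X : Fin n → 𝒳) (r : Fin n → ℝ)
    (S : Fin T → Fin m₀ → 𝓕) : Fin (T + 1) :=
  ⟨(Finset.univ.filter fun t => 0 < ∑ i, roundWeights csc α ν X r S t i).card,
    Nat.lt_succ_of_le ((Finset.card_filter_le _ _).trans_eq (by simp))⟩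

/-- The data-dependent center `γ̂` takes at most `T + 1` values, so it only multiplies the number of
patterns by `T + 1`. -/
theorem gammaHat_eq (α ν : ℝ) (X : Fin n → 𝒳) (r : Fin n → ℝ) (S : Fin T → Fin m₀ → 𝓕) :
    gammaHat csc α ν X r S = 1 / T * ((numOnes csc α ν X r S : ℕ) : ℝ) := by
  unfold gammaHat gammaResponse numOnes
  rw [Finset.sum_boole]

/-! ### Deviation bounds with the batches fixed, and with the individuals fixed. -/

section Bounds

variable {d : ℕ} {α β ν : ℝ} {P : Measure 𝒳} [IsProbabilityMeasure P]
  {r : (Fin n → 𝒳) → Fin n → ℝ}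

theorem measure_batchMeanErr_generalization_le (hn : 0 < n) (hcsc : IsCSCOracle ℋ csc)
    (hev : Measurable fun z : 𝓕 × 𝒳 => z.1 z.2) (hd : vcDim ℋ = d) (hr : Measurable r) {ε : ℝ}
    (hε : 0 ≤ ε) (hnε : 2 * Real.exp (-2 * n * (ε / 2) ^ 2) ≤ 1 / 2) (S : Fin T → Fin m₀ → 𝓕) :
    (Measure.pi fun _ : Fin n => P) {X | 1 / n * ∑ i, batchMeanErr csc α ν X (r X) S (X i) + ε <
      ∫ x, batchMeanErr csc α ν X (r X) S x ∂P} ≤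
      ENNReal.ofReal (2 * ((T + 1) * (2 * n + 1) ^ (T * m₀ * d) * Real.exp (-n * ε ^ 2 / 8))) := by
  refine uniform_convergence P hn (g := fun X x => batchMeanErr csc α ν X (r X) S x) ?_
    (fun X x => batchMeanErr_mem_Icc α ν X (r X) S x) (fun u => ?_) hε hnε
  · exact measurable_batchMeanErr hcsc hev α ν (Z := (Fin n → 𝒳) × 𝒳) measurable_fst
      (hr.comp measurable_fst) measurable_const measurable_snd
  -- With `S` fixed, the sample enters only through the labels that the responses to the problems in
  -- the batches give to `x`; the error estimate does not involve `γ̂`, hence the constant 0 for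
  -- `j`.
  · exact exists_finset_values hd
      (fun (X : Fin n → 𝒳) t s => roundResponse csc α ν X (r X) S t (S t s)) (fun _ => 0)
      (fun x _ b => 1 / T * ∑ t, (1 / m₀ * ∑ s, if b t s ≠ S t s x then (1 : ℝ) else 0)) u

theorem measure_unfairInd_generalization_le (hn : 0 < n) (hcsc : IsCSCOracle ℋ csc)
    (hev : Measurable fun z : 𝓕 × 𝒳 => z.1 z.2) (hd : vcDim ℋ = d) (hr : Measurable r) {ε : ℝ}
    (hε : 0 ≤ ε) (hnε : 2 * Real.exp (-2 * n * (ε / 2) ^ 2) ≤ 1 / 2) (S : Fin T → Fin m₀ → 𝓕) :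
    (Measure.pi fun _ : Fin n => P) {X | 1 / n * ∑ i, unfairInd csc α ν X (r X) S (X i) + ε <
      ∫ x, unfairInd csc α ν X (r X) S x ∂P} ≤
      ENNReal.ofReal (2 * ((T + 1) * (2 * n + 1) ^ (T * m₀ * d) * Real.exp (-n * ε ^ 2 / 8))) := by
  refine uniform_convergence P hn (g := fun X x => unfairInd csc α ν X (r X) S x) ?_
    (fun X x => unfairInd_mem_Icc α ν X (r X) S x) (fun u => ?_) hε hnε
  · exact measurable_unfairInd hcsc hev α ν (Z := (Fin n → 𝒳) × 𝒳) measurable_fst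
      (hr.comp measurable_fst) measurable_const measurable_snd
  · obtain ⟨s, hs, hmem⟩ := exists_finset_values hd
      (fun (X : Fin n → 𝒳) t s => roundResponse csc α ν X (r X) S t (S t s))
      (fun X => numOnes csc α ν X (r X) S)
      (fun x j b => if 3 * α < |1 / T * ∑ t,
        ((∑ s, if b t s = true ∧ S t s x = false then (1 : ℝ) else 0) /
          ∑ s, if S t s x = false then (1 : ℝ) else 0) - 1 / T * ((j : ℕ) : ℝ)|
        then 1 else 0) u
    refine ⟨s, hs, fun X => ?_⟩
    have := hmem X
    simp only [← gammaHat_eq] at this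
    exact this

/-- On most of the population, the estimates of all rounds are accurate. -/
theorem measure_population_not_accurate_le (hn : 0 < n) (hm₀ : 0 < m₀) (hcsc : IsCSCOracle ℋ csc)
    (hev : Measurable fun z : 𝓕 × 𝒳 => z.1 z.2) (Q : Measure 𝓕) [IsProbabilityMeasure Q] {ε : ℝ}
    (hε : 0 ≤ ε) (X : Fin n → 𝒳) (r : Fin n → ℝ) :
    (Measure.pi fun _ : Fin T => Measure.pi fun _ : Fin m₀ => Q)
      {S | (n : ℝ≥0∞)⁻¹ < P {x | ∃ t, ¬ BatchAccurate Q ε (S t) (roundResponse csc α ν X r S t) x}} ≤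
      ENNReal.ofReal (n * T * (6 * Real.exp (-2 * m₀ * ε ^ 2))) := by
  set M := Measure.pi fun _ : Fin T => Measure.pi fun _ : Fin m₀ => Q
  set D : Set ((Fin T → Fin m₀ → 𝓕) × 𝒳) := {z | ∃ t,
    ¬ BatchAccurate Q ε (z.1 t) (roundResponse csc α ν X r z.1 t) z.2} with hD
  have hDm : MeasurableSet D := by
    simp only [hD, Set.ofPred_exists]
    exact MeasurableSet.iUnion fun t => (measurableSet_roundAccurate hcsc hev Q ε α ν
      (Z := (Fin T → Fin m₀ → 𝓕) × 𝒳) measurable_const measurable_const measurable_fst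
      measurable_snd t).compl
  -- By Fubini the expected mass of badly estimated individuals is bounded by the failure
  -- probability at a single `x`. Markov's inequality with threshold `1 / n` then costs a factor
  -- `n`.
  have h1 : ∫⁻ S, P (Prod.mk S ⁻¹' D) ∂M ≤
      T * ENNReal.ofReal (6 * Real.exp (-2 * m₀ * ε ^ 2)) := by
    rw [← Measure.prod_apply hDm]
    refine prod_measure_le_of_right _ _ hDm fun x => ?_
    have : {S : Fin T → Fin m₀ → 𝓕 | (S, x) ∈ D} = ⋃ t,
        {S | ¬ BatchAccurate Q ε (S t) (roundResponse csc α ν X r S t) x} := by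
      ext S; simp [hD]
    rw [this]
    refine (measure_iUnion_fintype_le _ _).trans ((Finset.sum_le_sum fun t _ =>
      measure_round_not_accurate_le hm₀ hcsc hev Q hε α ν X r t x).trans_eq ?_)
    simp
  have h2 := mul_meas_ge_le_lintegral (μ := M) (measurable_measure_prodMk_left (ν := P) hDm)
    ((n : ℝ≥0∞)⁻¹)
  have h3 : M {S | (n : ℝ≥0∞)⁻¹ < P (Prod.mk S ⁻¹' D)} ≤ n * ((n : ℝ≥0∞)⁻¹ *
      M {S | (n : ℝ≥0∞)⁻¹ ≤ P (Prod.mk S ⁻¹' D)}) := by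
    rw [← mul_assoc, ENNReal.mul_inv_cancel (by exact_mod_cast hn.ne') (by simp), one_mul]
    exact measure_mono (Set.ofPred_subset_ofPred.2 fun S hS => hS.le)
  refine h3.trans ?_
  calc _ ≤ (n : ℝ≥0∞) * (T * ENNReal.ofReal (6 * Real.exp (-2 * m₀ * ε ^ 2))) := by
        exact mul_le_mul_right (h2.trans h1) _
    _ = _ := by
      rw [ENNReal.ofReal_mul (p := n * T) (by positivity), ENNReal.ofReal_mul (p := n) (by positivity),
        ENNReal.ofReal_natCast, ENNReal.ofReal_natCast, mul_assoc (n : ℝ≥0∞)]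

theorem measure_sample_not_accurate_le (hm₀ : 0 < m₀) (hcsc : IsCSCOracle ℋ csc)
    (hev : Measurable fun z : 𝓕 × 𝒳 => z.1 z.2) (Q : Measure 𝓕) [IsProbabilityMeasure Q] {ε : ℝ}
    (hε : 0 ≤ ε) (X : Fin n → 𝒳) (r : Fin n → ℝ) :
    (Measure.pi fun _ : Fin T => Measure.pi fun _ : Fin m₀ => Q)
      {S | ∃ i t, ¬ BatchAccurate Q ε (S t) (roundResponse csc α ν X r S t) (X i)} ≤
      ENNReal.ofReal (n * T * (6 * Real.exp (-2 * m₀ * ε ^ 2))) := by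
  have : {S : Fin T → Fin m₀ → 𝓕 |
      ∃ i t, ¬ BatchAccurate Q ε (S t) (roundResponse csc α ν X r S t) (X i)} = ⋃ i, ⋃ t,
        {S | ¬ BatchAccurate Q ε (S t) (roundResponse csc α ν X r S t) (X i)} := by
    ext S; simp
  rw [this]
  refine (measure_iUnion_fintype_le _ _).trans ((Finset.sum_le_sum fun i _ =>
    (measure_iUnion_fintype_le _ _).trans (Finset.sum_le_sum fun t _ =>
      measure_round_not_accurate_le hm₀ hcsc hev Q hε α ν X r t (X i))).trans_eq ?_)
  simp only [Finset.sum_const, Finset.card_univ, Fintype.card_fin, nsmul_eq_mul]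
  rw [ENNReal.ofReal_mul (p := n * T) (by positivity), ENNReal.ofReal_mul (p := n) (by positivity),
    ENNReal.ofReal_natCast, ENNReal.ofReal_natCast, mul_assoc (n : ℝ≥0∞)]

end Bounds

end Generalization

/-! ### The sample sizes -/

/-- The case `x = 0` relies on `Real.log 0 = 0`; it is needed before the sample sizes are known to
be positive. -/
theorem one_le_one_add_log_div {x c : ℝ} (hx : x = 0 ∨ 1 ≤ x) (hc : 0 < c) (hc1 : c ≤ 1) :
    1 ≤ 1 + Real.log (x / c) := by
  rcases hx with rfl | hx
  · simp
  · have : 0 ≤ Real.log (x / c) := Real.log_nonneg ((one_le_div hc).2 (hc1.trans hx))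
    linarith

theorem log_two_mul_add_one_le {n : ℕ} (hn : 2 ≤ n) :
    Real.log (2 * n + 1) ≤ 3 * Real.log n := by
  have h : (2 : ℝ) ≤ n := by exact_mod_cast hn
  rw [← Real.log_rpow (by linarith)]
  refine Real.log_le_log (by positivity) ?_
  norm_cast
  nlinarith [sq_nonneg (n - 2 : ℤ), Nat.mul_le_mul hn hn, Nat.mul_le_mul hn (Nat.mul_le_mul hn hn)]

theorem numRounds_le {n : ℕ} (hn : 2 ≤ n) (hlog : 1 ≤ Real.log n) {α ν : ℝ} (hα : 0 < α)
    (hα1 : α ≤ 1) (hν : 0 < ν) (hν1 : ν ≤ 1) :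
    (numRounds n α ν : ℝ) * (α ^ 2 * ν ^ 2) ≤ 4000 * Real.log n := by
  have h2 := log_two_mul_add_one_le hn
  have h0 : 0 ≤ Real.log (2 * n + 1) := Real.log_nonneg (by linarith [(n.cast_nonneg : (0:ℝ) ≤ n)])
  have h1 : (numRounds n α ν : ℝ) ≤
      16 * dualBound α ν ^ 2 * (1 + 2 * α) ^ 2 * Real.log (2 * n + 1) / ν ^ 2 + 1 :=
    (Nat.ceil_lt_add_one (by positivity)).le
  have hp : 0 < α ^ 2 * ν ^ 2 := by positivity
  have hp1 : α ^ 2 * ν ^ 2 ≤ 1 := mul_le_one₀ (pow_le_one₀ hα.le hα1) (by positivity)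
    (pow_le_one₀ hν.le hν1)
  calc _ ≤ (16 * dualBound α ν ^ 2 * (1 + 2 * α) ^ 2 * Real.log (2 * n + 1) / ν ^ 2 + 1) *
        (α ^ 2 * ν ^ 2) := mul_le_mul_of_nonneg_right h1 hp.le
    _ = 16 * (1 + 2 * ν) ^ 2 * (1 + 2 * α) ^ 2 * Real.log (2 * n + 1) + α ^ 2 * ν ^ 2 := by
        unfold dualBound; field_simp
    -- `16 * 81 * 3 = 3888`, and the 1 from rounding up is at most `Real.log n`.
    _ ≤ 16 * 3 ^ 2 * 3 ^ 2 * (3 * Real.log n) + 1 := by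
        gcongr <;> linarith
    _ ≤ _ := by linarith

/-- The consequences of the lower bounds on the sample sizes that the proof uses. -/
structure SampleSizes (n m₀ T d : ℕ) (a ε δ : ℝ) : Prop where
  n_pos : 0 < n
  batch_pos : 0 < m₀
  batch : n * T * (6 * Real.exp (-2 * m₀ * ε ^ 2)) ≤ δ
  estimate : Real.sqrt (Real.log n / (2 * m₀)) ≤ ε
  uniform : 2 * ((T + 1) * (2 * n + 1) ^ (T * m₀ * d) * Real.exp (-n * a ^ 2 / 8)) ≤ δ
  half : 2 * Real.exp (-2 * n * (a / 2) ^ 2) ≤ 1 / 2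
  inv_le : (n : ℝ)⁻¹ ≤ a

/-- The union over individuals and rounds is affordable because `T` is polynomial: `6 * N * T / δ`
is at most 24000 times the square of `N / (α * ν * δ)`, and `Real.log 24000 ≤ 11`. -/
theorem log_rounds_le {N T α ν δ : ℝ} (hN : 1 ≤ N) (hT : 1 ≤ T) (hα : 0 < α) (hν : 0 < ν)
    (hδ : 0 < δ) (hδ1 : δ ≤ 1) (hανδ : α * ν * δ ≤ N) (hTN : T * (α ^ 2 * ν ^ 2) ≤ 4000 * N) :
    Real.log (6 * N * T / δ) ≤ 11 * (1 + Real.log (N / (α * ν * δ))) := by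
  have h0 : 0 ≤ Real.log (N / (α * ν * δ)) :=
    Real.log_nonneg ((one_le_div (by positivity)).2 hανδ)
  have h1 : 6 * N * T / δ ≤ 24000 * (N / (α * ν * δ)) ^ 2 := by
    rw [div_pow, mul_div_assoc', div_le_div_iff₀ hδ (by positivity)]
    calc 6 * N * T * (α * ν * δ) ^ 2 = 6 * N * (T * (α ^ 2 * ν ^ 2)) * δ * δ := by ring
      _ ≤ 6 * N * (4000 * N) * δ * 1 := by gcongr
      _ = _ := by ring
  have h5 : Real.log 24000 ≤ 11 := by
    rw [Real.log_le_iff_le_exp (by norm_num)]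
    have h6 : Real.exp 11 = Real.exp 1 ^ 11 := by rw [← Real.exp_nat_mul]; norm_num
    rw [h6]
    calc (24000 : ℝ) ≤ 2.7 ^ 11 := by norm_num
      _ ≤ _ := by gcongr; linarith [Real.exp_one_gt_d9]
  calc _ ≤ Real.log (24000 * (N / (α * ν * δ)) ^ 2) := Real.log_le_log (by positivity) h1
    _ = Real.log 24000 + 2 * Real.log (N / (α * ν * δ)) := by
        rw [Real.log_mul (by norm_num) (by positivity), Real.log_pow]; norm_num
    _ ≤ _ := by linarith

/-- Dividing the bound on `m = T * m₀` by `T`, which is of order `l / (α ^ 2 * ν ^ 2)`, leaves `m₀`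
of order `L / (ρ ^ 2 * α ^ 2 * ν ^ 2)`. This suits Hoeffding at accuracy `ν * α * ρ / 20`. -/
theorem batch_size_bound {T M₀ l l' L α ν ρ : ℝ} (hT : 1 ≤ T) (hl : 0 ≤ l) (hl' : 1 ≤ l')
    (hL : 0 ≤ L) (hα : 0 < α) (hν : 0 < ν) (hρ : 0 < ρ)
    (hTl : T * (α ^ 2 * ν ^ 2) ≤ 4000 * l)
    (hm : 10 ^ 8 * (l * l' / (ρ ^ 2 * ν ^ 4 * α ^ 4)) * L ≤ T * M₀) :
    11 * L ≤ 2 * M₀ * (ν * α * ρ / 20) ^ 2 := by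
  have h1 : 10 ^ 8 * l * l' * L ≤ T * M₀ * (ρ ^ 2 * ν ^ 4 * α ^ 4) := by
    have : 10 ^ 8 * (l * l' / (ρ ^ 2 * ν ^ 4 * α ^ 4)) * L =
      10 ^ 8 * l * l' * L / (ρ ^ 2 * ν ^ 4 * α ^ 4) := by ring
    rwa [this, div_le_iff₀ (by positivity)] at hm
  have h2 : 10 ^ 8 * l * L ≤ 10 ^ 8 * l * l' * L := by
    have := mul_le_mul_of_nonneg_left hl' (show 0 ≤ 10 ^ 8 * l * L by positivity)
    linarith
  have h3 : T * (α ^ 2 * ν ^ 2) * (10 ^ 8 * L) ≤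
      4000 * (T * (α ^ 2 * ν ^ 2)) * (M₀ * (ρ ^ 2 * (α ^ 2 * ν ^ 2))) := by
    calc _ ≤ 4000 * l * (10 ^ 8 * L) := by gcongr
      _ = 4000 * (10 ^ 8 * l * L) := by ring
      _ ≤ 4000 * (T * M₀ * (ρ ^ 2 * ν ^ 4 * α ^ 4)) := by linarith
      _ = _ := by ring
  have h4 : 10 ^ 8 * L ≤ 4000 * (M₀ * (ρ ^ 2 * (α ^ 2 * ν ^ 2))) := by
    refine le_of_mul_le_mul_left ?_ (show 0 < T * (α ^ 2 * ν ^ 2) by positivity)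
    linarith
  have h5 : 2 * M₀ * (ν * α * ρ / 20) ^ 2 = M₀ * (ρ ^ 2 * (α ^ 2 * ν ^ 2)) / 200 := by ring
  rw [h5]
  linarith

theorem sampleSizes {n m m₀ d : ℕ} {α β ν δ ρ : ℝ} (hα : 0 < α) (hα1 : α ≤ 1) (hβ : 0 < β)
    (hν : 0 < ν) (hν1 : ν ≤ 1) (hδ : 0 < δ) (hδ1 : δ ≤ 1 / 12) (hαβ : α * β < 1) (hρ : 0 < ρ)
    (hm : m = numRounds n α ν * m₀)
    (hn : 10 ^ 8 * ((m * d + Real.log (1 / (ν ^ 2 * δ))) / (α ^ 2 * β ^ 2)) *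
        (1 + Real.log (n * m / (α * ν * δ))) ^ 1 ≤ n)
    (hmn : 10 ^ 8 * (Real.log n * Real.log (n / δ) / (ρ ^ 2 * ν ^ 4 * α ^ 4)) *
        (1 + Real.log (n / (α * ν * δ))) ^ 1 ≤ m) :
    SampleSizes n m₀ (numRounds n α ν) d (α * β) (ν * α * ρ / 20) δ := by
  rw [pow_one] at hn hmn
  rw [← mul_pow] at hn
  set a := α * β with ha
  have ha0 : 0 < a := by positivity
  set T := numRounds n α ν with hT
  set L₁ := 1 + Real.log (n * m / (α * ν * δ)) with hL₁
  set L₂ := 1 + Real.log (n / (α * ν * δ)) with hL₂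
  set D := m * d + Real.log (1 / (ν ^ 2 * δ)) with hD
  have hανδ : 0 < α * ν * δ := by positivity
  have hαν1 : α * ν ≤ 1 := mul_le_one₀ hα1 hν.le hν1
  have hανδ1 : α * ν * δ ≤ 1 := mul_le_one₀ hαν1 hδ.le (by linarith)
  -- The bound `δ ≤ 1 / 12` keeps the logarithm above 2, so that `n * a ^ 2` is large even if `m *
  -- d` vanishes.
  have hlog12 : (2 : ℝ) ≤ Real.log (1 / (ν ^ 2 * δ)) := by
    rw [Real.le_log_iff_exp_le (by positivity), le_div_iff₀ (by positivity)]
    have h1 : Real.exp 2 ≤ 12 := by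
      have h2 : Real.exp 2 = Real.exp 1 ^ 2 := by rw [← Real.exp_nat_mul]; norm_num
      rw [h2]
      nlinarith [Real.exp_one_lt_d9, Real.exp_pos 1]
    have h3 : ν ^ 2 * δ ≤ 1 / 12 := by
      have : ν ^ 2 ≤ 1 := pow_le_one₀ hν.le hν1
      have := mul_le_mul this hδ1 hδ.le zero_le_one
      linarith
    calc _ ≤ 12 * (1 / 12 : ℝ) := mul_le_mul h1 h3 (by positivity) (by norm_num)
      _ = 1 := by norm_num
  have hmd : (0 : ℝ) ≤ m * d := by positivity
  have hL₁1 : 1 ≤ L₁ := by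
    refine one_le_one_add_log_div ?_ hανδ hανδ1
    rcases Nat.eq_zero_or_pos (n * m) with h | h
    · left; exact_mod_cast h
    · right; exact_mod_cast h
  have hna : 10 ^ 8 * D * L₁ ≤ n * a ^ 2 := by
    have : 10 ^ 8 * (D / a ^ 2) * L₁ = 10 ^ 8 * D * L₁ / a ^ 2 := by ring
    rwa [this, div_le_iff₀ (by positivity)] at hn
  have hD2 : m * d + 2 ≤ D := by linarith
  have hna2 : 2 * 10 ^ 8 ≤ n * a ^ 2 := by
    refine le_trans ?_ hna
    calc (2 * 10 ^ 8 : ℝ) = 10 ^ 8 * 2 * 1 := by norm_num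
      _ ≤ _ := by gcongr; linarith
  have ha2 : a ^ 2 ≤ 1 := pow_le_one₀ ha0.le hαβ.le
  have hnbig : (2 * 10 ^ 8 : ℝ) ≤ n := by
    have : (n : ℝ) * a ^ 2 ≤ n := mul_le_of_le_one_right (by positivity) ha2
    linarith
  have hn2 : 2 ≤ n := by
    have : (2 : ℝ) ≤ n := by linarith
    exact_mod_cast this
  have hn0 : (0 : ℝ) < n := by linarith
  have hlogn : 1 ≤ Real.log n := by
    rw [Real.le_log_iff_exp_le hn0]; linarith [Real.exp_one_lt_d9]
  have hlognδ : 1 ≤ Real.log (n / δ) := hlogn.trans (Real.log_le_log hn0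
    (by rw [le_div_iff₀ hδ]; exact mul_le_of_le_one_right hn0.le (by linarith)))
  have hL₂n : Real.log n + 1 ≤ L₂ := by
    have : Real.log n ≤ Real.log (n / (α * ν * δ)) := Real.log_le_log hn0
      (by rw [le_div_iff₀ hανδ]; exact mul_le_of_le_one_right hn0.le hανδ1)
    linarith
  have hm1 : 1 ≤ m := by
    rw [Nat.one_le_iff_ne_zero]
    rintro h0
    rw [h0] at hmn
    have : 0 < 10 ^ 8 * (Real.log n * Real.log (n / δ) / (ρ ^ 2 * ν ^ 4 * α ^ 4)) * L₂ := by
      have : 0 < L₂ := by linarith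
      have : 0 < Real.log n := by linarith
      have : 0 < Real.log (n / δ) := by linarith
      positivity
    push_cast at hmn
    linarith
  have hm1' : (1 : ℝ) ≤ m := by exact_mod_cast hm1
  have hm₀ : 0 < m₀ := Nat.pos_of_ne_zero (by rintro rfl; simp at hm; omega)
  have hTpos : 0 < T := Nat.pos_of_ne_zero (by rintro h; rw [h] at hm; simp at hm; omega)
  have hT1 : (1 : ℝ) ≤ T := by exact_mod_cast hTpos
  have hmT : (m : ℝ) = T * m₀ := by rw [hm]; push_cast; ring
  have hL₁₂ : L₂ ≤ L₁ := by
    have : Real.log (n / (α * ν * δ)) ≤ Real.log (n * m / (α * ν * δ)) := by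
      refine Real.log_le_log (by positivity) ?_
      gcongr
      exact le_mul_of_one_le_right hn0.le hm1'
    linarith
  have hTle : (T : ℝ) * (α ^ 2 * ν ^ 2) ≤ 4000 * Real.log n :=
    numRounds_le hn2 hlogn hα hα1 hν hν1
  have hαν0 : 0 < α ^ 2 * ν ^ 2 := by positivity
  have hlogT : Real.log (6 * n * T / δ) ≤ 11 * L₂ :=
    log_rounds_le (by linarith) hT1 hα hν hδ (by linarith) (by linarith)
      (hTle.trans (by linarith [Real.log_le_self hn0.le]))
  have hbatch : 11 * L₂ ≤ 2 * m₀ * (ν * α * ρ / 20) ^ 2 := by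
    refine batch_size_bound hT1 (by linarith) hlognδ (by linarith) hα hν hρ hTle ?_
    rwa [← hmT]
  refine ⟨by omega, hm₀, ?_, ?_, ?_, ?_, ?_⟩
  · have h1 : 6 * n * T / δ ≤ Real.exp (2 * m₀ * (ν * α * ρ / 20) ^ 2) := by
      rw [← Real.log_le_iff_le_exp (by positivity)]; linarith
    rw [div_le_iff₀ hδ] at h1
    have h2 : Real.exp (-2 * m₀ * (ν * α * ρ / 20) ^ 2) =
        (Real.exp (2 * m₀ * (ν * α * ρ / 20) ^ 2))⁻¹ := by rw [← Real.exp_neg]; congr 1; ring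
    have h3 : n * T * (6 * (Real.exp (2 * m₀ * (ν * α * ρ / 20) ^ 2))⁻¹) =
        6 * n * T / Real.exp (2 * m₀ * (ν * α * ρ / 20) ^ 2) := by ring
    rw [h2, h3, div_le_iff₀ (Real.exp_pos _)]
    linarith
  · rw [Real.sqrt_le_left (by positivity), div_le_iff₀ (by positivity)]
    linarith
  · have hpow : ((2 * n + 1 : ℝ)) ^ (T * m₀ * d) = Real.exp (m * d * Real.log (2 * n + 1)) := by
      rw [hmT]
      have : (T : ℝ) * m₀ * d * Real.log (2 * n + 1) =
          ((T * m₀ * d : ℕ) : ℝ) * Real.log (2 * n + 1) := by push_cast; ring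
      rw [this, Real.exp_nat_mul, Real.exp_log (by positivity)]
    -- The factor `T + 1` and the confidence `δ` are both paid for by `exp (11 * L₂)`, using `2 * (T
    -- + 1) ≤ 6 * n * T`.
    have hT1' : 2 * ((T : ℝ) + 1) ≤ δ * Real.exp (11 * L₂) := by
      have h1 : 6 * n * T / δ ≤ Real.exp (11 * L₂) := by
        rwa [← Real.log_le_iff_le_exp (by positivity)]
      rw [div_le_iff₀ hδ] at h1
      have h2 : 1 * (T : ℝ) ≤ n * T := by gcongr; linarith
      linarith
    -- The costs `11 * L₂` and `3 * m * d * L₁` are both dominated by `n * a ^ 2 / 8`, which is at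
    -- least `10 ^ 8 / 8 * (m * d + 2) * L₁`.
    have hexp : 11 * L₂ + m * d * Real.log (2 * n + 1) + -n * a ^ 2 / 8 ≤ 0 := by
      have h1 := log_two_mul_add_one_le hn2
      have h2 : (m : ℝ) * d * Real.log (2 * n + 1) ≤ m * d * (3 * L₁) :=
        mul_le_mul_of_nonneg_left (by linarith) hmd
      have h3 : (m * d + 2) * L₁ ≤ D * L₁ := by gcongr
      have h4 : 0 ≤ (m * d : ℝ) * L₁ := by positivity
      linarith
    calc _ = 2 * ((T : ℝ) + 1) * Real.exp (m * d * Real.log (2 * n + 1)) *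
          Real.exp (-n * a ^ 2 / 8) := by rw [hpow]; ring
      _ ≤ δ * Real.exp (11 * L₂) * Real.exp (m * d * Real.log (2 * n + 1)) *
          Real.exp (-n * a ^ 2 / 8) := by gcongr
      _ = δ * Real.exp (11 * L₂ + m * d * Real.log (2 * n + 1) + -n * a ^ 2 / 8) := by
          rw [Real.exp_add, Real.exp_add]; ring
      _ ≤ δ * 1 := by gcongr; exact Real.exp_le_one_iff.2 hexp
      _ = δ := mul_one δ
  · have h1 := Real.add_one_le_exp (2 * n * (a / 2) ^ 2)
    have h2 : Real.exp (-2 * n * (a / 2) ^ 2) = (Real.exp (2 * n * (a / 2) ^ 2))⁻¹ := by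
      rw [← Real.exp_neg]; congr 1; ring
    have h3 : (4 : ℝ) ≤ Real.exp (2 * n * (a / 2) ^ 2) := by linarith
    rw [h2]
    have := inv_anti₀ (by norm_num) h3
    linarith
  · rw [inv_le_iff_one_le_mul₀ hn0]
    have : a ^ 2 ≤ a := by rw [sq]; exact mul_le_of_le_one_right ha0.le hαβ.le
    have := mul_le_mul_of_nonneg_left this hn0.le
    linarith

/-! ### The guarantee on the good event -/

section Conclusion

variable {𝒳 𝓕 : Type*} [MeasurableSpace 𝒳] [MeasurableSpace 𝓕] [FunLike 𝓕 𝒳 Bool]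
  {ℋ : Set (𝒳 → Bool)} {n T m₀ : ℕ} {csc : (Fin n → 𝒳 × ℝ × ℝ) → ℋ}

theorem abs_mean_sub_mean_le {a b : Fin n → ℝ} {c : ℝ} (hc : 0 ≤ c) (h : ∀ i, |a i - b i| ≤ c) :
    |1 / (n : ℝ) * ∑ i, a i - 1 / n * ∑ i, b i| ≤ c := by
  rw [← mul_sub, ← Finset.sum_sub_distrib, abs_mul, abs_of_nonneg (by positivity : 0 ≤ 1 / (n : ℝ))]
  refine (mul_le_mul_of_nonneg_left (Finset.abs_sum_le_sum_abs _ _) (by positivity)).trans ?_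
  rcases Nat.eq_zero_or_pos n with rfl | hn
  · simpa using hc
  · have hn' : (0 : ℝ) < n := by exact_mod_cast hn
    have : ∑ i, |a i - b i| ≤ n * c := by
      refine (Finset.sum_le_sum fun i _ => h i).trans_eq ?_
      simp
    rw [one_div_mul_eq_div, div_le_iff₀ hn']
    linarith

/-- An error of at most `ρ₀ / 2` keeps `r` above `ρ₀ / 2`, which bounds the relative error. -/
theorem abs_rho_div_sub_one_le {ρ r ρ₀ ε : ℝ} (hρ₀ : 0 < ρ₀) (hρ : ρ₀ ≤ ρ) (hε : 0 ≤ ε)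
    (hερ : ε ≤ ρ₀ / 2) (hr : |r - ρ| ≤ ε) : |ρ / r - 1| ≤ 2 * ε / ρ₀ := by
  have h1 := (abs_le.1 hr).1
  have hr0 : ρ₀ / 2 ≤ r := by linarith
  have hrpos : 0 < r := by linarith
  have h2 : ρ / r - 1 = -(r - ρ) / r := by field_simp; ring
  rw [h2, abs_div, abs_neg, abs_of_pos hrpos, div_le_div_iff₀ hrpos hρ₀]
  nlinarith [mul_le_mul hr hr0 (by linarith) hε]

/-- The deterministic part. The error chain costs `α * β` for the inaccurate individuals, for
generalization and for the comparator, and `3 / 2 * ν + 2 * ε ≤ 2 * ν` for the game and the two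
passages between estimates and true errors. -/
theorem good_event_conclusion (hcsc : IsCSCOracle ℋ csc)
    (hev : Measurable fun z : 𝓕 × 𝒳 => z.1 z.2) (P : Measure 𝒳) [IsProbabilityMeasure P]
    (Q : Measure 𝓕) [IsProbabilityMeasure Q] {α β ν ε : ℝ} (hα : 0 < α) (hα1 : α ≤ 1)
    (hβ : 0 < β) (hν : 0 < ν) (hν1 : ν ≤ 1) (hρ₀ : 0 < rhoInf 𝒳 Q)
    (hε : ε = ν * α * rhoInf 𝒳 Q / 20) (hm₀ : 0 < m₀) (hTn : T = numRounds n α ν) (hT : 0 < T)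
    (hnαβ : (n : ℝ)⁻¹ ≤ α * β) (hn : 0 < n)
    {X : Fin n → 𝒳} {r : Fin n → ℝ} {S : Fin T → Fin m₀ → 𝓕}
    (hacc : ∀ i t, BatchAccurate Q ε (S t) (roundResponse csc α ν X r S t) (X i))
    (hpop : P {x | ∃ t, ¬ BatchAccurate Q ε (S t) (roundResponse csc α ν X r S t) x} ≤
      (n : ℝ≥0∞)⁻¹)
    (herr : ∫ x, batchMeanErr csc α ν X r S x ∂P ≤
      1 / n * ∑ i, batchMeanErr csc α ν X r S (X i) + α * β)
    (hunf : ∫ x, unfairInd csc α ν X r S x ∂P ≤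
      1 / n * ∑ i, unfairInd csc α ν X r S (X i) + α * β)
    {ψ : 𝓕 → Measure ℋ} {γ : ℝ} (hψ : IsMapping ψ) (hγ : γ ∈ Set.Icc (0 : ℝ) 1)
    (hfair : ∀ x, |fpRate Q ψ x - γ| ≤ α)
    (hψerr : 1 / n * ∑ i, indErr Q ψ (X i) ≤ err P Q ψ + α * β)
    (hest : ∀ i, |r i - rho Q (X i)| ≤ ε) :
    IsFPAIFAt P Q (psiHat csc α ν X r S) (6 * α) (2 * β) (gammaHat csc α ν X r S) ∧
      err P Q (psiHat csc α ν X r S) ≤ err P Q ψ + 2 * ν + 3 * (α * β) := by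
  set ρ₀ := rhoInf 𝒳 Q with hρ₀def
  have hne : Nonempty 𝒳 := nonempty_of_isProbabilityMeasure P
  have hρx : ∀ x : 𝒳, ρ₀ ≤ rho Q x := rhoInf_le_rho Q
  have hρ1 : ρ₀ ≤ 1 := (hρx hne.some).trans (rho_le_one Q _)
  have hε0 : 0 ≤ ε := by rw [hε]; positivity
  have hνα : ν * α ≤ 1 := mul_le_one₀ hν1 hα.le hα1
  -- The 20 in `ε` makes both `κ` and `κ'` equal to `ν * α / 10`; then `B * (κ + 2 * κ') = (1 + 2 *
  -- ν) * ν * (3 / 10) ≤ ν`.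
  have hκ : 2 * ε / ρ₀ = ν * α / 10 := by rw [hε]; field_simp; norm_num
  have hεν : ε ≤ ν / 20 := by
    rw [hε]
    have : ν * α * ρ₀ ≤ ν * 1 * 1 := by gcongr
    linarith
  have hερ : ε ≤ ρ₀ / 2 := by
    rw [hε]
    have : ν * α * ρ₀ ≤ 1 * ρ₀ := by gcongr
    linarith
  have hsample := sample_guarantee hcsc hev Q (fun x => hρ₀.trans_le (hρx x)) hα hα1 hν hν1
    (κ := ν * α / 10) (κ' := ν * α / 10) (by positivity) (by positivity) (by
      have : dualBound α ν * (ν * α / 10 + 2 * (ν * α / 10)) = (1 + 2 * ν) * ν * (3 / 10) := by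
        unfold dualBound; field_simp; ring
      rw [this]
      nlinarith) hTn hT X r S
    (fun t i => hκ ▸ (hacc i t).batchFPRate_close hm₀ hev hρ₀ (hρx _))
    (fun i => hκ ▸ abs_rho_div_sub_one_le hρ₀ (hρx _) hε0 hερ (hest i)) hψ hγ (fun i => hfair (X i))
  obtain ⟨hserr, hsfair⟩ := hsample
  set bad := {x | ∃ t, ¬ BatchAccurate Q ε (S t) (roundResponse csc α ν X r S t) x} with hbad
  have hbadm : MeasurableSet bad := by
    simp only [hbad, Set.ofPred_exists]
    exact MeasurableSet.iUnion fun t => (measurableSet_roundAccurate hcsc hev Q ε α ν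
      measurable_const measurable_const measurable_const measurable_id t).compl
  have hbadle : P.real bad ≤ α * β := by
    refine le_trans ?_ hnαβ
    have h1 := ENNReal.toReal_mono (by simp [hn.ne']) hpop
    rwa [ENNReal.toReal_inv, ENNReal.toReal_natCast] at h1
  have hαβ : α * β ≤ β := mul_le_of_le_one_left hβ.le hα1
  have hψm := isMapping_psiHat hT hcsc hev α ν X r S
  constructor
  · refine ⟨(gammaHat_mem_Icc α ν X r S).1, ?_⟩
    have hUm : MeasurableSet {x | 3 * α < |batchMeanFP csc α ν X r S x - gammaHat csc α ν X r S|} :=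
      measurableSet_lt measurable_const ((measurable_batchMeanFP hcsc hev α ν measurable_const
        measurable_const measurable_const measurable_id).sub_const _).abs
    have hU : P.real {x | 3 * α < |batchMeanFP csc α ν X r S x - gammaHat csc α ν X r S|} ≤
        α * β := by
      -- No sampled individual is unfair, so the empirical mean vanishes and only the generalization
      -- gap remains.
      have h1 : ∀ i, unfairInd csc α ν X r S (X i) = 0 := fun i =>
        if_neg (not_lt.2 (hsfair i))
      simp only [h1, Finset.sum_const_zero, mul_zero, zero_add] at hunf
      rw [← integral_indicator_one hUm]
      refine le_trans (le_of_eq ?_) hunf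
      refine integral_congr_ae (ae_of_all _ fun x => ?_)
      simp [unfairInd, Set.indicator_apply]
    -- Outside `bad` the estimate is within `ν * α / 10` of the truth, well inside the gap between
    -- `3 * α` and `6 * α`.
    have hsub : {x | 6 * α < |fpRate Q (psiHat csc α ν X r S) x - gammaHat csc α ν X r S|} ⊆
        bad ∪ {x | 3 * α < |batchMeanFP csc α ν X r S x - gammaHat csc α ν X r S|} := by
      intro x hx
      by_cases hxb : x ∈ bad
      · exact Or.inl hxb
      right
      simp only [hbad, Set.mem_ofPred_eq, not_exists, not_not] at hxb hx ⊢
      have h1 : |batchMeanFP csc α ν X r S x - fpRate Q (psiHat csc α ν X r S) x| ≤ ν * α / 10 := by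
        rw [fpRate_psiHat hcsc hev]
        exact abs_mean_sub_mean_le (by positivity) fun t =>
          hκ ▸ (hxb t).batchFPRate_close hm₀ hev hρ₀ (hρx _)
      have h2 : ν * α ≤ α := mul_le_of_le_one_left hα.le hν1
      have h3 := abs_sub_le (fpRate Q (psiHat csc α ν X r S) x) (batchMeanFP csc α ν X r S x)
        (gammaHat csc α ν X r S)
      rw [abs_sub_comm (fpRate Q (psiHat csc α ν X r S) x) (batchMeanFP csc α ν X r S x)] at h3
      linarith
    refine (measureReal_mono hsub).trans ((measureReal_union_le _ _).trans ?_)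
    linarith
  · have hclose : ∀ x, x ∉ bad →
        |batchMeanErr csc α ν X r S x - indErr Q (psiHat csc α ν X r S) x| ≤ ε := by
      intro x hxb
      simp only [hbad, Set.mem_ofPred_eq, not_exists, not_not] at hxb
      rw [indErr_psiHat hcsc hev]
      refine abs_mean_sub_mean_le hε0 fun t => ?_
      rw [← integral_errInd]
      exact (hxb t).error
    have hqint : Integrable (batchMeanErr csc α ν X r S) P :=
      Integrable.of_mem_Icc 0 1 (measurable_batchMeanErr hcsc hev α ν measurable_const
        measurable_const measurable_const measurable_id).aemeasurable
        (ae_of_all _ fun x => batchMeanErr_mem_Icc α ν X r S x)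
    have hbint : Integrable (bad.indicator (1 : 𝒳 → ℝ)) P :=
      (integrable_const (1 : ℝ)).indicator hbadm
    have h1 : err P Q (psiHat csc α ν X r S) ≤
        ∫ x, batchMeanErr csc α ν X r S x ∂P + ε + P.real bad := by
      -- On `bad` nothing is known, and the trivial bound 1 on the individual error is charged to
      -- its mass.
      have hle : err P Q (psiHat csc α ν X r S) ≤
          ∫ x, ((batchMeanErr csc α ν X r S x + ε) + bad.indicator (1 : 𝒳 → ℝ) x) ∂P := by
        refine integral_mono_of_nonneg (ae_of_all _ fun x => (indErr_mem_Icc Q hψm.prob x).1)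
          ((hqint.add (integrable_const ε)).add hbint) (ae_of_all _ fun x => ?_)
        by_cases hx : x ∈ bad
        · have h2 := (indErr_mem_Icc Q hψm.prob x).2
          have h3 := (batchMeanErr_mem_Icc (csc := csc) α ν X r S x).1
          simp only [Set.indicator_of_mem hx, Pi.one_apply]
          linarith
        · have h2 := (abs_le.1 (hclose x hx)).1
          simp only [Set.indicator_of_notMem hx]
          linarith
      refine hle.trans_eq ?_
      have hadd : Integrable (fun x => batchMeanErr csc α ν X r S x + ε) P :=
        hqint.add (integrable_const ε)
      rw [integral_add hadd hbint,
        integral_add hqint (integrable_const ε), integral_indicator_one hbadm]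
      simp
    have h2 : 1 / (n : ℝ) * ∑ i, batchMeanErr csc α ν X r S (X i) ≤
        1 / n * ∑ i, indErr Q (psiHat csc α ν X r S) (X i) + ε := by
      have h3 : ∀ i, X i ∉ bad := fun i => by
        simp only [hbad, Set.mem_ofPred_eq, not_exists, not_not]
        exact hacc i
      have := (abs_le.1 (abs_mean_sub_mean_le hε0 fun i => hclose (X i) (h3 i))).2
      linarith
    simp only [indErr_psiHat hcsc hev] at h2
    linarith

end Conclusion

/-! ### The main theorem -/

section Main

variable {𝒳 𝓕 : Type*} [MeasurableSpace 𝒳] [MeasurableSpace 𝓕] [FunLike 𝓕 𝒳 Bool]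
  {ℋ : Set (𝒳 → Bool)}

theorem OPT_nonneg (P : Measure 𝒳) [IsProbabilityMeasure P] (Q : Measure 𝓕)
    [IsProbabilityMeasure Q] (α : ℝ) : 0 ≤ OPT ℋ P Q α := by
  refine Real.sInf_nonneg ?_
  rintro e ⟨ψ, γ, hψ, -, -, -, rfl⟩
  exact (err_mem_Icc P Q hψ.prob).1

/-- There are feasible mappings of almost optimal error. -/
theorem exists_near_optimal (P : Measure 𝒳) (Q : Measure 𝓕) {α ν : ℝ} (hα : 0 ≤ α) (hν : 0 < ν)
    (hfalse : (fun _ => false) ∈ ℋ) :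
    ∃ (ψ : 𝓕 → Measure ℋ) (γ : ℝ), IsMapping ψ ∧ γ ∈ Set.Icc (0 : ℝ) 1 ∧
      (∀ x, |fpRate Q ψ x - γ| ≤ α) ∧ err P Q ψ < OPT ℋ P Q α + ν := by
  have hne : {e : ℝ | ∃ (ψ : 𝓕 → Measure ℋ) (γ : ℝ), IsMapping ψ ∧ 0 ≤ γ ∧ γ ≤ 1 ∧
      (∀ x, |fpRate Q ψ x - γ| ≤ α) ∧ e = err P Q ψ}.Nonempty := by
    -- The constant classifier 0 has no false positives, hence is feasible with `γ = 0`.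
    refine ⟨_, pureMap fun _ : 𝓕 => (⟨fun _ => false, hfalse⟩ : ℋ), 0,
      isMapping_pureMap measurable_const, le_rfl, zero_le_one, fun x => ?_, rfl⟩
    have : fpRate Q (pureMap fun _ : 𝓕 => (⟨fun _ => false, hfalse⟩ : ℋ)) x = 0 := by
      unfold fpRate
      simp only [real_falsePositive, pureMap_real]
      simp [bit]
    rw [this]; simpa using hα
  obtain ⟨_, ⟨ψ, γ, hψ, h0, h1, hfair, rfl⟩, hlt⟩ :=
    exists_lt_of_csInf_lt hne (lt_add_of_pos_right (OPT ℋ P Q α) hν)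
  exact ⟨ψ, γ, hψ, ⟨h0, h1⟩, hfair, hlt⟩

end Main

/-! ### Probabilities of the failure events under the joint law. -/

section FailureEvents

variable {𝒳 𝓕 Ω : Type*} [MeasurableSpace 𝒳] [MeasurableSpace 𝓕] [FunLike 𝓕 𝒳 Bool]
  [MeasurableSpace Ω] {ℋ : Set (𝒳 → Bool)}

/-- The joint law of the side randomness, the individuals and the batches. -/
noncomputable def batchLaw (μ : Measure Ω) (P : Measure 𝒳) (Q : Measure 𝓕) (n T m₀ : ℕ) :
    Measure (Ω × (Fin n → 𝒳) × (Fin T → Fin m₀ → 𝓕)) :=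
  μ.prod ((Measure.pi fun _ : Fin n => P).prod
    (Measure.pi fun _ : Fin T => Measure.pi fun _ : Fin m₀ => Q))

variable {μ : Measure Ω} [IsProbabilityMeasure μ] {P : Measure 𝒳} [IsProbabilityMeasure P]
  {Q : Measure 𝓕} [IsProbabilityMeasure Q] {n T m₀ m : ℕ}

/-- This and `batchLaw_le_of_individuals` condition in opposite orders. Both are available because
the estimates are functions of `(ω, X)` and the batches are independent of that pair. -/
theorem batchLaw_le_of_batches {D : Set (Ω × (Fin n → 𝒳) × (Fin T → Fin m₀ → 𝓕))}
    (hD : MeasurableSet D) {c : ℝ≥0∞} (h : ∀ ω X,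
      (Measure.pi fun _ : Fin T => Measure.pi fun _ : Fin m₀ => Q) {S | (ω, X, S) ∈ D} ≤ c) :
    batchLaw μ P Q n T m₀ D ≤ c :=
  prod_measure_le_of_left _ _ hD fun ω =>
    prod_measure_le_of_left _ _ (measurable_prodMk_left hD) fun X => h ω X

theorem batchLaw_le_of_individuals {D : Set (Ω × (Fin n → 𝒳) × (Fin T → Fin m₀ → 𝓕))}
    (hD : MeasurableSet D) {c : ℝ≥0∞}
    (h : ∀ ω S, (Measure.pi fun _ : Fin n => P) {X | (ω, X, S) ∈ D} ≤ c) :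
    batchLaw μ P Q n T m₀ D ≤ c :=
  prod_measure_le_of_left _ _ hD fun ω =>
    prod_measure_le_of_right _ _ (measurable_prodMk_left hD) fun S => h ω S

theorem measurePreserving_sampleLaw [Nonempty (Split T m₀ m)] :
    MeasurePreserving (fun z : Ω × (Fin n → 𝒳) × (Fin m → 𝓕) × Split T m₀ m =>
      (z.1, z.2.1, batches z.2.2.1 z.2.2.2)) (sampleLaw μ P Q n m T m₀)
      (batchLaw μ P Q n T m₀) := by
  have : IsProbabilityMeasure (uniformOn (Set.univ : Set (Split T m₀ m))) :=
    isProbabilityMeasure_uniformOn Set.finite_univ Set.univ_nonempty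
  exact (MeasurePreserving.id μ).prod ((MeasurePreserving.id _).prod
    (measurePreserving_batches_random Q))

theorem ae_batchLaw_of_ae {p : Ω × (Fin n → 𝒳) → Prop}
    (h : ∀ᵐ z ∂(μ.prod (Measure.pi fun _ : Fin n => P)), p z) :
    ∀ᵐ z ∂(batchLaw μ P Q n T m₀), p (z.1, z.2.1) := by
  have h1 := (measurePreserving_prodAssoc μ (Measure.pi fun _ : Fin n => P)
    (Measure.pi fun _ : Fin T => Measure.pi fun _ : Fin m₀ => Q)).symm
  have h2 := (measurePreserving_fst (μ := μ.prod (Measure.pi fun _ : Fin n => P))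
    (ν := Measure.pi fun _ : Fin T => Measure.pi fun _ : Fin m₀ => Q)).comp h1
  exact h2.quasiMeasurePreserving.ae h

variable {csc : (Fin n → 𝒳 × ℝ × ℝ) → ℋ} {ρt : Ω → (Fin n → 𝒳) → Fin n → ℝ} {α β ν δ ε : ℝ}

theorem measurable_estimates
    (hρt : Measurable fun z : Ω × (Fin n → 𝒳) => ρt z.1 z.2) :
    Measurable fun z : Ω × (Fin n → 𝒳) × (Fin T → Fin m₀ → 𝓕) => ρt z.1 z.2.1 :=
  hρt.comp (measurable_fst.prodMk measurable_snd.fst)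

theorem batchLaw_sample_not_accurate_le
    (hρt : Measurable fun z : Ω × (Fin n → 𝒳) => ρt z.1 z.2)
    (hm₀ : 0 < m₀) (hcsc : IsCSCOracle ℋ csc)
    (hev : Measurable fun z : 𝓕 × 𝒳 => z.1 z.2) (hε : 0 ≤ ε) :
    batchLaw μ P Q n T m₀ {z | ∃ i t, ¬ BatchAccurate Q ε (z.2.2 t)
      (roundResponse csc α ν z.2.1 (ρt z.1 z.2.1) z.2.2 t) (z.2.1 i)} ≤
      ENNReal.ofReal (n * T * (6 * Real.exp (-2 * m₀ * ε ^ 2))) := by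
  refine batchLaw_le_of_batches ?_ fun ω X =>
    measure_sample_not_accurate_le hm₀ hcsc hev Q hε X (ρt ω X)
  simp only [Set.ofPred_exists]
  exact MeasurableSet.iUnion fun i => MeasurableSet.iUnion fun t =>
    (measurableSet_roundAccurate hcsc hev Q ε α ν measurable_snd.fst (measurable_estimates hρt)
      measurable_snd.snd ((measurable_pi_apply i).comp measurable_snd.fst) t).compl

theorem batchLaw_population_not_accurate_le
    (hρt : Measurable fun z : Ω × (Fin n → 𝒳) => ρt z.1 z.2)
    (hn : 0 < n) (hm₀ : 0 < m₀) (hcsc : IsCSCOracle ℋ csc)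
    (hev : Measurable fun z : 𝓕 × 𝒳 => z.1 z.2) (hε : 0 ≤ ε) :
    batchLaw μ P Q n T m₀ {z | (n : ℝ≥0∞)⁻¹ < P {x | ∃ t, ¬ BatchAccurate Q ε (z.2.2 t)
      (roundResponse csc α ν z.2.1 (ρt z.1 z.2.1) z.2.2 t) x}} ≤
      ENNReal.ofReal (n * T * (6 * Real.exp (-2 * m₀ * ε ^ 2))) := by
  refine batchLaw_le_of_batches ?_ fun ω X =>
    measure_population_not_accurate_le hn hm₀ hcsc hev Q hε X (ρt ω X)
  have hD : MeasurableSet {y : (Ω × (Fin n → 𝒳) × (Fin T → Fin m₀ → 𝓕)) × 𝒳 | ∃ t,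
      ¬ BatchAccurate Q ε (y.1.2.2 t)
        (roundResponse csc α ν y.1.2.1 (ρt y.1.1 y.1.2.1) y.1.2.2 t) y.2} := by
    simp only [Set.ofPred_exists]
    exact MeasurableSet.iUnion fun t =>
      (measurableSet_roundAccurate hcsc hev Q ε α ν measurable_fst.snd.fst
        ((measurable_estimates hρt).comp measurable_fst) measurable_fst.snd.snd
        measurable_snd t).compl
  exact measurableSet_lt measurable_const (measurable_measure_prodMk_left (ν := P) hD)

/-- A sample-dependent function whose generalization is controlled for fixed batches generalizes. -/
theorem batchLaw_generalization_le
    (hρt : Measurable fun z : Ω × (Fin n → 𝒳) => ρt z.1 z.2)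
    {g : (Fin n → 𝒳) → (Fin n → ℝ) → (Fin T → Fin m₀ → 𝓕) → 𝒳 → ℝ}
    (hg : Measurable fun y : (Ω × (Fin n → 𝒳) × (Fin T → Fin m₀ → 𝓕)) × 𝒳 =>
      g y.1.2.1 (ρt y.1.1 y.1.2.1) y.1.2.2 y.2) {a : ℝ} {c : ℝ≥0∞}
    (h : ∀ (r : (Fin n → 𝒳) → Fin n → ℝ), Measurable r → ∀ S,
      (Measure.pi fun _ : Fin n => P) {X | 1 / n * ∑ i, g X (r X) S (X i) + a <
        ∫ x, g X (r X) S x ∂P} ≤ c) :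
    batchLaw μ P Q n T m₀ {z | 1 / n * ∑ i, g z.2.1 (ρt z.1 z.2.1) z.2.2 (z.2.1 i) + a <
      ∫ x, g z.2.1 (ρt z.1 z.2.1) z.2.2 x ∂P} ≤ c := by
  refine batchLaw_le_of_individuals ?_ fun ω S =>
    h (ρt ω) (hρt.comp measurable_prodMk_left) S
  have h1 : Measurable fun z : Ω × (Fin n → 𝒳) × (Fin T → Fin m₀ → 𝓕) =>
      ∑ i, g z.2.1 (ρt z.1 z.2.1) z.2.2 (z.2.1 i) := Finset.measurable_sum _ fun i _ =>
    hg.comp (measurable_id.prodMk ((measurable_pi_apply i).comp measurable_snd.fst))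
  have h2 : Measurable fun z : Ω × (Fin n → 𝒳) × (Fin T → Fin m₀ → 𝓕) =>
      ∫ x, g z.2.1 (ρt z.1 z.2.1) z.2.2 x ∂P :=
    (hg.stronglyMeasurable.integral_prod_right' (ν := P)).measurable
  exact measurableSet_lt ((h1.const_mul _).add_const _) h2

/-- The comparator is fixed before sampling, so plain Hoeffding suffices and no uniform convergence
is needed. -/
theorem batchLaw_comparator_le (hn : 0 < n) (hev : Measurable fun z : 𝓕 × 𝒳 => z.1 z.2)
    {ψ : 𝓕 → Measure ℋ} (hψ : IsMapping ψ) {a : ℝ} (ha : 0 ≤ a) :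
    batchLaw μ P Q n T m₀ {z | a < |1 / n * ∑ i, indErr Q ψ (z.2.1 i) - err P Q ψ|} ≤
      ENNReal.ofReal (2 * Real.exp (-2 * n * a ^ 2)) := by
  have hm := hψ.measurable_indErr hev Q
  refine batchLaw_le_of_individuals ?_ fun ω S =>
    hoeffding_mean P hn hm (indErr_mem_Icc Q hψ.prob) ha
  have h1 : Measurable fun z : Ω × (Fin n → 𝒳) × (Fin T → Fin m₀ → 𝓕) =>
      ∑ i, indErr Q ψ (z.2.1 i) := Finset.measurable_sum _ fun i _ =>
    hm.comp ((measurable_pi_apply i).comp measurable_snd.fst)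
  exact measurableSet_lt measurable_const ((h1.const_mul _).sub_const _).abs

/-- The algorithm succeeds outside of an event of probability at most `5 δ`. -/
theorem batchLaw_failure_le {d : ℕ} (hev : Measurable fun z : 𝓕 × 𝒳 => z.1 z.2)
    (hfalse : (fun _ => false) ∈ ℋ) (hd : vcDim ℋ = d) (hcsc : IsCSCOracle ℋ csc)
    (hα : 0 < α) (hα1 : α ≤ 1) (hβ : 0 < β) (hν : 0 < ν) (hν1 : ν ≤ 1)
    (hρ₀ : 0 < rhoInf 𝒳 Q) (hTn : T = numRounds n α ν) (hT : 0 < T)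
    (hρt : Measurable fun z : Ω × (Fin n → 𝒳) => ρt z.1 z.2)
    (hest : ∀ᵐ z ∂(μ.prod (Measure.pi fun _ : Fin n => P)), ∀ i,
      |ρt z.1 z.2 i - rho Q (z.2 i)| ≤ Real.sqrt (Real.log n / (2 * m₀)))
    (hsize : SampleSizes n m₀ T d (α * β) (ν * α * rhoInf 𝒳 Q / 20) δ) :
    batchLaw μ P Q n T m₀ {z | ¬ (
      IsFPAIFAt P Q (psiHat csc α ν z.2.1 (ρt z.1 z.2.1) z.2.2) (6 * α) (2 * β)
        (gammaHat csc α ν z.2.1 (ρt z.1 z.2.1) z.2.2) ∧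
      err P Q (psiHat csc α ν z.2.1 (ρt z.1 z.2.1) z.2.2) ≤
        OPT ℋ P Q α + 3 * ν + 3 * (α * β))} ≤ ENNReal.ofReal (5 * δ) := by
  obtain ⟨hn, hm₀, hbatch, hestimate, huniform, hhalf, hinv⟩ := hsize
  set ε := ν * α * rhoInf 𝒳 Q / 20 with hε
  have hε0 : 0 ≤ ε := by positivity
  have ha : 0 ≤ α * β := by positivity
  obtain ⟨ψ, γ, hψ, hγ, hfair, hopt⟩ := exists_near_optimal P Q hα.le hν hfalse
  have hr := measurable_estimates (T := T) (m₀ := m₀) (𝓕 := 𝓕) hρt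
  have b1 := batchLaw_sample_not_accurate_le (μ := μ) (P := P) (Q := Q) (T := T) (α := α) (ν := ν)
    hρt hm₀ hcsc hev hε0
  have b2 := batchLaw_population_not_accurate_le (μ := μ) (P := P) (Q := Q) (T := T) (α := α)
    (ν := ν) hρt hn hm₀ hcsc hev hε0
  have b3 := batchLaw_generalization_le (μ := μ) (P := P) (Q := Q) (T := T) (m₀ := m₀) hρt
    (g := batchMeanErr csc α ν) (measurable_batchMeanErr hcsc hev α ν measurable_fst.snd.fst
      (hr.comp measurable_fst) measurable_fst.snd.snd measurable_snd) fun r hr S =>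
    measure_batchMeanErr_generalization_le hn hcsc hev hd hr ha hhalf S
  have b4 := batchLaw_generalization_le (μ := μ) (P := P) (Q := Q) (T := T) (m₀ := m₀) hρt
    (g := unfairInd csc α ν) (measurable_unfairInd hcsc hev α ν measurable_fst.snd.fst
      (hr.comp measurable_fst) measurable_fst.snd.snd measurable_snd) fun r hr S =>
    measure_unfairInd_generalization_le hn hcsc hev hd hr ha hhalf S
  have b5 := batchLaw_comparator_le (μ := μ) (P := P) (Q := Q) (T := T) (m₀ := m₀) hn hev hψ ha
  have b6 : batchLaw μ P Q n T m₀ {z | ¬ ∀ i, |ρt z.1 z.2.1 i - rho Q (z.2.1 i)| ≤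
      Real.sqrt (Real.log n / (2 * m₀))} = 0 := ae_batchLaw_of_ae hest
  -- The comparator's bound is dominated by the uniform convergence bound: the number of patterns is
  -- at least 1 and the exponent there is weaker.
  have hδ5 : 2 * Real.exp (-2 * n * (α * β) ^ 2) ≤ δ := by
    refine le_trans ?_ huniform
    have h1 : (1 : ℝ) ≤ (T + 1) * (2 * n + 1) ^ (T * m₀ * d) :=
      one_le_mul_of_one_le_of_one_le (by linarith [(T.cast_nonneg : (0 : ℝ) ≤ T)])
        (one_le_pow₀ (by linarith [(n.cast_nonneg : (0 : ℝ) ≤ n)]))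
    have h2 : Real.exp (-2 * n * (α * β) ^ 2) ≤ Real.exp (-n * (α * β) ^ 2 / 8) := by
      apply Real.exp_le_exp.2
      have : 0 ≤ (n : ℝ) * (α * β) ^ 2 := by positivity
      linarith
    have h3 := mul_le_mul h1 h2 (Real.exp_pos _).le (by positivity)
    linarith
  have c1 := b1.trans (ENNReal.ofReal_le_ofReal hbatch)
  have c2 := b2.trans (ENNReal.ofReal_le_ofReal hbatch)
  have c3 := b3.trans (ENNReal.ofReal_le_ofReal huniform)
  have c4 := b4.trans (ENNReal.ofReal_le_ofReal huniform)
  have c5 := b5.trans (ENNReal.ofReal_le_ofReal hδ5)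
  have hδ0 : 0 ≤ δ := le_trans (by positivity) hδ5
  -- Five events of probability at most `δ`; the final 0 is the null event on which the estimates
  -- fail.
  have hsum : ENNReal.ofReal (5 * δ) = ENNReal.ofReal δ + (ENNReal.ofReal δ + (ENNReal.ofReal δ +
      (ENNReal.ofReal δ + (ENNReal.ofReal δ + 0)))) := by
    rw [ENNReal.ofReal_mul (by norm_num), ENNReal.ofReal_ofNat]
    ring
  rw [hsum]
  refine le_trans (measure_mono ?_) ((measure_union_le _ _).trans (add_le_add c1
    ((measure_union_le _ _).trans (add_le_add c2 ((measure_union_le _ _).trans (add_le_add c3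
      ((measure_union_le _ _).trans (add_le_add c4 ((measure_union_le _ _).trans
        (add_le_add c5 b6.le))))))))))
  intro z hz
  by_contra hgood
  apply hz
  simp only [Set.mem_union, Set.mem_ofPred_eq, not_or, not_exists, not_not, not_lt] at hgood
  obtain ⟨g1, g2, g3, g4, g5, g6⟩ := hgood
  obtain ⟨hfpaif, herr⟩ := good_event_conclusion hcsc hev P Q hα hα1 hβ hν hν1 hρ₀ hε hm₀ hTn hT
    hinv hn g1 g2 g3 g4 hψ hγ hfair (by linarith [(abs_le.1 g5).2])
    fun i => (g6 i).trans hestimate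
  exact ⟨hfpaif, by linarith⟩

end FailureEvents

theorem numRounds_pos {n : ℕ} (hn : 0 < n) {α ν : ℝ} (hα : 0 < α) (hν : 0 < ν) :
    0 < numRounds n α ν := by
  have h1 : (0 : ℝ) < n := by exact_mod_cast hn
  have h2 : 0 < Real.log (2 * n + 1) := Real.log_pos (by linarith)
  have := dualBound_pos hα hν
  exact Nat.ceil_pos.2 (by positivity)

theorem nonempty_split (T m₀ : ℕ) : Nonempty (Split T m₀ (T * m₀)) := ⟨finProdFinEquiv⟩

end FPAIF

/-- The constants `C`, `K`, `k` are absolute; `C * (…) ^ k` is the `Õ` of the sample sizes and `K`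
is the `O` of the error bound. -/
theorem theoremA4 :
    ∃ (C K : ℝ) (k : ℕ), 0 < C ∧ 0 < K ∧
    ∀ (𝒳 : Type*) [MeasurableSpace 𝒳] (𝓕 : Type*) [MeasurableSpace 𝓕] [FunLike 𝓕 𝒳 Bool]
      (Ω : Type*) [MeasurableSpace Ω]
      (P : Measure 𝒳) [IsProbabilityMeasure P] (Q : Measure 𝓕) [IsProbabilityMeasure Q]
      (μ : Measure Ω) [IsProbabilityMeasure μ]
      (ℋ : Set (𝒳 → Bool)) (d n m m₀ : ℕ) (α β ν δ : ℝ)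
      (csc : (Fin n → 𝒳 × ℝ × ℝ) → ℋ) (ρt : Ω → (Fin n → 𝒳) → Fin n → ℝ),
      -- labels are jointly measurable in the problem and the individual
      Measurable (fun z : 𝓕 × 𝒳 => z.1 z.2) →
      -- the hypothesis class contains the constants and has VC dimension `d`
      (fun _ => false) ∈ ℋ → (fun _ => true) ∈ ℋ → FPAIF.vcDim ℋ = d →
      FPAIF.IsCSCOracle ℋ csc →
      -- the parameters
      0 < α → α ≤ 1 → 0 < β → 0 < ν → ν ≤ 1 → 0 < δ → δ < 1 →
      0 < FPAIF.rhoInf 𝒳 Q →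
      m = FPAIF.numRounds n α ν * m₀ →
      -- the estimates of the rates `ρ` at the sampled individuals, independent of the problems
      Measurable (fun z : Ω × (Fin n → 𝒳) => ρt z.1 z.2) →
      (∀ᵐ z ∂(μ.prod (Measure.pi fun _ : Fin n => P)), ∀ i,
        |ρt z.1 z.2 i - FPAIF.rho Q (z.2 i)| ≤ Real.sqrt (Real.log n / (2 * m₀))) →
      -- the sample sizes
      C * ((m * d + Real.log (1 / (ν ^ 2 * δ))) / (α ^ 2 * β ^ 2)) *
        (1 + Real.log (n * m / (α * ν * δ))) ^ k ≤ n →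
      C * (Real.log n * Real.log (n / δ) / (FPAIF.rhoInf 𝒳 Q ^ 2 * ν ^ 4 * α ^ 4)) *
        (1 + Real.log (n / (α * ν * δ))) ^ k ≤ m →
      -- the failure event has probability at most `12 δ`
      FPAIF.sampleLaw μ P Q n m (FPAIF.numRounds n α ν) m₀
        {z | ¬ (
          let r := ρt z.1 z.2.1
          let S := FPAIF.batches z.2.2.1 z.2.2.2
          let ψ := FPAIF.psiHat csc α ν z.2.1 r S
          let γ := FPAIF.gammaHat csc α ν z.2.1 r S
          FPAIF.IsMapping ψ ∧
          FPAIF.IsFPAIF P Q ψ (6 * α) (2 * β) ∧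
          FPAIF.IsFPAIFAt P Q ψ (6 * α) (2 * β) γ ∧
          FPAIF.err P Q ψ ≤ FPAIF.OPT ℋ P Q α + K * ν + K * (α * β))}
        ≤ ENNReal.ofReal (12 * δ) := by
  refine ⟨10 ^ 8, 3, 1, by norm_num, by norm_num, ?_⟩
  intro 𝒳 _ 𝓕 _ _ Ω _ P _ Q _ μ _ ℋ d n m m₀ α β ν δ csc ρt hev hfalse _ hd hcsc hα hα1 hβ hν hν1
    hδ hδ1 hρ₀ hm hρt hest hn hmn
  have hsplit : Nonempty (FPAIF.Split (FPAIF.numRounds n α ν) m₀ m) := by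
    rw [hm]; exact FPAIF.nonempty_split _ _
  have hmp := FPAIF.measurePreserving_sampleLaw (μ := μ) (P := P) (Q := Q) (n := n)
    (T := FPAIF.numRounds n α ν) (m₀ := m₀) (m := m)
  -- At `n = 0` the logarithmic factor is 1 because `Real.log 0 = 0`, so the size condition would
  -- bound a positive number by 0.
  have hnpos : 0 < n := by
    rw [Nat.pos_iff_ne_zero]
    rintro rfl
    have h1 : 0 < Real.log (1 / (ν ^ 2 * δ)) := by
      refine Real.log_pos ((one_lt_div (by positivity)).2 ?_)
      have : ν ^ 2 ≤ 1 := pow_le_one₀ hν.le hν1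
      nlinarith
    have h2 : (0 : ℝ) < m * d + Real.log (1 / (ν ^ 2 * δ)) := by positivity
    have h3 : 0 < 10 ^ 8 * ((m * d + Real.log (1 / (ν ^ 2 * δ))) / (α ^ 2 * β ^ 2)) := by
      positivity
    simp only [Nat.cast_zero, zero_mul, zero_div, Real.log_zero, add_zero, one_pow, mul_one] at hn
    linarith
  have hT := FPAIF.numRounds_pos hnpos hα hν
  -- For `δ > 1 / 12` the claimed bound exceeds 1.
  rcases lt_or_ge (1 / 12) δ with hδ12 | hδ12
  · have hprob : IsProbabilityMeasure (FPAIF.batchLaw μ P Q n (FPAIF.numRounds n α ν) m₀) := by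
      unfold FPAIF.batchLaw; infer_instance
    calc _ ≤ FPAIF.sampleLaw μ P Q n m (FPAIF.numRounds n α ν) m₀ Set.univ :=
          measure_mono (Set.subset_univ _)
      _ = 1 := by rw [← Set.preimage_univ, hmp.measure_preimage nullMeasurableSet_univ]; simp
      _ ≤ _ := ENNReal.one_le_ofReal.2 (by linarith)
  -- For `α * β ≥ 1` also `β ≥ 1`, and both conclusions follow because probabilities and error rates
  -- are at most 1.
  rcases le_or_gt 1 (α * β) with hαβ | hαβ
  · refine le_of_eq_of_le ?_ zero_le
    convert measure_empty (μ := FPAIF.sampleLaw μ P Q n m (FPAIF.numRounds n α ν) m₀)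
    refine Set.eq_empty_of_forall_notMem fun z hz => hz ?_
    have hβ1 : 1 ≤ β := hαβ.trans (mul_le_of_le_one_left hβ.le hα1)
    have hψ := FPAIF.isMapping_psiHat hT hcsc hev α ν z.2.1 (ρt z.1 z.2.1)
      (FPAIF.batches z.2.2.1 z.2.2.2)
    have hat : FPAIF.IsFPAIFAt P Q (FPAIF.psiHat csc α ν z.2.1 (ρt z.1 z.2.1)
        (FPAIF.batches z.2.2.1 z.2.2.2)) (6 * α) (2 * β) (FPAIF.gammaHat csc α ν z.2.1
          (ρt z.1 z.2.1) (FPAIF.batches z.2.2.1 z.2.2.2)) :=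
      ⟨(FPAIF.gammaHat_mem_Icc α ν _ _ _).1, measureReal_le_one.trans (by linarith)⟩
    refine ⟨hψ, ⟨_, hat⟩, hat, ?_⟩
    have h1 := (FPAIF.err_mem_Icc P Q hψ.prob).2
    have h2 := FPAIF.OPT_nonneg (ℋ := ℋ) P Q α
    linarith
  · have hsize := FPAIF.sampleSizes hα hα1 hβ hν hν1 hδ hδ12 hαβ hρ₀ hm hn hmn
    have hfail := FPAIF.batchLaw_failure_le hev hfalse hd hcsc hα hα1 hβ hν hν1 hρ₀ rfl hT hρt hest
      hsize
    -- Only an inequality for preimages is used, as it does not require the failure event to be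
    -- measurable.
    refine le_trans (measure_mono fun z hz => ?_) ((hmp.measure_preimage_le _).trans (hfail.trans
      (ENNReal.ofReal_le_ofReal (by linarith))))
    intro hgood
    exact hz ⟨FPAIF.isMapping_psiHat hT hcsc hev α ν _ _ _, ⟨_, hgood.1⟩, hgood.1, hgood.2⟩
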